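/- **Conventions.** Link diagrams and fronts lie in the plane with horizontal coordinate $q$ and vertical coordinate $u$, are nonempty, and are in general position (cusps, vertical tangencies and crossings at pairwise distinct values of $q$). Regular isotopy of diagrams is generated by planar isotopy and the second and third Reidemeister moves. Let $X_+$ denote a crossing whose overpassing branch rises from left to right, $X_-$ the crossing whose overpassing branch descends from left to right, $\asymp_V$ the splice $\supset\subset$ of a crossing, and $\asymp_H$ its splice into two horizontal arcs. (So $X_+$ is a positive crossing if its branches run in opposite horizontal directions, and negative otherwise.) *Polynomials.* $R$ is the function from oriented link diagrams to $\mathbb Z[z^{\pm1},a^{\pm1}]$ that is invariant under regular isotopy and satisfies: $R(\bigcirc)=\frac{a-a^{-1}}{z}$; $R(K_+)-R(K_-)=z\,R(K_0)$ for diagrams that differ only at one place, where $K_+$ has a positive crossing, $K_-$ a negative crossing, and $K_0$ the splice that respects the orientation; and $R(K')=a\,R(K)$ if $K'$ arises from $K$ by replacing a rightmost point $\supset$ by a crossing $X_+$ followed by $\supset$ (a positive curl). $D$ is the function from unoriented link diagrams to $\mathbb Z[z^{\pm1},a^{\pm1}]$ that is invariant under regular isotopy and satisfies: $D(\bigcirc)=\frac{a-a^{-1}}{z}+1$;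 $D(X_+)-D(X_-)=z\,(D(\asymp_V)-D(\asymp_H))$; and $D(K')=a\,D(K)$ for the same kind of curl. *Fronts.* A generic front is a closed plane curve (possibly with several components) without vertical tangents, with transverse crossings and with semicubic cusps pointing left or right. Its morsification is the link diagram obtained by making every crossing an $X_+$, rounding every left cusp to $\subset$, and replacing every right cusp by $X_+$ followed by $\supset$. For a front $l$, $R(l)$ (with $l$ oriented) and $D(l)$ denote the polynomials of its morsification. *States.* A state $\sigma$ of an unoriented front $l$ consists of a choice, at each crossing of $l$, of leaving it, splicing it to two horizontal arcs, or splicing it to a right cusp followed by a left cusp, together with an orientation of the resulting front $l_\sigma$. The weight $[l,\sigma]$ is the product over the spliced crossings of the local weights: $ta^{-2}(t-t^{-1})$ if the crossing is spliced to a right cusp oriented downward followed by a left cusp oriented upward; $t^{-1}-t$ if it is spliced to two horizontal arcs, the upper one oriented rightward and the lower one leftward; and $0$ for every other splice. **Theorem.** The functions $R$ and $D$ exist and are uniquely determined by the properties above, and for every Legendrian knot (or link) given by a generic front $l$, $$D(l)(t-t^{-1},a^2t^{-1})=\sum_\sigma (at^{-1})^{\,c(\sigma)}\,[l,\sigma]\,R(l_\sigma)(t-t^{-1},a),$$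 where $\sigma$ runs over all states of $l$, and $c(\sigma)$ is the number of left cusps of $l_\sigma$ oriented upward plus the number of right cusps of $l_\sigma$ oriented downward. Here $t,a$ may be taken in any field, with $t$, $a$ and $t-t^{-1}$ nonzero; for independent variables this is an identity of rational functions. -/

import Mathlib

/-!
# Link diagrams, fronts, and their states

All plane curves live in the plane with horizontal coordinate `q` and vertical coordinate `u`, and
are in general position with respect to `q`: cusps, vertical tangencies and crossings occur at
pairwise distinct values of `q`.  Such a curve is recorded by listing, from left to right, its
elementary pieces.  Between two consecutive pieces the curve consists of finitely many graphs over
the `q`-axis, its strands, which are numbered `0, 1, 2, …` from bottom to top.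

A piece sits at a position `k`: the strands below the piece are `0, …, k - 1`.

Strands carry labels in a type `α` with a negation.  An oriented curve has labels in `Dir`
(`east` or `west`, the horizontal direction of the strand, with `-` reversing it); an unoriented
curve has labels in the one-point type `Unit`.
-/

namespace LegendrianJaeger

/-- The horizontal direction of an oriented strand: `east` is increasing `q`. -/
inductive Dir
  | east
  | west
  deriving DecidableEq

instance : Fintype Dir := ⟨{.east, .west}, by intro d; cases d <;> decide⟩

/-- `-` reverses a direction. -/
instance : InvolutiveNeg Dir where
  neg
    | .east => .west
    | .west => .east
  neg_neg d := by cases d <;> rfl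

/-- `replaceAt k inp out L`: if the list of labels `L` (from bottom to top) has the block `inp` at
positions `k, k + 1, …`, replace that block by `out`; otherwise fail. -/
def replaceAt {α : Type} [DecidableEq α] (k : ℕ) (inp out L : List α) : Option (List α) :=
  if k ≤ L.length ∧ inp <+: L.drop k then
    some (L.take k ++ out ++ L.drop (k + inp.length))
  else none

/-! ## Link diagrams -/

/-- An elementary piece of a link diagram.
* `cup k d` : a smooth leftmost point `⊂`; it creates the strands `k` (labelled `d`) and `k + 1`
  (labelled `-d`).
* `cap k d` : a smooth rightmost point `⊃`; it joins the strands `k` (labelled `d`) and `k + 1`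
  (labelled `-d`).
* `cross k o d e` : a crossing of the strands `k` and `k + 1`, which are labelled `d` and `e` on the
  left of the crossing.  If `o = true`, the overpassing branch is the one that rises from left to
  right; if `o = false`, it is the one that descends from left to right. -/
inductive Slice (α : Type)
  | cup (k : ℕ) (d : α)
  | cap (k : ℕ) (d : α)
  | cross (k : ℕ) (o : Bool) (d e : α)

namespace Slice

variable {α : Type}

/-- The position of a piece. -/
def pos : Slice α → ℕ
  | cup k _ => k
  | cap k _ => k
  | cross k _ _ _ => k

/-- The same piece at position `j`. -/
def setPos (j : ℕ) : Slice α → Slice α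
  | cup _ d => cup j d
  | cap _ d => cap j d
  | cross _ o d e => cross j o d e

/-- The labels, from bottom to top, of the strands that enter a piece from the left. -/
def input [Neg α] : Slice α → List α
  | cup _ _ => []
  | cap _ d => [d, -d]
  | cross _ _ d e => [d, e]

/-- The labels, from bottom to top, of the strands that leave a piece to the right. -/
def output [Neg α] : Slice α → List α
  | cup _ d => [d, -d]
  | cap _ _ => []
  | cross _ _ d e => [e, d]

/-- The labels of all the strands to the right of a piece, given those to its left. -/
def step [Neg α] [DecidableEq α] (L : List α) (s : Slice α) : Option (List α) :=
  replaceAt s.pos s.input s.output L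

end Slice

/-- A nonempty link diagram with strand labels in `α`: a word in the elementary pieces that fits
together, beginning and ending with no strands at all. -/
structure Diagram (α : Type) [Neg α] [DecidableEq α] where
  word : List (Slice α)
  nonempty : word ≠ []
  closed : word.foldlM Slice.step [] = some []

/-- Unoriented link diagrams. -/
abbrev UDiagram : Type := Diagram Unit

/-- Oriented link diagrams. -/
abbrev ODiagram : Type := Diagram Dir

/-! ### Regular isotopy -/

/-- The elementary local moves between words of pieces that generate regular isotopy: planar
isotopy (`exchange`, the two zigzags, and the two slides) and the second and third Reidemeister
moves.  The first Reidemeister move is absent. -/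
inductive LocalMove {α : Type} [Neg α] : List (Slice α) → List (Slice α) → Prop
  /-- Two pieces, `s` below and `t` above with `n` strands in between, change their order. -/
  | exchange (s t : Slice α) (n : ℕ) :
      LocalMove [s, t.setPos (s.pos + s.output.length + n)]
        [t.setPos (s.pos + s.input.length + n), s]
  | zigzag (k : ℕ) (d : α) : LocalMove [.cup k d, .cap (k + 1) (-d)] []
  | zigzag' (k : ℕ) (d : α) : LocalMove [.cup (k + 1) d, .cap k (-d)] []
  /-- A crossing passes a leftmost point of one of its branches. -/
  | cupSlide (k : ℕ) (o : Bool) (d e : α) :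
      LocalMove [.cup k d, .cross (k + 1) o (-d) e] [.cup (k + 1) d, .cross k (!o) e d]
  /-- A crossing passes a rightmost point of one of its branches. -/
  | capSlide (k : ℕ) (o : Bool) (d e : α) :
      LocalMove [.cross (k + 1) o e (-d), .cap k d] [.cross k (!o) d e, .cap (k + 1) d]
  | reidemeisterTwo (k : ℕ) (o : Bool) (d e : α) :
      LocalMove [.cross k o d e, .cross k (!o) e d] []
  | reidemeisterThree (k : ℕ) (o : Bool) (d e f : α) :
      LocalMove [.cross k o d e, .cross (k + 1) o d f, .cross k o e f]
        [.cross (k + 1) o e f, .cross k o d f, .cross (k + 1) o d e]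

/-- Two diagrams differ by a single elementary move. -/
def Diagram.Move {α : Type} [Neg α] [DecidableEq α] (K K' : Diagram α) : Prop :=
  ∃ A B x y : List (Slice α), LocalMove x y ∧ K.word = A ++ x ++ B ∧ K'.word = A ++ y ++ B

/-- Regular isotopy of link diagrams. -/
def Diagram.RegularIsotopic {α : Type} [Neg α] [DecidableEq α] : Diagram α → Diagram α → Prop :=
  Relation.EqvGen Diagram.Move

/-! ### Laurent polynomials in two variables -/

/-- Laurent polynomials with integer coefficients in the variables `z` and `a`; the pair `(i, j)`
is the monomial `z ^ i * a ^ j`. -/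
abbrev LaurentZA : Type := AddMonoidAlgebra ℤ (ℤ × ℤ)

/-- The monomial `z ^ i * a ^ j`. -/
noncomputable def mono (i j : ℤ) : LaurentZA := AddMonoidAlgebra.single (i, j) 1

/-- The value `p(x, y)` of a Laurent polynomial `p` at `z = x`, `a = y`. -/
noncomputable def LaurentZA.eval {F : Type*} [Field F] (x y : F) (p : LaurentZA) : F :=
  p.coeff.sum fun m c => (c : F) * x ^ m.1 * y ^ m.2

/-! ### The skein relations -/

/-- The defining properties of the regular isotopy version `R` of the HOMFLY polynomial.

A crossing `cross k true d e` is positive if its branches run in opposite horizontal directions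
(both upward or both downward), and negative if they run in the same horizontal direction. -/
structure IsHomflyR (R : ODiagram → LaurentZA) : Prop where
  regularIsotopy : ∀ K K' : ODiagram, K.RegularIsotopic K' → R K = R K'
  /-- `R(○) = (a - a⁻¹) / z`. -/
  circle : ∀ (K : ODiagram) (d : Dir), K.word = [.cup 0 d, .cap 0 d] →
    R K = mono (-1) 1 - mono (-1) (-1)
  /-- `R(positive) - R(negative) = z * R(spliced)` where both branches go up or both go down. -/
  skeinVertical : ∀ (P N O : ODiagram) (A B : List (Slice Dir)) (k : ℕ) (d : Dir),
    P.word = A ++ [.cross k true d (-d)] ++ B →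
    N.word = A ++ [.cross k false d (-d)] ++ B →
    O.word = A ++ [.cap k d, .cup k (-d)] ++ B →
    R P - R N = mono 1 0 * R O
  /-- `R(positive) - R(negative) = z * R(spliced)` where both branches go right or both go left. -/
  skeinHorizontal : ∀ (P N O : ODiagram) (A B : List (Slice Dir)) (k : ℕ) (d : Dir),
    P.word = A ++ [.cross k false d d] ++ B →
    N.word = A ++ [.cross k true d d] ++ B →
    O.word = A ++ B →
    R P - R N = mono 1 0 * R O
  /-- A positive curl on a rightmost point contributes a factor `a`. -/
  curl : ∀ (K K' : ODiagram) (A B : List (Slice Dir)) (k : ℕ) (d : Dir),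
    K.word = A ++ [.cross k true d (-d), .cap k (-d)] ++ B →
    K'.word = A ++ [.cap k d] ++ B →
    R K = mono 0 1 * R K'

/-- The defining properties of the regular isotopy version `D` of the (Dubrovnik form of the)
Kauffman polynomial of unoriented diagrams. -/
structure IsKauffmanD (D : UDiagram → LaurentZA) : Prop where
  regularIsotopy : ∀ K K' : UDiagram, K.RegularIsotopic K' → D K = D K'
  /-- `D(○) = (a - a⁻¹) / z + 1`. -/
  circle : ∀ K : UDiagram, K.word = [.cup 0 (), .cap 0 ()] →
    D K = mono (-1) 1 - mono (-1) (-1) + 1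
  /-- The difference of the two crossings is `z * (D( ⊃⊂ ) - D( ═ ))`. -/
  skein : ∀ (P N V H : UDiagram) (A B : List (Slice Unit)) (k : ℕ),
    P.word = A ++ [.cross k true () ()] ++ B →
    N.word = A ++ [.cross k false () ()] ++ B →
    V.word = A ++ [.cap k (), .cup k ()] ++ B →
    H.word = A ++ B →
    D P - D N = mono 1 0 * (D V - D H)
  /-- A positive curl on a rightmost point contributes a factor `a`. -/
  curl : ∀ (K K' : UDiagram) (A B : List (Slice Unit)) (k : ℕ),
    K.word = A ++ [.cross k true () (), .cap k ()] ++ B →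
    K'.word = A ++ [.cap k ()] ++ B →
    D K = mono 0 1 * D K'

/-- The polynomial `R`: the function determined by the properties `IsHomflyR`. -/
noncomputable def homflyR : ODiagram → LaurentZA := Classical.epsilon IsHomflyR

/-- The polynomial `D`: the function determined by the properties `IsKauffmanD`. -/
noncomputable def kauffmanD : UDiagram → LaurentZA := Classical.epsilon IsKauffmanD

/-! ## Fronts -/

/-- An elementary piece of a generic front.
* `leftCusp k d` : a cusp pointing leftward, whose lower branch is the new strand `k` (labelled `d`)
  and whose upper branch is the new strand `k + 1` (labelled `-d`).
* `rightCusp k d` : a cusp pointing rightward, whose lower branch is the strand `k` (labelled `d`)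
  and whose upper branch is the strand `k + 1` (labelled `-d`).
* `crossing k d e` : a transverse crossing of the strands `k` and `k + 1`, which are labelled `d`
  and `e` on the left of the crossing. -/
inductive FrontPiece (α : Type)
  | leftCusp (k : ℕ) (d : α)
  | rightCusp (k : ℕ) (d : α)
  | crossing (k : ℕ) (d e : α)

namespace FrontPiece

variable {α : Type}

/-- The position of a piece. -/
def pos : FrontPiece α → ℕ
  | leftCusp k _ => k
  | rightCusp k _ => k
  | crossing k _ _ => k

/-- The labels, from bottom to top, of the strands that enter a piece from the left. -/
def input [Neg α] : FrontPiece α → List α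
  | leftCusp _ _ => []
  | rightCusp _ d => [d, -d]
  | crossing _ d e => [d, e]

/-- The labels, from bottom to top, of the strands that leave a piece to the right. -/
def output [Neg α] : FrontPiece α → List α
  | leftCusp _ d => [d, -d]
  | rightCusp _ _ => []
  | crossing _ d e => [e, d]

/-- The labels of all the strands to the right of a piece, given those to its left. -/
def step [Neg α] [DecidableEq α] (L : List α) (s : FrontPiece α) : Option (List α) :=
  replaceAt s.pos s.input s.output L

/-- The piece of the morsification that replaces a piece of a front: a crossing becomes the
crossing whose overpassing branch is the one of larger slope, a left cusp is rounded, and a right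
cusp becomes a curl, that is, a crossing of the same kind followed by a rounded rightmost point. -/
def morsify [Neg α] : FrontPiece α → List (Slice α)
  | leftCusp k d => [.cup k d]
  | rightCusp k d => [.cross k true d (-d), .cap k (-d)]
  | crossing k d e => [.cross k true d e]

end FrontPiece

/-- A nonempty generic front (of a Legendrian knot or link) with strand labels in `α`. -/
structure Front (α : Type) [Neg α] [DecidableEq α] where
  word : List (FrontPiece α)
  nonempty : word ≠ []
  closed : word.foldlM FrontPiece.step [] = some []

theorem replaceAt_eq_some {α : Type} [DecidableEq α] {k : ℕ} {inp out L M : List α} :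
    replaceAt k inp out L = some M ↔
      ∃ P S, P.length = k ∧ L = P ++ inp ++ S ∧ M = P ++ out ++ S := by
  unfold replaceAt
  constructor
  · intro h
    split_ifs at h with hc
    obtain ⟨hk, S, hS⟩ := hc
    refine ⟨L.take k, S, by simp [hk], ?_, ?_⟩
    · rw [List.append_assoc, hS, List.take_append_drop]
    · have : L.drop (k + inp.length) = S := by
        rw [← List.drop_drop, ← hS, List.drop_left]
      rw [this] at h
      exact (Option.some.inj h).symm
  · rintro ⟨P, S, rfl, rfl, rfl⟩
    rw [if_pos]
    · have h1 : (P ++ inp ++ S).take P.length = P := by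
        rw [List.append_assoc, List.take_left]
      have h2 : (P ++ inp ++ S).drop (P.length + inp.length) = S := by
        rw [← List.length_append, List.drop_left]
      rw [h1, h2]
    · constructor
      · simp
      · rw [List.append_assoc, List.drop_left]
        exact ⟨S, rfl⟩

theorem foldlM_morsify {α : Type} [InvolutiveNeg α] [DecidableEq α] (s : FrontPiece α)
    {L M : List α} (h : FrontPiece.step L s = some M) :
    s.morsify.foldlM Slice.step L = some M := by
  unfold FrontPiece.step at h
  cases s with
  | leftCusp k d =>
    simpa [FrontPiece.morsify, Slice.step, Slice.pos, Slice.input, Slice.output, FrontPiece.pos,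
      FrontPiece.input, FrontPiece.output] using h
  | crossing k d e =>
    simpa [FrontPiece.morsify, Slice.step, Slice.pos, Slice.input, Slice.output, FrontPiece.pos,
      FrontPiece.input, FrontPiece.output] using h
  | rightCusp k d =>
    obtain ⟨P, S, hP, rfl, rfl⟩ := replaceAt_eq_some.1 h
    have h1 : Slice.step (P ++ [d, -d] ++ S) (.cross k true d (-d)) =
        some (P ++ [-d, d] ++ S) := replaceAt_eq_some.2 ⟨P, S, hP, rfl, rfl⟩
    have h2 : Slice.step (P ++ [-d, d] ++ S) (.cap k (-d)) = some (P ++ [] ++ S) :=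
      replaceAt_eq_some.2 ⟨P, S, hP, by simp [Slice.input], rfl⟩
    simp only [FrontPiece.morsify, FrontPiece.input, FrontPiece.output, List.foldlM_cons,
      List.foldlM_nil, h1, Option.bind_eq_bind, Option.bind_some, h2]
    rfl

theorem foldlM_flatMap_morsify {α : Type} [InvolutiveNeg α] [DecidableEq α]
    (w : List (FrontPiece α)) : ∀ {L M : List α}, w.foldlM FrontPiece.step L = some M →
      (w.flatMap FrontPiece.morsify).foldlM Slice.step L = some M := by
  induction w with
  | nil => intro L M h; simpa using h
  | cons s w ih =>
    intro L M h
    rw [List.foldlM_cons, Option.bind_eq_bind, Option.bind_eq_some_iff] at h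
    obtain ⟨N, h1, h2⟩ := h
    rw [List.flatMap_cons, List.foldlM_append, foldlM_morsify s h1]
    exact ih h2

/-- The morsification of a front. -/
def Front.morsification {α : Type} [InvolutiveNeg α] [DecidableEq α] (l : Front α) :
    Diagram α where
  word := l.word.flatMap FrontPiece.morsify
  nonempty := by
    obtain ⟨w, hw, -⟩ := l
    cases w with
    | nil => exact absurd rfl hw
    | cons s w => cases s <;> simp [FrontPiece.morsify]
  closed := foldlM_flatMap_morsify l.word l.closed

/-! ## States of a front -/

/-- What a state does at a piece of an unoriented front: it orients cusps, and it leaves a crossing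
unspliced, or splices it horizontally, or splices it vertically, with orientations.
* `keep k d e` : the crossing stays; its strands have the directions `d` (lower) and `e` (upper) on
  its left.
* `spliceH k d e` : the crossing is replaced by two horizontal arcs, with directions `d` (lower arc)
  and `e` (upper arc).
* `spliceV k d e` : the crossing is replaced by a right cusp, with lower branch of direction `d`,
  followed by a left cusp, with lower branch of direction `e`. -/
inductive LocalState
  | leftCusp (k : ℕ) (d : Dir)
  | rightCusp (k : ℕ) (d : Dir)
  | keep (k : ℕ) (d e : Dir)
  | spliceH (k : ℕ) (d e : Dir)
  | spliceV (k : ℕ) (d e : Dir)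

namespace LocalState

/-- The piece of the unspliced unoriented front. -/
def original : LocalState → FrontPiece Unit
  | leftCusp k _ => .leftCusp k ()
  | rightCusp k _ => .rightCusp k ()
  | keep k _ _ => .crossing k () ()
  | spliceH k _ _ => .crossing k () ()
  | spliceV k _ _ => .crossing k () ()

/-- The directions of all the strands to the right of a piece, given those to its left, after
splicing; it fails if the prescribed directions do not fit. -/
def stepState (L : List Dir) : LocalState → Option (List Dir)
  | leftCusp k d => FrontPiece.step L (.leftCusp k d)
  | rightCusp k d => FrontPiece.step L (.rightCusp k d)
  | keep k d e => FrontPiece.step L (.crossing k d e)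
  | spliceH k d e => replaceAt k [d, e] [d, e] L
  | spliceV k d e => (FrontPiece.step L (.rightCusp k d)).bind
      fun M => FrontPiece.step M (.leftCusp k e)

/-- The pieces of the spliced oriented front. -/
def result : LocalState → List (FrontPiece Dir)
  | leftCusp k d => [.leftCusp k d]
  | rightCusp k d => [.rightCusp k d]
  | keep k d e => [.crossing k d e]
  | spliceH _ _ _ => []
  | spliceV k d e => [.rightCusp k d, .leftCusp k e]

/-- The local weight. It is `1` away from the spliced crossings. A vertical splice has weight
`t a⁻² (t - t⁻¹)` if its right cusp is oriented downward and its left cusp upward; a horizontal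
splice has weight `t⁻¹ - t` if its upper arc goes right and its lower arc goes left. All other
splices have weight `0`. -/
def weight {F : Type*} [Field F] (t a : F) : LocalState → F
  | leftCusp _ _ => 1
  | rightCusp _ _ => 1
  | keep _ _ _ => 1
  | spliceV _ .west .west => t * (a ^ 2)⁻¹ * (t - t⁻¹)
  | spliceV _ _ _ => 0
  | spliceH _ .west .east => t⁻¹ - t
  | spliceH _ _ _ => 0

theorem foldlM_result (s : LocalState) {L M : List Dir} (h : stepState L s = some M) :
    s.result.foldlM FrontPiece.step L = some M := by
  cases s with
  | leftCusp k d => simpa [stepState, result] using h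
  | rightCusp k d => simpa [stepState, result] using h
  | keep k d e => simpa [stepState, result] using h
  | spliceH k d e =>
    obtain ⟨P, S, -, rfl, rfl⟩ := replaceAt_eq_some.1 h
    rfl
  | spliceV k d e => simpa [stepState, result] using h

theorem foldlM_flatMap_result (τ : List LocalState) : ∀ {L M : List Dir},
    τ.foldlM stepState L = some M → (τ.flatMap result).foldlM FrontPiece.step L = some M := by
  induction τ with
  | nil => intro L M h; simpa using h
  | cons s w ih =>
    intro L M h
    rw [List.foldlM_cons, Option.bind_eq_bind, Option.bind_eq_some_iff] at h
    obtain ⟨N, h1, h2⟩ := h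
    rw [List.flatMap_cons, List.foldlM_append, foldlM_result s h1]
    exact ih h2

end LocalState

/-- A state of an unoriented front `l`: a choice, at each crossing of `l`, of leaving it or of
splicing it in one of two ways, together with an orientation of the resulting front. -/
@[ext]
structure FrontState (l : Front Unit) where
  pieces : List LocalState
  original : pieces.map LocalState.original = l.word
  oriented : pieces.foldlM LocalState.stepState [] = some []

namespace FrontState

variable {l : Front Unit}

/-- The oriented front `l_σ` obtained by splicing. -/
def front (σ : FrontState l) : Front Dir where
  word := σ.pieces.flatMap LocalState.result
  nonempty := by
    obtain ⟨τ, h1, h2⟩ := σ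
    cases τ with
    | nil => exact absurd h1.symm l.nonempty
    | cons s w =>
      cases s <;>
        simp [LocalState.stepState, LocalState.result, replaceAt, FrontPiece.step,
          FrontPiece.input] at h2 ⊢
  closed := LocalState.foldlM_flatMap_result σ.pieces σ.oriented

/-- The weight `[l, σ]`: the product of the local weights. -/
def weight {F : Type*} [Field F] (t a : F) (σ : FrontState l) : F :=
  (σ.pieces.map (LocalState.weight t a)).prod

theorem finite_fiber (w : List (FrontPiece Unit)) :
    {τ : List LocalState | τ.map LocalState.original = w}.Finite := by
  induction w with
  | nil => simp
  | cons p w ih =>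
    have hp : {s : LocalState | s.original = p}.Finite := by
      let k := p.pos
      have hfin : ((Set.range fun d => LocalState.leftCusp k d) ∪
          (Set.range fun d => LocalState.rightCusp k d) ∪
          (Set.range fun d : Dir × Dir => LocalState.keep k d.1 d.2) ∪
          (Set.range fun d : Dir × Dir => LocalState.spliceH k d.1 d.2) ∪
          (Set.range fun d : Dir × Dir => LocalState.spliceV k d.1 d.2)).Finite := by
        refine Set.Finite.union (Set.Finite.union (Set.Finite.union (Set.Finite.union ?_ ?_) ?_)
          ?_) ?_ <;> exact Set.finite_range _
      refine hfin.subset ?_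
      rintro s rfl
      cases s <;> simp [k, LocalState.original, FrontPiece.pos]
    refine (hp.image2 List.cons ih).subset ?_
    rintro τ hτ
    cases τ with
    | nil => simp at hτ
    | cons s τ =>
      simp only [Set.mem_ofPred_eq, List.map_cons, List.cons.injEq] at hτ
      exact ⟨s, hτ.1, τ, hτ.2, rfl⟩

instance : Finite (FrontState l) :=
  have := (finite_fiber l.word).to_subtype
  Finite.of_injective
    (fun σ : FrontState l => (⟨σ.pieces, σ.original⟩ :
      {τ : List LocalState | τ.map LocalState.original = l.word}))
    fun _ _ h => FrontState.ext (congrArg Subtype.val h)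

noncomputable instance : Fintype (FrontState l) := Fintype.ofFinite _

end FrontState

/-- A cusp pointing leftward and oriented upward: the curve arrives along the lower branch, going
left, and leaves along the upper branch, going right. -/
def FrontPiece.isLeftCuspUp : FrontPiece Dir → Bool
  | .leftCusp _ .west => true
  | _ => false

/-- A cusp pointing rightward and oriented downward: the curve arrives along the upper branch, going
right, and leaves along the lower branch, going left. -/
def FrontPiece.isRightCuspDown : FrontPiece Dir → Bool
  | .rightCusp _ .west => true
  | _ => false

/-- The number of left cusps oriented upward. -/
def Front.leftCuspsUp (l : Front Dir) : ℕ := l.word.countP FrontPiece.isLeftCuspUp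

/-- The number of right cusps oriented downward. -/
def Front.rightCuspsDown (l : Front Dir) : ℕ := l.word.countP FrontPiece.isRightCuspDown

end LegendrianJaeger

open LegendrianJaeger

set_option linter.unusedSectionVars false
set_option linter.unusedSimpArgs false

namespace LegendrianJaeger

/-! ## Words of pieces between two boundaries -/

section Typing

variable {α : Type} [InvolutiveNeg α] [DecidableEq α]

/-! A diagram is cut by a vertical line. Fixing the part to the left of the cut turns a function of
closed diagrams into a functional of the part to the right, and `act` moves the cut. The functionals
that respect the moves, the skein relation and the curl relation form `skeinSpace`; one definition,
`IsSkein`, serves `R` (labels in `Dir`) and `D` (labels in `Unit`).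

Uniqueness: a skein functional composed with an arbitrary word is a linear combination of its
compositions with standard systems of arcs. Indeed a piece slides to the left past the newest arc,
or it meets an end of that arc and is simplified by Reidemeister moves, curls and the skein relation
(`piecesPreserve`). When there are no strands the only standard system is empty, so `φ w = c • φ []`
with `c` in the ground ring (`skein_mem_span`). Applied to a pair of functionals, this is
uniqueness. Applied to a family of rational functionals, on which Laurent polynomials act through
evaluation at a family of points, it shows that the values at the points come from one Laurent
polynomial (`exists_laurent_skein`). Existence therefore needs to be shown only at enough special
points.

Existence of `R`: at `z = t - t⁻¹`, `a = t ^ N` there is a vertex model with `N` colors, a sum over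
colorings with local weights (`Model.value_mem`). These points determine a Laurent polynomial.

Jaeger's formula: let `φ` be a skein functional of oriented words at `(t - t⁻¹, a)`. For every
unoriented word, not just for morsified fronts, sum the values of `φ` over orientations and splices
with suitable local weights, for crossings of both kinds. Modulo the relations of `φ`, this sum is
invariant under the moves, satisfies the Kauffman skein relation, and gains `a ^ 2 * t⁻¹` from a
curl (`Jaeger.jaegerEq_regular`, `Jaeger.op_skein`, `Jaeger.op_curl`); so it is a skein functional
at `(t - t⁻¹, a ^ 2 * t⁻¹)` (`Jaeger.value_mem`). At rational points this yields the existence of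
`D` by interpolation, and over any field uniqueness identifies it with the evaluation of `D`. On a
morsified front each right cusp carries a curl, worth `a ^ 2 * t⁻¹` before and `a` after the
expansion; absorbing these factors turns the local weights into those of the statement
(`Jaeger.opWord_morsify`). -/

/-- The word `w` fits together, from the strands `L` on its left to the strands `M` on its right. -/
def Typed (L : List α) (w : List (Slice α)) (M : List α) : Prop :=
  w.foldlM Slice.step L = some M

theorem replaceAt_append_length (P : List α) (inp out L : List α) :
    replaceAt P.length inp out (P ++ L) = (replaceAt 0 inp out L).map (P ++ ·) := by
  simp [replaceAt, ← List.drop_drop]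

theorem replaceAt_append_length_add (P : List α) (k : ℕ) (inp out L : List α) :
    replaceAt (P.length + k) inp out (P ++ L) = (replaceAt k inp out L).map (P ++ ·) := by
  simp only [replaceAt, List.length_append, Nat.add_le_add_iff_left, Nat.add_assoc,
    List.drop_length_add_append, List.take_length_add_append]
  split_ifs <;> simp

theorem replaceAt_succ_cons (k : ℕ) (c : α) (inp out L : List α) :
    replaceAt (k + 1) inp out (c :: L) = (replaceAt k inp out L).map (c :: ·) := by
  simp only [replaceAt, List.length_cons, Nat.add_le_add_iff_right, List.drop_succ_cons,
    List.take_succ_cons, Nat.add_right_comm k 1]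
  split_ifs <;> simp

theorem replaceAt_zero_nil (out L : List α) : replaceAt 0 [] out L = some (out ++ L) := by
  simp [replaceAt]

theorem replaceAt_zero_pair (d e : α) (out L : List α) :
    replaceAt 0 [d, e] out (d :: e :: L) = some (out ++ L) := by
  simp [replaceAt]

@[simp] theorem typed_nil {L M : List α} : Typed L [] M ↔ L = M := by simp [Typed]

theorem typed_cons {L M : List α} {s : Slice α} {w : List (Slice α)} :
    Typed L (s :: w) M ↔ ∃ N, s.step L = some N ∧ Typed N w M := by
  simp [Typed, Option.bind_eq_some_iff]

theorem typed_append {L M : List α} {v w : List (Slice α)} :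
    Typed L (v ++ w) M ↔ ∃ N, Typed L v N ∧ Typed N w M := by
  simp [Typed, List.foldlM_append, Option.bind_eq_some_iff]

theorem Typed.append {L M N : List α} {v w : List (Slice α)} (hv : Typed L v N)
    (hw : Typed N w M) : Typed L (v ++ w) M := typed_append.2 ⟨N, hv, hw⟩

theorem Typed.det {L M N : List α} {w : List (Slice α)} (h : Typed L w M) (h' : Typed L w N) :
    M = N := Option.some.inj (h.symm.trans h')

theorem step_eq_some {s : Slice α} {L M : List α} :
    s.step L = some M ↔
      ∃ P S, P.length = s.pos ∧ L = P ++ s.input ++ S ∧ M = P ++ s.output ++ S :=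
  replaceAt_eq_some

theorem step_unfold (L : List α) (s : Slice α) :
    s.step L = replaceAt s.pos s.input s.output L := rfl

@[simp] theorem Slice.pos_setPos (j : ℕ) (s : Slice α) : (s.setPos j).pos = j := by cases s <;> rfl
@[simp] theorem Slice.setPos_pos (s : Slice α) : s.setPos s.pos = s := by cases s <;> rfl
@[simp] theorem Slice.input_setPos (j : ℕ) (s : Slice α) : (s.setPos j).input = s.input := by
  cases s <;> rfl
@[simp] theorem Slice.output_setPos (j : ℕ) (s : Slice α) : (s.setPos j).output = s.output := by
  cases s <;> rfl

/-- A piece at position `|P|` acting between `P` and `S`. -/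
theorem typed_setPos (s : Slice α) (P S : List α) (k : ℕ) (hk : P.length = k) :
    Typed (P ++ s.input ++ S) [s.setPos k] (P ++ s.output ++ S) :=
  typed_cons.2 ⟨_, step_eq_some.2 ⟨P, S, by simpa using hk, by simp, rfl⟩, by simp⟩

-- With positions in the form `P.length` or `P.length + k`, these rules let `simp` decide whether a
-- concrete word fits together. This is why later proofs substitute the equation for the position
-- before they discharge typing goals.
@[simp] theorem typed_cup {P L M : List α} {d : α} {w : List (Slice α)} :
    Typed (P ++ L) (.cup P.length d :: w) M ↔ Typed (P ++ d :: -d :: L) w M := by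
  simp [typed_cons, step_unfold, Slice.pos, Slice.input, Slice.output, replaceAt_append_length,
    replaceAt_zero_nil]

@[simp] theorem typed_cup_add {P L M : List α} {d : α} {k : ℕ} {w : List (Slice α)} :
    Typed (P ++ L) (.cup (P.length + k) d :: w) M ↔
      ∃ N, replaceAt k [] [d, -d] L = some N ∧ Typed (P ++ N) w M := by
  simp [typed_cons, step_unfold, Slice.pos, Slice.input, Slice.output, replaceAt_append_length_add]

@[simp] theorem typed_cap {P L M : List α} {d : α} {w : List (Slice α)} :
    Typed (P ++ d :: -d :: L) (.cap P.length d :: w) M ↔ Typed (P ++ L) w M := by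
  simp [typed_cons, step_unfold, Slice.pos, Slice.input, Slice.output, replaceAt_append_length,
    replaceAt_zero_pair]

@[simp] theorem typed_cap_neg {P L M : List α} {d : α} {w : List (Slice α)} :
    Typed (P ++ -d :: d :: L) (.cap P.length (-d) :: w) M ↔ Typed (P ++ L) w M := by
  simpa using typed_cap (P := P) (L := L) (M := M) (d := -d) (w := w)

@[simp] theorem typed_cap_add {P L M : List α} {d : α} {k : ℕ} {w : List (Slice α)} :
    Typed (P ++ L) (.cap (P.length + k) d :: w) M ↔
      ∃ N, replaceAt k [d, -d] [] L = some N ∧ Typed (P ++ N) w M := by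
  simp [typed_cons, step_unfold, Slice.pos, Slice.input, Slice.output, replaceAt_append_length_add]

@[simp] theorem typed_cross {P L M : List α} {o : Bool} {d e : α} {w : List (Slice α)} :
    Typed (P ++ d :: e :: L) (.cross P.length o d e :: w) M ↔ Typed (P ++ e :: d :: L) w M := by
  simp [typed_cons, step_unfold, Slice.pos, Slice.input, Slice.output, replaceAt_append_length,
    replaceAt_zero_pair]

@[simp] theorem typed_cross_add {P L M : List α} {o : Bool} {d e : α} {k : ℕ}
    {w : List (Slice α)} :
    Typed (P ++ L) (.cross (P.length + k) o d e :: w) M ↔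
      ∃ N, replaceAt k [d, e] [e, d] L = some N ∧ Typed (P ++ N) w M := by
  simp [typed_cons, step_unfold, Slice.pos, Slice.input, Slice.output, replaceAt_append_length_add]

attribute [simp] replaceAt_succ_cons replaceAt_zero_nil replaceAt_zero_pair

end Typing

/-! ## Congruences of words -/

section Congruence

variable {α : Type} [InvolutiveNeg α] [DecidableEq α]

/-- An equivalence relation between words that start at the strands `L`, compatible with
composition and with the exchange of distant pieces. -/
structure TangleCongr (E : List α → List (Slice α) → List (Slice α) → Prop) : Prop where
  refl : ∀ L x, E L x x
  symm : ∀ {L x y}, E L x y → E L y x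
  trans : ∀ {L x y w}, E L x y → E L y w → E L x w
  -- The relation is indexed by the strands on the left, so the left context has to be typed; the
  -- right context is free.
  ctx : ∀ {L M : List α} (A B : List (Slice α)) {x y : List (Slice α)},
    Typed L A M → E M x y → E L (A ++ x ++ B) (A ++ y ++ B)
  exchange : ∀ (s t : Slice α) (P Q S : List α), P.length = s.pos →
    E (P ++ s.input ++ Q ++ t.input ++ S)
      [s, t.setPos (s.pos + s.output.length + Q.length)]
      [t.setPos (s.pos + s.input.length + Q.length), s]

/-- A congruence that contains planar isotopy and the second Reidemeister move. -/
structure IsotopyCongr (E : List α → List (Slice α) → List (Slice α) → Prop) : Prop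
    extends TangleCongr E where
  zigzag : ∀ (P S : List α) (k : ℕ) (d : α), P.length = k →
    E (P ++ d :: S) [.cup k d, .cap (k + 1) (-d)] []
  zigzag' : ∀ (P S : List α) (k : ℕ) (d : α), P.length = k →
    E (P ++ -d :: S) [.cup (k + 1) d, .cap k (-d)] []
  cupSlide : ∀ (P S : List α) (k : ℕ) (o : Bool) (d e : α), P.length = k →
    E (P ++ e :: S) [.cup k d, .cross (k + 1) o (-d) e] [.cup (k + 1) d, .cross k (!o) e d]
  reidemeisterTwo : ∀ (P S : List α) (k : ℕ) (o : Bool) (d e : α), P.length = k →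
    E (P ++ d :: e :: S) [.cross k o d e, .cross k (!o) e d] []

/-- The third Reidemeister move for three strands with given labels. -/
def HasR3 (E : List α → List (Slice α) → List (Slice α) → Prop) (o : Bool) (d e f : α) : Prop :=
  ∀ (P S : List α) (k : ℕ), P.length = k → E (P ++ d :: e :: f :: S)
    [.cross k o d e, .cross (k + 1) o d f, .cross k o e f]
    [.cross (k + 1) o e f, .cross k o d f, .cross (k + 1) o d e]

variable {E : List α → List (Slice α) → List (Slice α) → Prop}

namespace TangleCongr

/-- Exchange, inside a word. -/
theorem exch (h : TangleCongr E) {L : List α} (A B : List (Slice α)) (s t : Slice α)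
    (P Q S : List α) (i j : ℕ) (hP : P.length = s.pos)
    (hA : Typed L A (P ++ s.input ++ Q ++ t.input ++ S))
    (hi : s.pos + s.output.length + Q.length = i) (hj : s.pos + s.input.length + Q.length = j) :
    E L (A ++ s :: t.setPos i :: B) (A ++ t.setPos j :: s :: B) := by
  subst hi hj
  simpa using h.ctx A B hA (h.exchange s t P Q S hP)

theorem ctx_left (h : TangleCongr E) {L M : List α} (A : List (Slice α)) {x y : List (Slice α)}
    (hA : Typed L A M) (hxy : E M x y) : E L (A ++ x) (A ++ y) := by
  simpa using h.ctx A [] hA hxy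

theorem ctx_right (h : TangleCongr E) {L : List α} (B : List (Slice α)) {x y : List (Slice α)}
    (hxy : E L x y) : E L (x ++ B) (y ++ B) := by
  simpa using h.ctx [] B (typed_nil.2 rfl) hxy

end TangleCongr

namespace IsotopyCongr

/-- A zigzag created on the strand labelled `-d` supplies a leftmost point, the crossing passes that
point by `cupSlide`, and the original rightmost point is then part of a zigzag that is straightened.
So this slide need not be a field of `IsotopyCongr`. -/
theorem capSlide (h : IsotopyCongr E) (P S : List α) (k : ℕ) (o : Bool) (d e : α)
    (hk : P.length = k) :
    E (P ++ d :: e :: -d :: S) [.cross (k + 1) o e (-d), .cap k d]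
      [.cross k (!o) d e, .cap (k + 1) d] := by
  subst hk
  set k := P.length
  refine h.trans (y := [.cup (k + 2) (-d), .cap (k + 3) d, .cross (k + 1) o e (-d), .cap k d])
    (h.symm ?_) ?_
  · have key := h.zigzag (P ++ [d, e]) S (k + 2) (-d) (by simp [k])
    simp only [neg_neg, Bool.not_not] at key
    exact h.ctx [] [.cross (k + 1) o e (-d), .cap k d] (M := (P ++ [d, e]) ++ -d :: S) (by simp) key
  refine h.trans (y := [.cup (k + 2) (-d), .cross (k + 1) o e (-d), .cap (k + 3) d, .cap k d])
    (h.symm ?_) ?_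
  · exact h.exch [.cup (k + 2) (-d)] [.cap k d] (.cross (k + 1) o e (-d)) (.cap 0 d) (P ++ [d]) []
      S (k + 3) (k + 3) (by simp [k, Slice.pos]) (by simp [k, Slice.input]) rfl rfl
  refine h.trans (y := [.cup (k + 1) (-d), .cross (k + 2) (!o) d e, .cap (k + 3) d, .cap k d])
    (h.symm ?_) ?_
  · have key := h.cupSlide (P ++ [d]) (-d :: S) (k + 1) (!o) (-d) e (by simp [k])
    simp only [neg_neg, Bool.not_not] at key
    exact h.ctx [] [.cap (k + 3) d, .cap k d] (M := (P ++ [d]) ++ e :: -d :: S) (by simp) key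
  refine h.trans (y := [.cup (k + 1) (-d), .cross (k + 2) (!o) d e, .cap k d, .cap (k + 1) d])
    (h.symm ?_) ?_
  · exact h.exch [.cup (k + 1) (-d), .cross (k + 2) (!o) d e] [] (.cap k d) (.cap 0 d) P [e]
      S (k + 1) (k + 3) (by simp [k, Slice.pos]) (by simp [k, Slice.input]) rfl rfl
  refine h.trans (y := [.cup (k + 1) (-d), .cap k d, .cross k (!o) d e, .cap (k + 1) d])
    (h.symm ?_) ?_
  · exact h.exch [.cup (k + 1) (-d)] [.cap (k + 1) d] (.cap k d) (.cross 0 (!o) d e) P []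
      (-d :: S) k (k + 2) (by simp [k, Slice.pos]) (by simp [k, Slice.input]) rfl rfl
  · have key := h.zigzag' P (e :: -d :: S) k (-d) rfl
    simp only [neg_neg, Bool.not_not] at key
    exact h.ctx [] [.cross k (!o) d e, .cap (k + 1) d] (M := P ++ d :: e :: -d :: S) (by simp) key

/-- Third Reidemeister move where the crossing of the two upper strands is switched. -/
theorem r3_flip_upper (h : IsotopyCongr E) {o : Bool} {d e f : α} (h3 : HasR3 E o d f e)
    (P S : List α) (k : ℕ) (hk : P.length = k) : E (P ++ d :: e :: f :: S)
    [.cross k o d e, .cross (k + 1) o d f, .cross k (!o) e f]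
    [.cross (k + 1) (!o) e f, .cross k o d f, .cross (k + 1) o d e] := by
  subst hk
  set k := P.length
  -- A cancelling pair of crossings is inserted in front, `h3` is applied, and a cancelling pair
  -- comes out at the other end.
  refine h.trans (y := [.cross (k + 1) (!o) e f, .cross (k + 1) o f e, .cross k o d e,
    .cross (k + 1) o d f, .cross k (!o) e f]) (h.symm ?_) ?_
  · have key := h.reidemeisterTwo (P ++ [d]) S (k + 1) (!o) e f (by simp [k])
    simp only [neg_neg, Bool.not_not] at key
    exact h.ctx [] [.cross k o d e, .cross (k + 1) o d f, .cross k (!o) e f]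
      (M := (P ++ [d]) ++ e :: f :: S) (by simp) key
  refine h.trans (y := [.cross (k + 1) (!o) e f, .cross k o d f, .cross (k + 1) o d e,
    .cross k o f e, .cross k (!o) e f]) (h.symm ?_) ?_
  · exact h.ctx [.cross (k + 1) (!o) e f] [.cross k (!o) e f]
      (M := P ++ d :: f :: e :: S) (by simp [k]) (h3 P S k rfl)
  · exact h.ctx [.cross (k + 1) (!o) e f, .cross k o d f, .cross (k + 1) o d e] []
      (M := P ++ f :: e :: d :: S) (by simp [k]) (h.reidemeisterTwo P (d :: S) k o f e rfl)

/-- Third Reidemeister move where the crossing of the two lower strands is switched. -/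
theorem r3_flip_lower (h : IsotopyCongr E) {o : Bool} {d e f : α} (h3 : HasR3 E o e d f)
    (P S : List α) (k : ℕ) (hk : P.length = k) : E (P ++ d :: e :: f :: S)
    [.cross k (!o) d e, .cross (k + 1) o d f, .cross k o e f]
    [.cross (k + 1) o e f, .cross k o d f, .cross (k + 1) (!o) d e] := by
  subst hk
  set k := P.length
  refine h.trans (y := [.cross k (!o) d e, .cross (k + 1) o d f, .cross k o e f,
    .cross (k + 1) o e d, .cross (k + 1) (!o) d e]) (h.symm ?_) ?_
  · exact h.ctx [.cross k (!o) d e, .cross (k + 1) o d f, .cross k o e f] []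
      (M := (P ++ [f]) ++ e :: d :: S) (by simp [k])
      (h.reidemeisterTwo (P ++ [f]) S (k + 1) o e d (by simp [k]))
  refine h.trans (y := [.cross k (!o) d e, .cross k o e d, .cross (k + 1) o e f, .cross k o d f,
    .cross (k + 1) (!o) d e]) (h.symm ?_) ?_
  · exact h.ctx [.cross k (!o) d e] [.cross (k + 1) (!o) d e]
      (M := P ++ e :: d :: f :: S) (by simp [k]) (h3 P S k rfl)
  · have key := h.reidemeisterTwo P (f :: S) k (!o) d e rfl
    simp only [neg_neg, Bool.not_not] at key
    exact h.ctx [] [.cross (k + 1) o e f, .cross k o d f, .cross (k + 1) (!o) d e]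
      (M := P ++ d :: e :: f :: S) (by simp [k]) key

/-- Rotating the third Reidemeister move. -/
theorem r3_rotate (h : IsotopyCongr E) {o : Bool} {d e f : α} (h3 : HasR3 E (!o) f e (-d)) :
    HasR3 E o d e f := by
  intro P S k hk
  subst hk
  set k := P.length
  have slide := fun (Q T : List α) (j : ℕ) (hj : Q.length = j) (x : α) =>
    h.capSlide Q T j (!o) d x hj
  simp only [Bool.not_not] at slide
  -- bend the strand labelled `d`, so that it crosses the two others from above
  have key := h.r3_flip_lower (d := e) (e := f) (f := -d) h3 (P ++ [d]) (d :: S) (k + 1)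
    (by simp [k])
  simp only [Bool.not_not] at key
  -- Closed up by the bend, the right side of `key` straightens to the left side of the move; `hA`
  -- treats the other sides. Each crossing with the bent strand passes the rightmost point by
  -- `slide`, which switches its kind.
  have hB : E (P ++ d :: e :: f :: S)
      [.cup (k + 3) (-d), .cross (k + 2) (!o) f (-d), .cross (k + 1) (!o) e (-d),
        .cross (k + 2) o e f, .cap k d]
      [.cross k o d e, .cross (k + 1) o d f, .cross k o e f] := by
    refine h.trans (y := [.cup (k + 3) (-d), .cross (k + 2) (!o) f (-d),
      .cross (k + 1) (!o) e (-d), .cap k d, .cross k o e f]) (h.symm ?_) ?_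
    · exact h.exch [.cup (k + 3) (-d), .cross (k + 2) (!o) f (-d), .cross (k + 1) (!o) e (-d)] []
        (.cap k d) (.cross 0 o e f) P [] (d :: S) k (k + 2) (by simp [k, Slice.pos])
        (by simp [k, Slice.input]) rfl rfl
    refine h.trans (y := [.cup (k + 3) (-d), .cross (k + 2) (!o) f (-d),
      .cross k o d e, .cap (k + 1) d, .cross k o e f]) ?_ ?_
    · exact h.ctx [.cup (k + 3) (-d), .cross (k + 2) (!o) f (-d)] [.cross k o e f]
        (M := P ++ d :: e :: -d :: f :: d :: S) (by simp [k]) (slide P (f :: d :: S) k rfl e)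
    refine h.trans (y := [.cup (k + 3) (-d), .cross k o d e, .cross (k + 2) (!o) f (-d),
      .cap (k + 1) d, .cross k o e f]) (h.symm ?_) ?_
    · exact h.exch [.cup (k + 3) (-d)] [.cap (k + 1) d, .cross k o e f]
        (.cross k o d e) (.cross 0 (!o) f (-d)) P [] (d :: S) (k + 2) (k + 2)
        (by simp [k, Slice.pos]) (by simp [k, Slice.input]) rfl rfl
    refine h.trans (y := [.cross k o d e, .cup (k + 3) (-d), .cross (k + 2) (!o) f (-d),
      .cap (k + 1) d, .cross k o e f]) (h.symm ?_) ?_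
    · exact h.exch [] [.cross (k + 2) (!o) f (-d), .cap (k + 1) d, .cross k o e f]
        (.cross k o d e) (.cup 0 (-d)) P [f] S (k + 3) (k + 3)
        (by simp [k, Slice.pos]) (by simp [k, Slice.input]) rfl rfl
    refine h.trans (y := [.cross k o d e, .cup (k + 3) (-d), .cross (k + 1) o d f,
      .cap (k + 2) d, .cross k o e f]) ?_ ?_
    · exact h.ctx [.cross k o d e, .cup (k + 3) (-d)] [.cross k o e f]
        (M := (P ++ [e]) ++ d :: f :: -d :: d :: S) (by simp [k])
        (slide (P ++ [e]) (d :: S) (k + 1) (by simp [k]) f)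
    refine h.trans (y := [.cross k o d e, .cross (k + 1) o d f, .cup (k + 3) (-d),
      .cap (k + 2) d, .cross k o e f]) (h.symm ?_) ?_
    · exact h.exch [.cross k o d e] [.cap (k + 2) d, .cross k o e f]
        (.cross (k + 1) o d f) (.cup 0 (-d)) (P ++ [e]) [] S (k + 3) (k + 3)
        (by simp [k, Slice.pos]) (by simp [k, Slice.input]) rfl rfl
    · have key := h.zigzag' (P ++ [e, f]) S (k + 2) (-d) (by simp [k])
      simp only [neg_neg, Bool.not_not] at key
      exact h.ctx [.cross k o d e, .cross (k + 1) o d f] [.cross k o e f]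
        (M := (P ++ [e, f]) ++ d :: S) (by simp [k]) key
  have hA : E (P ++ d :: e :: f :: S)
      [.cup (k + 3) (-d), .cross (k + 1) o e f, .cross (k + 2) (!o) e (-d),
        .cross (k + 1) (!o) f (-d), .cap k d]
      [.cross (k + 1) o e f, .cross k o d f, .cross (k + 1) o d e] := by
    refine h.trans (y := [.cup (k + 3) (-d), .cross (k + 1) o e f, .cross (k + 2) (!o) e (-d),
      .cross k o d f, .cap (k + 1) d]) ?_ ?_
    · exact h.ctx [.cup (k + 3) (-d), .cross (k + 1) o e f, .cross (k + 2) (!o) e (-d)] []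
        (M := P ++ d :: f :: -d :: e :: d :: S) (by simp [k]) (slide P (e :: d :: S) k rfl f)
    refine h.trans (y := [.cup (k + 3) (-d), .cross (k + 1) o e f, .cross k o d f,
      .cross (k + 2) (!o) e (-d), .cap (k + 1) d]) (h.symm ?_) ?_
    · exact h.exch [.cup (k + 3) (-d), .cross (k + 1) o e f] [.cap (k + 1) d]
        (.cross k o d f) (.cross 0 (!o) e (-d)) P [] (d :: S) (k + 2) (k + 2)
        (by simp [k, Slice.pos]) (by simp [k, Slice.input]) rfl rfl
    refine h.trans (y := [.cup (k + 3) (-d), .cross (k + 1) o e f, .cross k o d f,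
      .cross (k + 1) o d e, .cap (k + 2) d]) ?_ ?_
    · exact h.ctx [.cup (k + 3) (-d), .cross (k + 1) o e f, .cross k o d f] []
        (M := (P ++ [f]) ++ d :: e :: -d :: d :: S) (by simp [k])
        (slide (P ++ [f]) (d :: S) (k + 1) (by simp [k]) e)
    refine h.trans (y := [.cross (k + 1) o e f, .cup (k + 3) (-d), .cross k o d f,
      .cross (k + 1) o d e, .cap (k + 2) d]) (h.symm ?_) ?_
    · exact h.exch [] [.cross k o d f, .cross (k + 1) o d e, .cap (k + 2) d]
        (.cross (k + 1) o e f) (.cup 0 (-d)) (P ++ [d]) [] S (k + 3) (k + 3)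
        (by simp [k, Slice.pos]) (by simp [k, Slice.input]) rfl rfl
    refine h.trans (y := [.cross (k + 1) o e f, .cross k o d f, .cup (k + 3) (-d),
      .cross (k + 1) o d e, .cap (k + 2) d]) (h.symm ?_) ?_
    · exact h.exch [.cross (k + 1) o e f] [.cross (k + 1) o d e, .cap (k + 2) d]
        (.cross k o d f) (.cup 0 (-d)) P [e] S (k + 3) (k + 3)
        (by simp [k, Slice.pos]) (by simp [k, Slice.input]) rfl rfl
    refine h.trans (y := [.cross (k + 1) o e f, .cross k o d f, .cross (k + 1) o d e,
      .cup (k + 3) (-d), .cap (k + 2) d]) (h.symm ?_) ?_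
    · exact h.exch [.cross (k + 1) o e f, .cross k o d f] [.cap (k + 2) d]
        (.cross (k + 1) o d e) (.cup 0 (-d)) (P ++ [f]) [] S (k + 3) (k + 3)
        (by simp [k, Slice.pos]) (by simp [k, Slice.input]) rfl rfl
    · have key := h.zigzag' (P ++ [f, e]) S (k + 2) (-d) (by simp [k])
      simp only [neg_neg, Bool.not_not] at key
      exact h.ctx [.cross (k + 1) o e f, .cross k o d f, .cross (k + 1) o d e] []
        (M := (P ++ [f, e]) ++ d :: S) (by simp [k]) key
  refine h.trans (h.symm hB) (h.trans (h.symm ?_) hA)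
  exact h.ctx [.cup (k + 3) (-d)] [.cap k d] (by simp [k]) key

end IsotopyCongr
end Congruence

/-! ### Sliding pieces across long strands and across arcs. -/

section Slides

variable {α : Type} [InvolutiveNeg α] [DecidableEq α]
variable {E : List α → List (Slice α) → List (Slice α) → Prop}

/-- A congruence that contains regular isotopy. -/
structure RegularCongr (E : List α → List (Slice α) → List (Slice α) → Prop) : Prop
    extends IsotopyCongr E where
  reidemeisterThree : ∀ o d e f, HasR3 E o d e f

/-- The strand `k`, labelled `c`, crosses all the strands above it, labelled `S`. -/
def up (k : ℕ) (o : Bool) (c : α) : List α → List (Slice α)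
  | [] => []
  | x :: S => .cross k o c x :: up (k + 1) o c S

/-- A new arc whose lower end is the strand `k` and whose upper end is moved to the top. -/
def arc (k : ℕ) (d : α) (S : List α) : List (Slice α) :=
  .cup k d :: up (k + 1) true (-d) S

theorem up_append (k : ℕ) (o : Bool) (c : α) (S T : List α) :
    up k o c (S ++ T) = up k o c S ++ up (k + S.length) o c T := by
  induction S generalizing k with
  | nil => simp [up]
  | cons x S ih => simp [up, ih, Nat.add_assoc, Nat.add_comm 1]

theorem typed_up (P : List α) (k : ℕ) (o : Bool) (c : α) (S : List α) (hk : P.length = k) :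
    Typed (P ++ c :: S) (up k o c S) (P ++ S ++ [c]) := by
  induction S generalizing P k with
  | nil => simp [up]
  | cons x S ih =>
    subst hk
    simpa [up] using ih (P ++ [x]) (P.length + 1) (by simp)

/-- The same with further strands above. -/
theorem typed_up_append (P : List α) (k : ℕ) (o : Bool) (c : α) (S T : List α)
    (hk : P.length = k) :
    Typed (P ++ c :: (S ++ T)) (up k o c S) (P ++ S ++ c :: T) := by
  induction S generalizing P k with
  | nil => simp [up]
  | cons x S ih =>
    subst hk
    simpa [up] using ih (P ++ [x]) (P.length + 1) (by simp)

theorem typed_arc (P : List α) (k : ℕ) (d : α) (S : List α) (hk : P.length = k) :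
    Typed (P ++ S) (arc k d S) (P ++ d :: S ++ [-d]) := by
  subst hk
  simpa [arc] using typed_up (P ++ [d]) (P.length + 1) true (-d) S (by simp)

namespace IsotopyCongr

/-- A leftmost point slides under or over a strand. -/
theorem cup_across (h : IsotopyCongr E) (P S : List α) (k : ℕ) (o : Bool) (c d : α)
    (hk : P.length = k) :
    E (P ++ c :: S) [.cup (k + 1) d, .cross k o c d, .cross (k + 1) o c (-d)] [.cup k d] := by
  subst hk
  set k := P.length
  have h1 := h.cupSlide P S k (!o) d c rfl
  have h2 := h.reidemeisterTwo (P ++ [d]) S (k + 1) (!o) (-d) c (by simp [k])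
  simp only [Bool.not_not] at h1 h2
  refine h.trans (h.symm (h.ctx [] [.cross (k + 1) o c (-d)] (by simp) h1)) ?_
  exact h.ctx [.cup k d] [] (by simp [k]) h2

/-- A rightmost point slides under or over a strand. -/
theorem cap_across (h : IsotopyCongr E) (P S : List α) (k : ℕ) (o : Bool) (c d : α)
    (hk : P.length = k) :
    E (P ++ c :: d :: -d :: S) [.cross k o c d, .cross (k + 1) o c (-d), .cap k d]
      [.cap (k + 1) d] := by
  subst hk
  set k := P.length
  have h1 := h.capSlide P S k o d c rfl
  have h2 := h.reidemeisterTwo P (-d :: S) k o c d rfl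
  refine h.trans (h.ctx [.cross k o c d] [] (by simp [k]) h1) ?_
  exact h.ctx [] [.cap (k + 1) d] (by simp [k]) h2

/-- A circle slides across a strand. -/
theorem circle_across (h : IsotopyCongr E) (P S : List α) (k : ℕ) (c d : α)
    (hk : P.length = k) :
    E (P ++ c :: S) [.cup k d, .cap k d] [.cup (k + 1) d, .cap (k + 1) d] := by
  subst hk
  set k := P.length
  have h1 := h.cup_across P S k true c d rfl
  have h2 := h.cap_across P S k true c d rfl
  refine h.trans (h.symm (h.ctx [] [.cap k d] (by simp) h1)) ?_
  exact h.ctx [.cup (k + 1) d] [] (by simp [k]) h2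

end IsotopyCongr

/-- A piece commutes with `up` acting above it. -/
theorem TangleCongr.low_up_append (h : TangleCongr E) (s : Slice α) (P Q : List α) (i j : ℕ)
    (o : Bool) (c : α) (S T : List α) (hP : P.length = s.pos)
    (hi : s.pos + s.output.length + Q.length = i) (hj : s.pos + s.input.length + Q.length = j) :
    E (P ++ s.input ++ Q ++ c :: (S ++ T)) (s :: up i o c S) (up j o c S ++ [s]) := by
  induction S generalizing Q i j with
  | nil => exact h.refl _ _
  | cons x S ih =>
    refine h.trans (y := .cross j o c x :: s :: up (i + 1) o c S) ?_ ?_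
    · exact h.exch [] (up (i + 1) o c S) s (.cross 0 o c x) P Q (S ++ T) i j hP
        (by simp [Slice.input]) hi hj
    · have := ih (Q ++ [x]) (i + 1) (j + 1) (by simp; omega) (by simp; omega)
      refine h.ctx_left (M := P ++ s.input ++ (Q ++ [x]) ++ c :: (S ++ T)) [.cross j o c x] ?_ this
      have := typed_setPos (.cross 0 o c x) (P ++ s.input ++ Q) (S ++ T) j (by simp; omega)
      simpa [Slice.input, Slice.output, Slice.setPos] using this

theorem TangleCongr.low_up (h : TangleCongr E) (s : Slice α) (P Q : List α) (i j : ℕ) (o : Bool)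
    (c : α) (S : List α) (hP : P.length = s.pos)
    (hi : s.pos + s.output.length + Q.length = i) (hj : s.pos + s.input.length + Q.length = j) :
    E (P ++ s.input ++ Q ++ c :: S) (s :: up i o c S) (up j o c S ++ [s]) := by
  simpa using h.low_up_append s P Q i j o c S [] hP hi hj

/-- A piece commutes with an arc attached above it. -/
theorem TangleCongr.low_arc (h : TangleCongr E) (s : Slice α) (P Q : List α) (i j : ℕ)
    (d : α) (S : List α) (hP : P.length = s.pos)
    (hi : s.pos + s.output.length + Q.length = i) (hj : s.pos + s.input.length + Q.length = j) :
    E (P ++ s.input ++ Q ++ S) (s :: arc i d S) (arc j d S ++ [s]) := by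
  refine h.trans (y := .cup j d :: s :: up (i + 1) true (-d) S) ?_ ?_
  · exact h.exch [] (up (i + 1) true (-d) S) s (.cup 0 d) P Q S i j hP (by simp [Slice.input])
      hi hj
  · have := h.low_up s P (Q ++ [d]) (i + 1) (j + 1) true (-d) S hP (by simp; omega)
      (by simp; omega)
    refine h.ctx_left (M := P ++ s.input ++ (Q ++ [d]) ++ -d :: S) [.cup j d] ?_ this
    have := typed_setPos (.cup 0 d) (P ++ s.input ++ Q) S j (by simp; omega)
    simpa [Slice.input, Slice.output, Slice.setPos] using this

namespace RegularCongr

/-- A piece slides across a strand that crosses the strands of the piece. -/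
theorem piece_across (h : RegularCongr E) (s : Slice α) (P S : List α) (k : ℕ) (o : Bool) (c : α)
    (hk : P.length = k) :
    E (P ++ c :: (s.input ++ S)) (s.setPos (k + 1) :: up k o c s.output)
      (up k o c s.input ++ [s.setPos k]) := by
  cases s with
  | cup j d => exact h.cup_across P S k o c d hk
  | cap j d => exact h.symm (h.cap_across P S k o c d hk)
  | cross j o' d e =>
    refine h.symm ?_
    -- A crossing of the same kind as those of the moving strand passes by the third Reidemeister
    -- move itself, one of the other kind by its variant with the upper crossing switched.
    obtain rfl | rfl : o' = o ∨ o' = !o := by cases o <;> cases o' <;> simp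
    · exact h.reidemeisterThree o' c d e P S k hk
    · exact h.r3_flip_upper (h.reidemeisterThree o c e d) P S k hk

/-- Crossings with `T` commute with the piece by exchange, those with the strands of the piece pass
by `piece_across`, and those with `S` commute by `low_up`. Once `c` has gone by, one strand fewer
lies below the piece, hence the shift from `i` to `j`. -/
theorem high_up (h : RegularCongr E) (s : Slice α) (P T S : List α) (k i j : ℕ) (o : Bool)
    (c : α) (hk : P.length = k) (hi : k + 1 + T.length = i) (hj : k + T.length = j) :
    E (P ++ c :: (T ++ s.input ++ S)) (s.setPos i :: up k o c (T ++ s.output ++ S))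
      (up k o c (T ++ s.input ++ S) ++ [s.setPos j]) := by
  induction T generalizing P k i j with
  | nil =>
    simp only [List.length_nil, Nat.add_zero] at hi hj
    subst hi hj
    have h1 := h.piece_across s P S k o c hk
    have h2 := h.low_up (s.setPos k) (P) [] (k + s.output.length)
      (k + s.input.length) o c S (by simpa using hk) (by simp) (by simp)
    simp only [List.nil_append, up_append]
    refine h.trans (y := up k o c s.input ++ (s.setPos k :: up (k + s.output.length) o c S)) ?_ ?_
    · have := h.ctx_right (up (k + s.output.length) o c S) h1
      simpa using this
    · have ht := typed_up_append P k o c s.input S hk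
      have := h.ctx_left _ ht (by simpa using h2)
      simpa using this
  | cons x T ih =>
    have h2 := ih (P ++ [x]) (k + 1) i j (by simpa using hk) (by simp at hi; omega)
      (by simp at hj; omega)
    refine h.trans (y := .cross k o c x :: s.setPos i :: up (k + 1) o c (T ++ s.output ++ S))
      (h.symm ?_) ?_
    · refine h.exch [] (up (k + 1) o c (T ++ s.output ++ S)) (.cross k o c x) s P T S i i
        hk (by simp [Slice.input]) ?_ ?_ <;>
      · simp [Slice.input, Slice.output, Slice.pos] at hi ⊢; omega
    · subst hk
      exact h.ctx_left [.cross P.length o c x] (by simp) h2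

theorem high_arc (h : RegularCongr E) (s : Slice α) (P T S : List α) (k i j : ℕ)
    (d : α) (hk : P.length = k) (hi : k + T.length = i) (hj : k + 1 + T.length = j) :
    E (P ++ (T ++ s.input ++ S)) (s.setPos i :: arc k d (T ++ s.output ++ S))
      (arc k d (T ++ s.input ++ S) ++ [s.setPos j]) := by
  refine h.trans (y := .cup k d :: s.setPos (i + 2) ::
    up (k + 1) true (-d) (T ++ s.output ++ S)) (h.symm ?_) ?_
  · refine h.exch [] (up (k + 1) true (-d) (T ++ s.output ++ S)) (.cup k d) s P T S (i + 2) i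
      hk (by simp [Slice.input]) ?_ ?_ <;>
    · simp [Slice.input, Slice.output, Slice.pos]; omega
  · have := h.high_up s (P ++ [d]) T S (k + 1) (i + 2) j true (-d) (by simpa using hk)
      (by omega) (by omega)
    subst hk
    exact h.ctx_left [.cup P.length d] (by simp) this

end RegularCongr
end Slides

/-! ## Skein functionals -/

section SkeinSpace

variable {α : Type} [InvolutiveNeg α] [DecidableEq α]
variable {A : Type*} [CommRing A] {W : Type*} [AddCommGroup W] [Module A W]

/-- A functional on the words from the strands `L` to no strands at all that satisfies the skein
relations.  For labels in `Dir` these are the relations of `R`, for labels in `Unit` those of `D`.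
-/
structure IsSkein (z a : A) (L : List α) (f : List (Slice α) → W) : Prop where
  -- Setting the value to `0` on words that do not fit makes equalities of functionals hold on all
  -- lists, not only on the typed ones.
  untyped : ∀ w, ¬ Typed L w [] → f w = 0
  move : ∀ U V x y, LocalMove x y → Typed L (U ++ x ++ V) [] → f (U ++ x ++ V) = f (U ++ y ++ V)
  -- The conditions say which splices respect the labels. In `Unit` both always hold, which gives
  -- the relation of `D`. In `Dir` exactly one holds, and the minus sign before the horizontal
  -- splice reflects that the crossing `true` is negative for equal directions.
  skein : ∀ U V k d e, Typed L (U ++ [.cross k true d e] ++ V) [] →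
    f (U ++ [.cross k true d e] ++ V) - f (U ++ [.cross k false d e] ++ V) =
      z • ((if e = -d then f (U ++ [.cap k d, .cup k (-d)] ++ V) else 0) -
        if d = e then f (U ++ V) else 0)
  curl : ∀ U V k d, Typed L (U ++ [.cross k true d (-d), .cap k (-d)] ++ V) [] →
    f (U ++ [.cross k true d (-d), .cap k (-d)] ++ V) = a • f (U ++ [.cap k d] ++ V)

/-- Skein functionals form a module. -/
def skeinSpace (W : Type*) [AddCommGroup W] [Module A W] (z a : A) (L : List α) :
    Submodule A (List (Slice α) → W) where
  carrier := {f | IsSkein z a L f}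
  zero_mem' := by constructor <;> simp
  add_mem' {f g} hf hg := by
    constructor
    · intro w hw; simp [hf.untyped w hw, hg.untyped w hw]
    · intro U V x y h ht; simp only [Pi.add_apply, hf.move U V x y h ht, hg.move U V x y h ht]
    · intro U V k d e ht
      have h1 := hf.skein U V k d e ht
      have h2 := hg.skein U V k d e ht
      simp only [Pi.add_apply]
      rw [add_sub_add_comm, h1, h2, ← smul_add]
      congr 1
      split_ifs <;> abel
    · intro U V k d ht; simp only [Pi.add_apply, hf.curl U V k d ht, hg.curl U V k d ht, smul_add]
  smul_mem' c f hf := by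
    constructor
    · intro w hw; simp [hf.untyped w hw]
    · intro U V x y h ht; simp only [Pi.smul_apply, hf.move U V x y h ht]
    · intro U V k d e ht
      have h1 := hf.skein U V k d e ht
      simp only [Pi.smul_apply]
      rw [← smul_sub, h1, smul_comm]
      congr 1
      split_ifs <;> simp [smul_sub]
    · intro U V k d ht
      simp only [Pi.smul_apply, hf.curl U V k d ht]
      rw [smul_comm]

/-- Composition of a functional with a word on its left. -/
def act (x : List (Slice α)) : (List (Slice α) → W) →ₗ[A] (List (Slice α) → W) where
  toFun f w := f (x ++ w)
  map_add' _ _ := rfl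
  map_smul' _ _ := rfl

theorem act_apply (x w : List (Slice α)) (f : List (Slice α) → W) :
    act (A := A) x f w = f (x ++ w) := rfl

@[simp] theorem act_nil (f : List (Slice α) → W) : act (A := A) [] f = f := rfl

theorem act_append (x y : List (Slice α)) (f : List (Slice α) → W) :
    act (A := A) (x ++ y) f = act (A := A) y (act (A := A) x f) := by
  ext w; simp [act_apply]

theorem act_cons (s : Slice α) (y : List (Slice α)) (f : List (Slice α) → W) :
    act (A := A) (s :: y) f = act (A := A) y (act (A := A) [s] f) := act_append [s] y f

variable {z a : A}

theorem act_mem {L M : List α} {f : List (Slice α) → W} (hf : f ∈ skeinSpace W z a L)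
    {x : List (Slice α)} (hx : Typed L x M) : act (A := A) x f ∈ skeinSpace W z a M := by
  have ht : ∀ {w}, Typed M w [] → Typed L (x ++ w) [] := fun h => hx.append h
  have ht' : ∀ {w}, Typed L (x ++ w) [] → Typed M w [] := fun h => by
    obtain ⟨N, h1, h2⟩ := typed_append.1 h
    rwa [hx.det h1]
  constructor
  · intro w hw; exact hf.untyped _ fun h => hw (ht' h)
  · intro U V s t h hU
    have := hf.move (x ++ U) V s t h (by simpa using ht hU)
    simpa [act_apply] using this
  · intro U V k d e hU
    have := hf.skein (x ++ U) V k d e (by simpa using ht hU)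
    simpa [act_apply] using this
  · intro U V k d hU
    have := hf.curl (x ++ U) V k d (by simpa using ht hU)
    simpa [act_apply] using this

/-- Two words that no skein functional distinguishes. -/
def SkeinEq (W : Type*) [AddCommGroup W] [Module A W] (z a : A) (L : List α)
    (x y : List (Slice α)) : Prop :=
  ∀ f ∈ skeinSpace W z a L, act (A := A) x f = act (A := A) y f

theorem skeinEq_of_move {L M : List α} {x y : List (Slice α)} (h : LocalMove x y)
    (hx : Typed L x M) (hy : Typed L y M) : SkeinEq W z a L x y := by
  intro f hf
  ext w
  by_cases hw : Typed M w []
  · simpa [act_apply] using hf.move [] w x y h (by simpa using hx.append hw)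
  · rw [act_apply, act_apply, hf.untyped, hf.untyped]
    · intro h'
      obtain ⟨N, h1, h2⟩ := typed_append.1 h'
      exact hw (by rwa [hy.det h1])
    · intro h'
      obtain ⟨N, h1, h2⟩ := typed_append.1 h'
      exact hw (by rwa [hx.det h1])

/-- This turns every geometric lemma on congruences into an identity between operators `act` on
skein functionals. -/
theorem skeinEq_regular : RegularCongr (SkeinEq (α := α) W z a) where
  refl _ _ _ _ := rfl
  symm h f hf := (h f hf).symm
  trans h h' f hf := (h f hf).trans (h' f hf)
  ctx A' B x y hA h f hf := by
    simp only [act_append]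
    rw [h _ (act_mem hf hA)]
  exchange s t P Q S hP := by
    refine skeinEq_of_move (M := P ++ s.output ++ Q ++ t.output ++ S) (.exchange s t Q.length)
      ?_ ?_
    · have h1 := typed_setPos s P (Q ++ t.input ++ S) s.pos hP
      have h2 := typed_setPos t (P ++ s.output ++ Q) S (s.pos + s.output.length + Q.length)
        (by simp; omega)
      rw [Slice.setPos_pos] at h1
      have := h1.append (M := P ++ s.output ++ Q ++ t.output ++ S) (by simpa using h2)
      simpa using this
    · have h1 := typed_setPos s P (Q ++ t.output ++ S) s.pos hP
      have h2 := typed_setPos t (P ++ s.input ++ Q) S (s.pos + s.input.length + Q.length)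
        (by simp; omega)
      rw [Slice.setPos_pos] at h1
      have := h2.append (M := P ++ s.output ++ Q ++ t.output ++ S) (by simpa using h1)
      simpa using this
  zigzag P S k d hk := by
    subst hk
    exact skeinEq_of_move (M := P ++ d :: S) (.zigzag _ d) (by simp) (by simp)
  zigzag' P S k d hk := by
    subst hk
    exact skeinEq_of_move (M := P ++ -d :: S) (.zigzag' _ d) (by simp) (by simp)
  cupSlide P S k o d e hk := by
    subst hk
    exact skeinEq_of_move (M := P ++ d :: e :: -d :: S) (.cupSlide _ o d e) (by simp) (by simp)
  reidemeisterTwo P S k o d e hk := by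
    subst hk
    exact skeinEq_of_move (M := P ++ d :: e :: S) (.reidemeisterTwo _ o d e) (by simp) (by simp)
  reidemeisterThree o d e f P S k hk := by
    subst hk
    exact skeinEq_of_move (M := P ++ f :: e :: d :: S) (.reidemeisterThree _ o d e f) (by simp)
      (by simp)

/-- The skein relation for functionals. -/
theorem act_skein {P S : List α} {d e : α} {f : List (Slice α) → W} (k : ℕ) (hk : P.length = k)
    (hf : f ∈ skeinSpace W z a (P ++ d :: e :: S)) :
    act (A := A) [.cross k true d e] f - act (A := A) [.cross k false d e] f =
      z • ((if e = -d then act (A := A) [.cap k d, .cup k (-d)] f else 0) -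
        if d = e then f else 0) := by
  subst hk
  ext w
  by_cases hw : Typed (P ++ e :: d :: S) w []
  · have := hf.skein [] w P.length d e (by simpa using hw)
    simp only [List.nil_append] at this
    simp only [Pi.sub_apply, act_apply, Pi.smul_apply, this]
    congr 1
    split_ifs <;> rfl
  · have hX : ∀ o, f ([.cross P.length o d e] ++ w) = 0 := fun o => by
      refine hf.untyped _ ?_
      simpa using hw
    simp only [Pi.sub_apply, act_apply, hX, Pi.smul_apply, sub_zero]
    have h1 : (if e = -d then act (A := A) [.cap P.length d, .cup P.length (-d)] f else 0) w
        = 0 := by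
      split_ifs with h
      · subst h
        refine hf.untyped _ ?_
        simpa using hw
      · rfl
    have h2 : (if d = e then f else 0) w = 0 := by
      split_ifs with h
      · subst h
        exact hf.untyped _ hw
      · rfl
    rw [h1, h2]; simp

theorem act_curl_true {P S : List α} {d : α} {f : List (Slice α) → W} (k : ℕ) (hk : P.length = k)
    (hf : f ∈ skeinSpace W z a (P ++ d :: -d :: S)) :
    act (A := A) [.cross k true d (-d), .cap k (-d)] f = a • act (A := A) [.cap k d] f := by
  subst hk
  ext w
  by_cases hw : Typed (P ++ S) w []
  · exact hf.curl [] w P.length d (by simpa using hw)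
  · simp only [act_apply, Pi.smul_apply]
    rw [hf.untyped, hf.untyped, smul_zero]
    · simpa using hw
    · simpa using hw

variable {ai : A}

/-- The factor of a curl, given the kind of its crossing. -/
def curlFactor (a ai : A) (o : Bool) : A := if o then a else ai

/-- A negative crossing followed by a positive curl is, by the second Reidemeister move, a plain
rightmost point; hence the negative curl has the inverse factor. -/
theorem act_curl (ha : a * ai = 1) {P S : List α} {d : α} {f : List (Slice α) → W} (k : ℕ)
    (o : Bool) (hk : P.length = k) (hf : f ∈ skeinSpace W z a (P ++ d :: -d :: S)) :
    act (A := A) [.cross k o d (-d), .cap k (-d)] f =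
      curlFactor a ai o • act (A := A) [.cap k d] f := by
  subst hk
  cases o with
  | true => exact act_curl_true _ rfl hf
  | false =>
    have h := (skeinEq_regular (W := W) (z := z) (a := a)).reidemeisterTwo P S P.length false d
      (-d) rfl f hf
    have h1 : act (A := A) [.cross P.length false d (-d)] f ∈
        skeinSpace W z a (P ++ -d :: - -d :: S) := act_mem hf (by simp)
    have h2 := act_curl_true P.length rfl h1
    simp only [neg_neg] at h2
    have h3 : act (A := A) [.cap P.length d] f =
        a • act (A := A) [.cross P.length false d (-d), .cap P.length (-d)] f := by
      have := congrArg (act (A := A) [.cap P.length d]) h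
      exact this.symm.trans h2
    rw [h3, smul_smul, curlFactor, if_neg (by simp), mul_comm, ha, one_smul]

/-- A zigzag on one branch supplies a rightmost point, and the two slides rotate the crossing onto
it; `act_curl` applies, and what remains is a zigzag. -/
theorem act_cup_curl (ha : a * ai = 1) {P S : List α} {d : α} {f : List (Slice α) → W} (k : ℕ)
    (o : Bool) (hk : P.length = k) (hf : f ∈ skeinSpace W z a (P ++ S)) :
    act (A := A) [.cup k d, .cross k o d (-d)] f =
      curlFactor a ai o • act (A := A) [.cup k (-d)] f := by
  subst hk
  set k := P.length
  have h := skeinEq_regular (α := α) (W := W) (z := z) (a := a)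
  have e1 : SkeinEq W z a (P ++ S) [.cup k d, .cross k o d (-d)]
      [.cup k (-d), .cup (k + 1) d, .cross k o (-d) d, .cap k d] := by
    refine h.trans (y := [.cup k d, .cross k o d (-d), .cup (k + 2) (-d), .cap (k + 1) d])
      (h.symm ?_) ?_
    · have key := h.zigzag' (P ++ [-d]) S (k + 1) (-d) (by simp [k])
      simp only [neg_neg] at key
      exact h.ctx [.cup k d, .cross k o d (-d)] [] (by simp [k]) key
    refine h.trans (y := [.cup k d, .cup (k + 2) (-d), .cross k o d (-d), .cap (k + 1) d]) ?_ ?_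
    · exact h.exch [.cup k d] [.cap (k + 1) d] (.cross k o d (-d)) (.cup 0 (-d)) P [] S (k + 2)
        (k + 2) rfl (by simp [k, Slice.input]) rfl rfl
    refine h.trans (y := [.cup k (-d), .cup k d, .cross k o d (-d), .cap (k + 1) d]) ?_ ?_
    · exact h.exch [] [.cross k o d (-d), .cap (k + 1) d] (.cup k d) (.cup 0 (-d)) P [] S (k + 2)
        k rfl (by simp [k, Slice.input]) rfl rfl
    refine h.trans (y := [.cup k (-d), .cup k d, .cross (k + 1) (!o) (-d) (-d), .cap k d])
      (h.symm ?_) ?_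
    · have key := h.capSlide P (d :: S) k (!o) d (-d) rfl
      simp only [Bool.not_not] at key
      exact h.ctx [.cup k (-d), .cup k d] [] (by simp [k]) key
    · have key := h.cupSlide P (d :: S) k (!o) d (-d) rfl
      simp only [Bool.not_not] at key
      exact h.ctx [.cup k (-d)] [.cap k d] (by simp [k]) key
  rw [e1 f hf]
  have h1 : act (A := A) [.cup k (-d), .cup (k + 1) d] f ∈
      skeinSpace W z a (P ++ -d :: - -d :: (-d) :: d :: S) := act_mem hf (by simp [k])
  have h2 := act_curl ha k o rfl h1
  simp only [neg_neg] at h2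
  rw [← act_append, ← act_append] at h2
  rw [show ([.cup k (-d), .cup (k + 1) d, .cross k o (-d) d, .cap k d] : List (Slice α)) =
    [.cup k (-d), .cup (k + 1) d] ++ [.cross k o (-d) d, .cap k d] from rfl, h2]
  congr 1
  have key := h.zigzag' P (d :: S) k d rfl
  exact h.ctx [.cup k (-d)] [] (by simp [k]) key f hf

/-- The value of a circle, times `z`. -/
def circleFactor (z a ai : A) (d : α) : A := a - ai + if d = -d then z else 0

/-- The skein relation is applied to a curl on a strand. The two kinds of curl give `a` and `ai`,
the vertical splice gives the strand with a circle, and the horizontal one, which exists only if `x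
= -x`, gives the bare strand. Keeping the factor `z` avoids division. -/
theorem act_circle_above (ha : a * ai = 1) {P S : List α} {x : α} {f : List (Slice α) → W}
    (k : ℕ) (hk : P.length = k) (hf : f ∈ skeinSpace W z a (P ++ x :: S)) :
    z • act (A := A) [.cup (k + 1) x, .cap (k + 1) x] f = circleFactor z a ai x • f := by
  subst hk
  set k := P.length
  have h := skeinEq_regular (α := α) (W := W) (z := z) (a := a)
  have hz := h.zigzag P S k x rfl f hf
  have hg : act (A := A) [.cup k x] f ∈ skeinSpace W z a ((P ++ [x]) ++ -x :: - -x :: S) :=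
    act_mem hf (by simp [k])
  have c1 := act_curl ha (k + 1) true (by simp [k]) hg
  have c2 := act_curl ha (k + 1) false (by simp [k]) hg
  have sk := act_skein (k + 1) (by simp [k]) hg
  have sk' := congrArg (act (A := A) [.cap (k + 1) x]) sk
  simp only [neg_neg, if_true, map_sub, map_smul, curlFactor, Bool.false_eq_true, if_false]
    at c1 c2 sk'
  have hz' : act (A := A) [.cap (k + 1) (-x)] (act (A := A) [.cup k x] f) = f := hz
  rw [hz'] at c1 c2
  change act (A := A) [.cap (k + 1) x] (act (A := A) [.cross (k + 1) true (-x) x]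
    (act (A := A) [.cup k x] f)) = _ at c1
  change act (A := A) [.cap (k + 1) x] (act (A := A) [.cross (k + 1) false (-x) x]
    (act (A := A) [.cup k x] f)) = _ at c2
  have hz2 : act (A := A) [.cap (k + 1) x]
      (act (A := A) [.cap (k + 1) (-x), .cup (k + 1) x] (act (A := A) [.cup k x] f)) =
      act (A := A) [.cup (k + 1) x, .cap (k + 1) x] f := by
    conv_rhs => rw [← hz', ← act_append]
    rw [← act_append, ← act_append, ← act_append]; rfl
  rw [hz2, c1, c2] at sk'
  rw [circleFactor]
  by_cases hx : x = -x
  · rw [if_pos hx.symm] at sk'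
    rw [← hx] at hz'
    rw [hz'] at sk'
    rw [if_pos hx, add_smul, sub_smul]
    rw [sk', smul_sub]; abel
  · rw [if_neg (fun h => hx h.symm)] at sk'
    rw [if_neg hx, add_zero, sub_smul]
    simpa using sk'.symm

theorem act_circle_below (ha : a * ai = 1) {P S : List α} {x : α} {f : List (Slice α) → W}
    (k : ℕ) (hk : P.length = k) (hf : f ∈ skeinSpace W z a (P ++ x :: S)) :
    z • act (A := A) [.cup k (-x), .cap k (-x)] f = circleFactor z a ai x • f := by
  subst hk
  set k := P.length
  have h := skeinEq_regular (α := α) (W := W) (z := z) (a := a)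
  have hz := h.zigzag' P S k (-x) rfl
  simp only [neg_neg] at hz
  replace hz := hz f hf
  have hg : act (A := A) [.cup (k + 1) (-x)] f ∈ skeinSpace W z a (P ++ x :: -x :: x :: S) :=
    act_mem hf (by simp [k])
  have c1 := act_curl ha k true rfl hg
  have c2 := act_curl ha k false rfl hg
  have sk := act_skein k rfl hg
  have sk' := congrArg (act (A := A) [.cap k (-x)]) sk
  simp only [if_true, map_sub, map_smul, curlFactor, Bool.false_eq_true, if_false] at c1 c2 sk'
  have hz' : act (A := A) [.cap k x] (act (A := A) [.cup (k + 1) (-x)] f) = f := hz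
  rw [hz'] at c1 c2
  change act (A := A) [.cap k (-x)] (act (A := A) [.cross k true x (-x)]
    (act (A := A) [.cup (k + 1) (-x)] f)) = _ at c1
  change act (A := A) [.cap k (-x)] (act (A := A) [.cross k false x (-x)]
    (act (A := A) [.cup (k + 1) (-x)] f)) = _ at c2
  have hz2 : act (A := A) [.cap k (-x)]
      (act (A := A) [.cap k x, .cup k (-x)] (act (A := A) [.cup (k + 1) (-x)] f)) =
      act (A := A) [.cup k (-x), .cap k (-x)] f := by
    conv_rhs => rw [← hz', ← act_append]
    rw [← act_append, ← act_append, ← act_append]; rfl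
  rw [hz2, c1, c2] at sk'
  rw [circleFactor]
  by_cases hx : x = -x
  · rw [if_pos hx, ← hx] at sk'
    rw [← hx] at hz'
    rw [hz'] at sk'
    rw [if_pos hx, add_smul, sub_smul, ← hx]
    rw [sk', smul_sub]; abel
  · rw [if_neg hx] at sk'
    rw [if_neg hx, add_zero, sub_smul]
    simpa using sk'.symm

/-- A circle next to a strand. -/
theorem act_circle (hα : ∀ d x : α, d = x ∨ d = -x) (ha : a * ai = 1) {P S : List α} {x : α}
    (d : α) {f : List (Slice α) → W} (k : ℕ) (hk : P.length = k)
    (hf : f ∈ skeinSpace W z a (P ++ x :: S)) :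
    z • act (A := A) [.cup (k + 1) d, .cap (k + 1) d] f = circleFactor z a ai d • f := by
  have h := skeinEq_regular (α := α) (W := W) (z := z) (a := a)
  obtain rfl | rfl := hα d x
  · exact act_circle_above ha k hk hf
  · have := act_circle_below ha k hk hf
    rw [h.circle_across P S k x (-x) hk f hf] at this
    rw [this]
    simp [circleFactor, eq_comm]

end SkeinSpace

/-! ## Skein functionals are determined by their value on the empty diagram -/

section Span

variable {α : Type} [InvolutiveNeg α] [DecidableEq α]
variable {A : Type*} [CommRing A] {W : Type*} [AddCommGroup W] [Module A W]
variable {z a zi ai : A} {φ : List (Slice α) → W}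

theorem act_cross_false {P S : List α} {d e : α} {f : List (Slice α) → W} (k : ℕ)
    (hk : P.length = k) (hf : f ∈ skeinSpace W z a (P ++ d :: e :: S)) :
    act (A := A) [.cross k false d e] f = act (A := A) [.cross k true d e] f -
      z • ((if e = -d then act (A := A) [.cap k d, .cup k (-d)] f else 0) -
        if d = e then f else 0) := by
  rw [← act_skein k hk hf, sub_sub_cancel]

/-- The functionals obtained by composing `φ` with standard words: every arc is attached above the
previous ones, with its upper end at the top. -/
inductive Std (φ : List (Slice α) → W) : List α → (List (Slice α) → W) → Prop
  | nil : Std φ [] φ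
  -- The upper end of the newest arc is the topmost strand. Hence a piece can meet that end only at
  -- the very top.
  | arc (P S : List α) (d : α) (f : List (Slice α) → W) : Std φ (P ++ S) f →
      Std φ (P ++ d :: S ++ [-d]) fun w => f (arc P.length d S ++ w)

/-- The span of the standard functionals. -/
def stdSpan (A : Type*) [CommRing A] [Module A W] (φ : List (Slice α) → W) (L : List α) :
    Submodule A (List (Slice α) → W) :=
  Submodule.span A {f | Std φ L f}

theorem act_mem_of_std {L : List α} {x : List (Slice α)} {N : Submodule A (List (Slice α) → W)}
    (h : ∀ f, Std φ L f → act (A := A) x f ∈ N) {f : List (Slice α) → W}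
    (hf : f ∈ stdSpan A φ L) : act (A := A) x f ∈ N := by
  have : stdSpan A φ L ≤ N.comap (act (A := A) x) := Submodule.span_le.2 h
  exact this hf

theorem stdSpan_le (hφ : φ ∈ skeinSpace W z a []) (L : List α) :
    stdSpan A φ L ≤ skeinSpace W z a L := by
  refine Submodule.span_le.2 fun f hf => ?_
  replace hf : Std φ L f := hf
  induction hf with
  | nil => exact hφ
  | arc P S d f _ ih => exact act_mem ih (typed_arc P _ d S rfl)

theorem arc_mem {P S : List α} (d : α) (k : ℕ) (hk : P.length = k) {f : List (Slice α) → W}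
    (hf : f ∈ stdSpan A φ (P ++ S)) :
    act (A := A) (arc k d S) f ∈ stdSpan A φ (P ++ d :: S ++ [-d]) := by
  subst hk
  exact act_mem_of_std (fun f hf => Submodule.subset_span (Std.arc P S d f hf)) hf

/-- All pieces that act on `n` strands preserve the span of the standard functionals. -/
def PiecesPreserve (A : Type*) [CommRing A] [Module A W] (φ : List (Slice α) → W) (n : ℕ) :
    Prop :=
  ∀ (P S : List α) (s : Slice α), P.length = s.pos → (P ++ s.input ++ S).length = n →
    ∀ f ∈ stdSpan A φ (P ++ s.input ++ S), act (A := A) [s] f ∈ stdSpan A φ (P ++ s.output ++ S)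

/-- Crossings of `n` strands with at least `m` strands above preserve the span of the standard
functionals. -/
def CrossingsPreserve (A : Type*) [CommRing A] [Module A W] (φ : List (Slice α) → W) (m n : ℕ) :
    Prop :=
  ∀ (P S : List α) (k : ℕ) (o : Bool) (d e : α), P.length = k → m ≤ S.length →
    k + 2 + S.length = n → ∀ f ∈ stdSpan A φ (P ++ d :: e :: S),
      act (A := A) [.cross k o d e] f ∈ stdSpan A φ (P ++ e :: d :: S)

theorem PiecesPreserve.crossings {n : ℕ} (h : PiecesPreserve A φ n) : CrossingsPreserve A φ 0 n := by
  intro P S k o d e hk _ hn f hf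
  have := h P S (.cross k o d e) hk (by simp [Slice.input]; omega) f (by simpa [Slice.input] using hf)
  simpa [Slice.output] using this

theorem PiecesPreserve.cup {P S : List α} {f : List (Slice α) → W} {n : ℕ}
    (h : PiecesPreserve A φ n) (hf : f ∈ stdSpan A φ (P ++ S)) (hn : (P ++ S).length = n) (d : α)
    (k : ℕ) (hk : P.length = k) :
    act (A := A) [.cup k d] f ∈ stdSpan A φ (P ++ d :: -d :: S) := by
  have := h P S (.cup k d) hk (by simpa [Slice.input] using hn) f (by simpa [Slice.input] using hf)
  simpa [Slice.output] using this

theorem CrossingsPreserve.up_mem {m n : ℕ} (h : CrossingsPreserve A φ m n) {P S T : List α}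
    {c : α} (k : ℕ) (o : Bool) (hk : P.length = k) (hT : m ≤ T.length)
    (hn : k + 1 + S.length + T.length = n) {f : List (Slice α) → W}
    (hf : f ∈ stdSpan A φ (P ++ c :: (S ++ T))) :
    act (A := A) (up k o c S) f ∈ stdSpan A φ (P ++ S ++ c :: T) := by
  induction S generalizing P k f with
  | nil => simpa [up] using hf
  | cons x S ih =>
    rw [up, act_cons]
    have h1 := h P (S ++ T) k o c x hk (by simp; omega) (by simp at hn ⊢; omega) f
      (by simpa using hf)
    have := ih (P := P ++ [x]) (k + 1) (by simpa using hk) (by simp at hn; omega)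
      (f := act (A := A) [.cross k o c x] f) (by simpa using h1)
    simpa using this

theorem PiecesPreserve.up_mem {n : ℕ} (h : PiecesPreserve A φ n) {P S : List α}
    {c : α} (k : ℕ) (o : Bool) (hk : P.length = k)
    (hn : k + 1 + S.length = n) {f : List (Slice α) → W}
    (hf : f ∈ stdSpan A φ (P ++ c :: S)) :
    act (A := A) (up k o c S) f ∈ stdSpan A φ (P ++ S ++ [c]) :=
  h.crossings.up_mem k o hk (T := []) (by simp) (by simpa using hn) (by simpa using hf)

section Step

variable {P S : List α} {f : List (Slice α) → W} {n : ℕ}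

/-- A piece that misses both ends of the newest arc slides to its left and there acts on the `n`
strands of the smaller system, where `h` applies. Here the piece is below the arc; in `high_mem` it
lies between the two ends. -/
theorem low_mem (hφ : φ ∈ skeinSpace W z a []) (h : PiecesPreserve A φ n) {Q : List α}
    (s : Slice α) (d : α) (k : ℕ) (hP : P.length = s.pos)
    (hk : (P ++ s.input ++ Q).length = k)
    (hf : f ∈ stdSpan A φ (P ++ s.input ++ Q ++ S)) (hn : (P ++ s.input ++ Q ++ S).length = n) :
    act (A := A) [s] (act (A := A) (arc k d S) f) ∈
      stdSpan A φ (P ++ s.output ++ (Q ++ d :: S ++ [-d])) := by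
  have e := (skeinEq_regular (W := W) (z := z) (a := a)).low_arc s P Q
    (s.pos + s.output.length + Q.length) k d S hP rfl (by rw [← hk, ← hP]; simp [Nat.add_assoc])
  rw [← act_append, ← e f (stdSpan_le hφ _ hf), act_cons]
  have h1 := h P (Q ++ S) s hP (by simpa using hn) f (by simpa using hf)
  have := arc_mem (P := P ++ s.output ++ Q) (S := S) d (s.pos + s.output.length + Q.length)
    (by simp; omega) (f := act (A := A) [s] f) (by simpa using h1)
  simpa using this

theorem high_mem (hφ : φ ∈ skeinSpace W z a []) (h : PiecesPreserve A φ n) {T : List α}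
    (s : Slice α) (d : α) (k : ℕ) (hk : P.length = k) (hs : s.pos = k + 1 + T.length)
    (hf : f ∈ stdSpan A φ (P ++ (T ++ s.input ++ S)))
    (hn : (P ++ (T ++ s.input ++ S)).length = n) :
    act (A := A) [s] (act (A := A) (arc k d (T ++ s.input ++ S)) f) ∈
      stdSpan A φ (P ++ d :: T ++ s.output ++ (S ++ [-d])) := by
  have e := (skeinEq_regular (W := W) (z := z) (a := a)).high_arc s P T S k
    (k + T.length) s.pos d hk rfl hs.symm
  rw [Slice.setPos_pos] at e
  rw [← act_append, ← e f (stdSpan_le hφ _ hf), act_cons]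
  have h1 := h (P ++ T) S (s.setPos (k + T.length)) (by simpa using hk) (by simpa using hn) f
    (by simpa using hf)
  have := arc_mem (P := P) (S := T ++ s.output ++ S) d k hk
    (f := act (A := A) [s.setPos (k + T.length)] f) (by simpa using h1)
  simpa using this

/-- A rightmost point at the lower end of the newest arc and the strand below. -/
theorem cap_lower_mem (hφ : φ ∈ skeinSpace W z a []) (h : PiecesPreserve A φ n) {x : α} (k : ℕ)
    (hk : P.length = k) (hf : f ∈ stdSpan A φ (P ++ x :: S)) (hn : k + 1 + S.length = n) :
    act (A := A) [.cap k x] (act (A := A) (arc (k + 1) (-x) S) f) ∈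
      stdSpan A φ (P ++ S ++ [x]) := by
  have hE := skeinEq_regular (α := α) (W := W) (z := z) (a := a)
  have e : SkeinEq W z a (P ++ x :: S) (arc (k + 1) (-x) S ++ [.cap k x]) (up k true x S) := by
    have h1 := hE.low_up (.cap k x) P [] k (k + 2) true x S hk rfl rfl
    have h2 := hE.zigzag' P S k (-x) hk
    simp only [neg_neg] at h2
    have h3 := hE.trans (hE.symm (hE.ctx_left [.cup (k + 1) (-x)]
      (L := P ++ x :: S) (by subst hk; simp [Slice.input]) h1)) (hE.ctx_right (up k true x S) h2)
    simpa [arc] using h3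
  rw [← act_append, e f (stdSpan_le hφ _ hf)]
  exact h.up_mem k true hk hn hf

/-- The newest arc, with its lower part straightened by a slide. -/
theorem arc_cross_lower (k : ℕ) (hk : P.length = k) (o : Bool) (x d : α) :
    SkeinEq W z a (P ++ x :: S) (arc (k + 1) d S ++ [.cross k o x d])
      ([.cup k d, .cross (k + 1) (!o) (-d) x] ++ up (k + 2) true (-d) S) := by
  have hE := skeinEq_regular (α := α) (W := W) (z := z) (a := a)
  have h1 := hE.low_up (.cross k o x d) P [] (k + 2) (k + 2) true (-d) S hk rfl rfl
  have h2 := hE.cupSlide P S k (!o) d x hk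
  simp only [Bool.not_not] at h2
  have h3 := hE.trans (hE.symm (hE.ctx_left [.cup (k + 1) d] (L := P ++ x :: S)
    (by subst hk; simp [Slice.input]) h1)) (hE.ctx_right (up (k + 2) true (-d) S) (hE.symm h2))
  simpa [arc] using h3

/-- A piece on the two strands next to the lower end of the newest arc. -/
theorem arc_cons_low (k : ℕ) (hk : P.length = k) (d x : α) (s : Slice α) (hs : s.pos = k)
    (hin : s.input = [d, x]) :
    SkeinEq W z a (P ++ x :: S) (arc k d (x :: S) ++ [s])
      ([.cup (k + 1) d, .cross k false x d, s] ++
        up (k + s.output.length) true (-d) S) := by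
  have hE := skeinEq_regular (α := α) (W := W) (z := z) (a := a)
  have h1 := hE.low_up s P [] (k + s.output.length) (k + 2) true (-d) S (by omega)
    (by simp [hs]) (by simp [hs, hin])
  have h2 := hE.cupSlide P S k true d x hk
  simp only [Bool.not_true] at h2
  have h3 := hE.trans (hE.symm (hE.ctx_left [.cup k d, .cross (k + 1) true (-d) x]
    (L := P ++ x :: S) (by subst hk; simp [hin]) h1))
    (hE.ctx_right (s :: up (k + s.output.length) true (-d) S) h2)
  simpa [arc, up] using h3

/-- A rightmost point at the lower end of the newest arc and the strand above. -/
theorem cap_upper_mem (ha : a * ai = 1) (hφ : φ ∈ skeinSpace W z a []) (h : PiecesPreserve A φ n)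
    {d : α} (k : ℕ) (hk : P.length = k) (hf : f ∈ stdSpan A φ (P ++ -d :: S))
    (hn : k + 1 + S.length = n) :
    act (A := A) [.cap k d] (act (A := A) (arc k d (-d :: S)) f) ∈
      stdSpan A φ (P ++ S ++ [-d]) := by
  have hE := skeinEq_regular (α := α) (W := W) (z := z) (a := a)
  have hV := stdSpan_le hφ _ hf
  have e := arc_cons_low (W := W) (z := z) (a := a) (P := P) (S := S) k hk d (-d) (.cap k d) rfl rfl
  have hg : act (A := A) [.cup (k + 1) d] f ∈ skeinSpace W z a (P ++ -d :: - -d :: -d :: S) :=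
    act_mem hV (by subst hk; simp)
  have c := act_curl ha k false hk hg
  simp only [neg_neg] at c
  have h2 := hE.zigzag' P S k d hk f hV
  rw [← act_append, e f hV, act_append]
  change act (A := A) (up k true (-d) S) (act (A := A) [.cross k false (-d) d, .cap k d]
    (act (A := A) [.cup (k + 1) d] f)) ∈ _
  rw [c, map_smul]
  refine Submodule.smul_mem _ _ ?_
  change act (A := A) (up k true (-d) S) (act (A := A) [.cup (k + 1) d, .cap k (-d)] f) ∈ _
  rw [h2]
  exact h.up_mem k true hk hn hf

/-- A rightmost point on the newest arc and the strand at the top. -/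
theorem cap_top_aux (hφ : φ ∈ skeinSpace W z a []) (h : PiecesPreserve A φ n)
    {d : α} (k j : ℕ) (hk : P.length = k) (hf : f ∈ stdSpan A φ (P ++ S ++ [d]))
    (hj : k + 1 + S.length = j) (hn : j = n) :
    act (A := A) (.cup k d :: up (k + 1) true (-d) S ++ [.cap j (-d)]) f ∈
      stdSpan A φ (P ++ d :: S) := by
  have hE := skeinEq_regular (α := α) (W := W) (z := z) (a := a)
  -- For `S = []` the word is a zigzag. In general the top strand is pulled down through `S`, and
  -- each strand of `S` leaves one crossing among `n` strands at the end of the word, which `h`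
  -- absorbs.
  induction S generalizing P k with
  | nil =>
    simp only [List.length_nil, Nat.add_zero] at hj
    subst hj
    have := hE.zigzag P [] k d hk f (by simpa using stdSpan_le hφ _ hf)
    simp only [up, List.cons_append, List.nil_append]
    rw [this]
    simpa using hf
  | cons x S ih =>
    have hV := stdSpan_le hφ _ hf
    have e : SkeinEq W z a (P ++ x :: S ++ [d])
        (.cup k d :: up (k + 1) true (-d) (x :: S) ++ [.cap j (-d)])
        ((.cup (k + 1) d :: up (k + 2) true (-d) S ++ [.cap j (-d)]) ++
          [.cross k false x d]) := by
      have h2 := hE.cupSlide P (S ++ [d]) k true d x hk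
      simp only [Bool.not_true] at h2
      have h1 := hE.low_up_append (.cross k false x d) P [] (k + 2) (k + 2) true (-d) S [d] hk
        rfl rfl
      have h0 := hE.ctx_right (up (k + 2) true (-d) S ++ [.cap j (-d)]) h2
      refine hE.trans (by simpa [up] using h0) ?_
      refine hE.trans (y := .cup (k + 1) d :: (up (k + 2) true (-d) S ++
        [.cross k false x d, .cap j (-d)])) ?_ ?_
      · have := hE.ctx [.cup (k + 1) d] [.cap j (-d)] (L := P ++ x :: (S ++ [d]))
          (by subst hk; simp [Slice.input]) h1
        simpa using this
      · have := hE.exch (L := P ++ x :: (S ++ [d]))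
          (.cup (k + 1) d :: up (k + 2) true (-d) S) [] (.cross k false x d) (.cap 0 (-d)) P S
          [] j j hk ?_ (by simp [Slice.pos, Slice.output] at hj ⊢; omega)
          (by simp [Slice.pos, Slice.input] at hj ⊢; omega)
        · simpa [Slice.setPos] using this
        · have h3 := typed_up_append (P ++ [x, d]) (k + 2) true (-d) S [d] (by simpa using hk)
          subst hk
          simpa [Slice.input] using h3
    rw [e f hV, act_append]
    have h4 := ih (P := P ++ [x]) (k + 1) (by simpa using hk) (by simpa using hf)
      (by simp at hj; omega)
    exact h.crossings P S k false x d hk (by simp) (by simp at hj; omega) _ (by simpa using h4)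

theorem up_concat (k : ℕ) (o : Bool) (c x : α) (S : List α) :
    up k o c (S ++ [x]) = up k o c S ++ [.cross (k + S.length) o c x] := by
  simp [up_append, up]

/-- The last crossing of the arc and the rightmost point form a curl; removing it leaves the
situation of `cap_top_aux`. -/
theorem cap_top_mem (ha : a * ai = 1) (hφ : φ ∈ skeinSpace W z a []) (h : PiecesPreserve A φ n)
    {d : α} (k : ℕ) (hk : P.length = k) (hf : f ∈ stdSpan A φ (P ++ S ++ [d]))
    (hn : k + 1 + S.length = n) :
    act (A := A) [.cap n d] (act (A := A) (arc k d (S ++ [d])) f) ∈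
      stdSpan A φ (P ++ d :: S) := by
  have hV := stdSpan_le hφ _ hf
  have hg : act (A := A) (.cup k d :: up (k + 1) true (-d) S) f ∈
      skeinSpace W z a ((P ++ d :: S) ++ -d :: - -d :: []) := by
    refine act_mem hV ?_
    have h3 := typed_up_append (P ++ [d]) (k + 1) true (-d) S [d] (by simpa using hk)
    subst hk
    simpa using h3
  have c := act_curl ha n true (by simp; omega) hg
  simp only [neg_neg] at c
  rw [arc, up_concat, ← List.cons_append, act_append, hn]
  change act (A := A) [.cross n true (-d) d, .cap n d]
    (act (A := A) (.cup k d :: up (k + 1) true (-d) S) f) ∈ _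
  rw [c]
  refine Submodule.smul_mem _ _ ?_
  rw [← act_append]
  exact cap_top_aux hφ h k n hk hf hn rfl

/-- By `arc_cross_lower` the crossing becomes a crossing of the kind `!o` of the arc with `x`. For
`o = false` this is a standard arc. For `o = true` the skein relation switches it, and the splices
give either an arc beside a straightened strand or a leftmost point after crossings of `n` strands.
-/
theorem cross_lower_mem (hφ : φ ∈ skeinSpace W z a []) (h : PiecesPreserve A φ n) {x d : α} (k : ℕ)
    (o : Bool) (hk : P.length = k) (hf : f ∈ stdSpan A φ (P ++ x :: S))
    (hn : k + 1 + S.length = n) :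
    act (A := A) [.cross k o x d] (act (A := A) (arc (k + 1) d S) f) ∈
      stdSpan A φ (P ++ d :: x :: S ++ [-d]) := by
  have hE := skeinEq_regular (α := α) (W := W) (z := z) (a := a)
  have hV := stdSpan_le hφ _ hf
  rw [← act_append, arc_cross_lower k hk o x d f hV]
  have hpos : act (A := A) (up (k + 2) true (-d) S) (act (A := A) [.cross (k + 1) true (-d) x]
      (act (A := A) [.cup k d] f)) ∈ stdSpan A φ (P ++ d :: x :: S ++ [-d]) := by
    have := arc_mem (P := P) (S := x :: S) d k hk hf
    rw [arc, up, act_cons, act_cons (.cross _ _ _ _)] at this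
    exact this
  cases o with
  | false => exact hpos
  | true =>
    have hg : act (A := A) [.cup k d] f ∈ skeinSpace W z a ((P ++ [d]) ++ -d :: x :: S) :=
      act_mem hV (by subst hk; simp)
    have sk := act_cross_false (k + 1) (by simpa using hk) hg
    rw [act_append]
    change act (A := A) (up (k + 2) true (-d) S) (act (A := A) [.cross (k + 1) false (-d) x]
      (act (A := A) [.cup k d] f)) ∈ _
    rw [sk, map_sub, map_smul, map_sub]
    refine Submodule.sub_mem _ hpos (Submodule.smul_mem _ _ (Submodule.sub_mem _ ?_ ?_))
    · split_ifs with hx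
      · rw [neg_neg] at hx ⊢
        subst hx
        have e := hE.zigzag P S k x hk f hV
        have := arc_mem (P := P ++ [x]) (S := S) x (k + 1) (by simpa using hk)
          (by simpa using hf)
        rw [← act_append, ← act_append]
        change act (A := A) ([.cup k x, .cap (k + 1) (-x)] ++ arc (k + 1) x S) f ∈ _
        rw [act_append, e]
        simpa using this
      · rw [map_zero]; exact Submodule.zero_mem _
    · split_ifs with hx
      · subst hx
        have e := hE.low_up (.cup k d) P [] (k + 2) k true (-d) S hk rfl rfl f
          (by simpa [Slice.input] using hV)
        rw [← act_append, List.singleton_append, e, act_append]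
        have h1 := h.up_mem k true hk hn hf
        have := h.cup (P := P) (S := S ++ [-d]) (by simpa using h1) (by simp; omega) d k hk
        simpa using this
      · rw [map_zero]; exact Submodule.zero_mem _

/-- For `o = true` the crossing cancels, after a slide, against the crossing of the arc with `x`,
and the arc starts above `x` instead. The other kind is reduced to this one by the skein relation.
-/
theorem cross_upper_mem (ha : a * ai = 1) (hφ : φ ∈ skeinSpace W z a [])
    (h : PiecesPreserve A φ n) {x d : α} (k : ℕ) (o : Bool) (hk : P.length = k)
    (hf : f ∈ stdSpan A φ (P ++ x :: S)) (hn : k + 1 + S.length = n) :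
    act (A := A) [.cross k o d x] (act (A := A) (arc k d (x :: S)) f) ∈
      stdSpan A φ (P ++ x :: d :: S ++ [-d]) := by
  have hE := skeinEq_regular (α := α) (W := W) (z := z) (a := a)
  have hV := stdSpan_le hφ _ hf
  have hpos : act (A := A) [.cross k true d x] (act (A := A) (arc k d (x :: S)) f) ∈
      stdSpan A φ (P ++ x :: d :: S ++ [-d]) := by
    have e := arc_cons_low (W := W) (z := z) (a := a) (P := P) (S := S) k hk d x
      (.cross k true d x) rfl rfl
    have e2 := hE.reidemeisterTwo (P ++ []) (-d :: S) k false x d (by simpa using hk)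
    rw [← act_append, e f hV]
    have e3 := hE.ctx (L := P ++ x :: S) [.cup (k + 1) d] (up (k + 2) true (-d) S)
      (by subst hk; simp) e2 f hV
    have := arc_mem (P := P ++ [x]) (S := S) d (k + 1) (by simpa using hk) (by simpa using hf)
    refine (congrArg (· ∈ _) e3).mpr ?_
    simpa [arc] using this
  cases o with
  | true => exact hpos
  | false =>
    have hg : act (A := A) (arc k d (x :: S)) f ∈
        skeinSpace W z a (P ++ d :: x :: (S ++ [-d])) := by
      have := act_mem hV (typed_arc P k d (x :: S) hk)
      simpa using this
    rw [act_cross_false k hk hg]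
    refine Submodule.sub_mem _ hpos (Submodule.smul_mem _ _ (Submodule.sub_mem _ ?_ ?_))
    · split_ifs with hx
      · subst hx
        rw [act_cons]
        have h1 := cap_upper_mem ha hφ h k hk hf hn
        have := h.cup (P := P) (S := S ++ [-d]) (by simpa using h1) (by simp; omega) (-d) k hk
        simpa using this
      · exact Submodule.zero_mem _
    · split_ifs with hx
      · subst hx
        simpa using arc_mem d k hk hf
      · exact Submodule.zero_mem _

/-- For `o = false` the crossing cancels the last crossing of the arc. The remaining arc ends below
`x`, so it is not standard; but all its crossings have `x` above them, which is what `h'` allows.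
The other kind follows by the skein relation. -/
theorem cross_top_mem (ha : a * ai = 1) (hφ : φ ∈ skeinSpace W z a [])
    (h : PiecesPreserve A φ n) (h' : CrossingsPreserve A φ 1 (n + 2)) {x d : α} (k : ℕ) (o : Bool)
    (hk : P.length = k) (hf : f ∈ stdSpan A φ (P ++ S ++ [x])) (hn : k + 1 + S.length = n) :
    act (A := A) [.cross n o x (-d)] (act (A := A) (arc k d (S ++ [x])) f) ∈
      stdSpan A φ (P ++ d :: S ++ [-d, x]) := by
  have hE := skeinEq_regular (α := α) (W := W) (z := z) (a := a)
  have hV := stdSpan_le hφ _ hf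
  have hneg : act (A := A) [.cross n false x (-d)] (act (A := A) (arc k d (S ++ [x])) f) ∈
      stdSpan A φ (P ++ d :: S ++ [-d, x]) := by
    have ht : Typed (P ++ S ++ [x]) (.cup k d :: up (k + 1) true (-d) S)
        ((P ++ d :: S) ++ -d :: x :: []) := by
      have h3 := typed_up_append (P ++ [d]) (k + 1) true (-d) S [x] (by simpa using hk)
      subst hk
      simpa using h3
    have e := hE.reidemeisterTwo (P ++ d :: S) [] n true (-d) x (by simp; omega)
    have e2 := hE.ctx_left _ ht e f hV
    rw [← act_append, arc, up_concat, hn]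
    simp only [List.cons_append, List.append_assoc, List.nil_append, List.append_nil,
      Bool.not_true] at e2 ⊢
    rw [e2, act_cons]
    have h1 := h.cup (P := P) (S := S ++ [x]) (by simpa using hf) (by simp; omega) d k hk
    have := h'.up_mem (P := P ++ [d]) (S := S) (T := [x]) (k + 1) true (by simpa using hk) (by simp)
      (by simp; omega) (by simpa using h1)
    simpa using this
  cases o with
  | false => exact hneg
  | true =>
    have hg : act (A := A) (arc k d (S ++ [x])) f ∈
        skeinSpace W z a ((P ++ d :: S) ++ x :: -d :: []) := by
      have := act_mem hV (by simpa using typed_arc P k d (S ++ [x]) hk)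
      simpa using this
    have sk := act_skein n (by simp; omega) hg
    rw [sub_eq_iff_eq_add] at sk
    rw [sk]
    refine Submodule.add_mem _ (Submodule.smul_mem _ _ (Submodule.sub_mem _ ?_ ?_)) hneg
    · split_ifs with hx
      · rw [neg_inj] at hx
        subst hx
        rw [act_cons]
        have h1 := cap_top_mem ha hφ h k hk hf hn
        have := h.cup (P := P ++ d :: S) (S := []) (by simpa using h1) (by simp; omega) (-d) n
          (by simp; omega)
        simpa using this
      · exact Submodule.zero_mem _
    · split_ifs with hx
      · subst hx
        have := arc_mem (P := P) (S := S ++ [-d]) d k hk (by simpa using hf)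
        simpa using this
      · exact Submodule.zero_mem _

end Step
end Span

/-! ### The induction on the number of strands. -/

section Span

variable {α : Type} [InvolutiveNeg α] [DecidableEq α]
variable {A : Type*} [CommRing A] {W : Type*} [AddCommGroup W] [Module A W]
variable {z a zi ai : A} {φ : List (Slice α) → W}

/-- Next to a strand a circle is evaluated by `act_circle`. Without strands the skein relation does
not evaluate it, so `hcirc` is needed. Invertibility of `z` removes the factor. -/
theorem circle_mem (hα : ∀ d x : α, d = x ∨ d = -x) (hz : zi * z = 1) (ha : a * ai = 1)
    (hφ : φ ∈ skeinSpace W z a [])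
    (hcirc : ∀ d, z • act (A := A) [.cup 0 d, .cap 0 d] φ = circleFactor z a ai d • φ)
    {P : List α} {f : List (Slice α) → W} (d : α) (hf : f ∈ stdSpan A φ P) :
    act (A := A) [.cap P.length d] (act (A := A) [.cup P.length d] f) ∈ stdSpan A φ P := by
  have key : z • act (A := A) [.cup P.length d, .cap P.length d] f ∈ stdSpan A φ P := by
    obtain rfl | ⟨Q, x, rfl⟩ := P.eq_nil_or_concat'
    · rw [← map_smul]
      refine act_mem_of_std (L := []) ?_ (Submodule.smul_mem _ z hf)
      intro f hf
      have hfφ : f = φ := by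
        generalize hL : ([] : List α) = L at hf
        cases hf with
        | nil => rfl
        | arc => simp at hL
      subst f
      have := Submodule.smul_mem _ (circleFactor z a ai d)
        (Submodule.subset_span hf : φ ∈ stdSpan A φ [])
      rw [← hcirc] at this
      have := Submodule.smul_mem _ zi this
      rwa [smul_smul, hz, one_smul] at this
    · have := act_circle hα ha (P := Q) (S := []) (x := x) d Q.length rfl
        (by simpa using stdSpan_le hφ _ hf)
      rw [List.length_append, List.length_singleton, this]
      exact Submodule.smul_mem _ _ hf
  have := Submodule.smul_mem _ zi key
  rwa [smul_smul, hz, one_smul] at this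

theorem exists_append_of_append_eq {U T P X : List α} (h : U ++ T = P ++ X)
    (hl : U.length ≤ P.length) : ∃ V, P = U ++ V ∧ T = V ++ X := by
  obtain ⟨V, hV⟩ := List.prefix_of_prefix_length_le ⟨T, h⟩ ⟨X, rfl⟩ hl
  refine ⟨V, hV.symm, ?_⟩
  rw [← hV, List.append_assoc] at h
  exact List.append_cancel_left h

/-- Either the piece misses the ends of the newest arc, or it is a leftmost point at the very top,
or it acts on two strands that contain an end: the lower end with the strand below it, the lower end
with the strand above it, or the upper end with the strand below it. -/
theorem piece_arc_mem (hα : ∀ d x : α, d = x ∨ d = -x) (hz : zi * z = 1) (ha : a * ai = 1)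
    (hφ : φ ∈ skeinSpace W z a [])
    (hcirc : ∀ d, z • act (A := A) [.cup 0 d, .cap 0 d] φ = circleFactor z a ai d • φ)
    {n : ℕ} (h : PiecesPreserve A φ n) {P S Q T : List α} {d : α} (s : Slice α)
    (hn : P.length + S.length = n) (hs : Q.length = s.pos)
    (heq : Q ++ s.input ++ T = P ++ d :: S ++ [-d])
    (htop : T = [] → CrossingsPreserve A φ 1 (n + 2)) {f : List (Slice α) → W}
    (hf : f ∈ stdSpan A φ (P ++ S)) :
    act (A := A) [s] (act (A := A) (arc P.length d S) f) ∈ stdSpan A φ (Q ++ s.output ++ T) := by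
  have hlen := congrArg List.length heq
  simp only [List.length_append, List.length_cons, List.length_nil] at hlen
  by_cases h1 : Q.length + s.input.length ≤ P.length
  · obtain ⟨V, rfl, rfl⟩ := exists_append_of_append_eq (U := Q ++ s.input) (T := T) (P := P)
      (X := d :: S ++ [-d]) (by simpa using heq) (by simpa using h1)
    have := low_mem hφ h s d _ hs rfl hf (by simpa [Nat.add_assoc] using hn)
    simpa using this
  by_cases h2 : P.length + 1 ≤ Q.length ∧ Q.length + s.input.length ≤ n + 1
  · obtain ⟨V, rfl, h3⟩ := exists_append_of_append_eq (U := P ++ [d]) (T := S ++ [-d]) (P := Q)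
      (X := s.input ++ T) (by simpa using heq.symm) (by simpa using h2.1)
    obtain ⟨V', rfl, rfl⟩ := exists_append_of_append_eq (U := V ++ s.input) (T := T) (P := S)
      (X := [-d]) (by simpa using h3.symm) (by simp at h2 ⊢; omega)
    have := high_mem hφ h s d _ rfl (by rw [← hs]; simp; omega) hf (by simpa using hn)
    simpa using this
  cases s with
  | cup k c =>
    -- The only position left is above the arc, where a leftmost point is itself a standard arc.
    obtain rfl : T = [] := by
      rw [← List.length_eq_zero_iff]
      simp only [Slice.input, List.length_nil] at h1 h2 hlen
      omega
    have hQ : Q = P ++ d :: S ++ [-d] := by simpa [Slice.input] using heq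
    have h3 := arc_mem (P := Q) (S := []) c k hs (f := act (A := A) (arc P.length d S) f)
      (by rw [hQ, List.append_nil]; exact arc_mem d _ rfl hf)
    simpa [Slice.output, arc, up] using h3
  | cap k x =>
    simp only [Slice.input, List.length_cons, List.length_nil] at h1 h2 hlen
    simp only [Slice.input, Slice.output, List.append_nil, Slice.pos] at heq hs ⊢
    obtain h3 | h3 | ⟨h3, h4⟩ : Q.length + 1 = P.length ∨ Q.length = P.length ∨
        (P.length < Q.length ∧ Q.length = n) := by omega
    · obtain ⟨rfl, h5⟩ := List.append_inj (s₁ := Q ++ [x]) (t₁ := -x :: T) (s₂ := P)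
        (t₂ := d :: S ++ [-d]) (by simpa using heq) (by simpa using h3)
      simp only [List.cons_append, List.cons.injEq] at h5
      obtain ⟨rfl, rfl⟩ := h5
      have := cap_lower_mem hφ h k hs (by simpa using hf) (by simp at hn; omega)
      rw [List.length_append, List.length_singleton, hs]
      simpa using this
    · obtain ⟨rfl, h5⟩ := List.append_inj (s₁ := Q) (t₁ := x :: -x :: T) (s₂ := P)
        (t₂ := d :: S ++ [-d]) (by simpa using heq) (by simpa using h3)
      simp only [List.cons_append, List.cons.injEq] at h5
      obtain ⟨rfl, h5⟩ := h5
      -- If `S = []`, the rightmost point joins the two ends of the arc and closes a circle.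
      cases S with
      | nil =>
        simp only [List.nil_append, List.cons.injEq, true_and] at h5
        subst h5
        have := circle_mem hα hz ha hφ hcirc x (by simpa using hf)
        rw [hs] at this
        simpa [arc, up, hs] using this
      | cons y S =>
        simp only [List.cons_append, List.cons.injEq] at h5
        obtain ⟨rfl, rfl⟩ := h5
        have := cap_upper_mem ha hφ h k hs hf (by simp at hn; omega)
        rw [hs]
        simpa using this
    · obtain rfl | ⟨S, y, rfl⟩ := S.eq_nil_or_concat'
      · simp at hn; omega
      obtain ⟨rfl, h5⟩ := List.append_inj (s₁ := Q) (t₁ := x :: -x :: T) (s₂ := P ++ d :: S)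
        (t₂ := [y, -d]) (by simpa using heq) (by simp at hn ⊢; omega)
      simp only [List.cons.injEq, neg_inj] at h5
      obtain ⟨rfl, rfl, rfl⟩ := h5
      have := cap_top_mem ha hφ h (P := P) (S := S) P.length rfl (by simpa using hf)
        (by simp at hn; omega)
      rw [← hs, h4]
      simpa using this
  | cross k o x y =>
    simp only [Slice.input, List.length_cons, List.length_nil] at h1 h2 hlen
    simp only [Slice.input, Slice.output, List.append_nil, Slice.pos] at heq hs ⊢
    obtain h3 | h3 | ⟨h3, h4⟩ : Q.length + 1 = P.length ∨ Q.length = P.length ∨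
        (P.length < Q.length ∧ Q.length = n) := by omega
    · obtain ⟨rfl, h5⟩ := List.append_inj (s₁ := Q ++ [x]) (t₁ := y :: T) (s₂ := P)
        (t₂ := d :: S ++ [-d]) (by simpa using heq) (by simpa using h3)
      simp only [List.cons_append, List.cons.injEq] at h5
      obtain ⟨rfl, rfl⟩ := h5
      have := cross_lower_mem hφ h k o (d := y) hs (by simpa using hf) (by simp at hn; omega)
      rw [List.length_append, List.length_singleton, hs]
      simpa using this
    · obtain ⟨rfl, h5⟩ := List.append_inj (s₁ := Q) (t₁ := x :: y :: T) (s₂ := P)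
        (t₂ := d :: S ++ [-d]) (by simpa using heq) (by simpa using h3)
      simp only [List.cons_append, List.cons.injEq] at h5
      obtain ⟨rfl, h5⟩ := h5
      -- If `S = []`, the two ends of the arc cross each other: a curl on a leftmost point.
      cases S with
      | nil =>
        simp only [List.nil_append, List.cons.injEq] at h5
        obtain ⟨rfl, rfl⟩ := h5
        have hV := stdSpan_le hφ _ hf
        have c := act_cup_curl ha (d := x) k o hs hV
        rw [hs]
        change act (A := A) [.cup k x, .cross k o x (-x)] f ∈ _
        rw [c]
        refine Submodule.smul_mem _ _ ?_
        have := arc_mem (P := Q) (S := []) (-x) k hs hf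
        simpa [arc, up] using this
      | cons y' S =>
        simp only [List.cons_append, List.cons.injEq] at h5
        obtain ⟨rfl, rfl⟩ := h5
        have := cross_upper_mem ha hφ h k o (d := x) hs hf (by simp at hn; omega)
        rw [hs]
        simpa using this
    · obtain rfl | ⟨S, y', rfl⟩ := S.eq_nil_or_concat'
      · simp at hn; omega
      obtain ⟨rfl, h5⟩ := List.append_inj (s₁ := Q) (t₁ := x :: y :: T) (s₂ := P ++ d :: S)
        (t₂ := [y', -d]) (by simpa using heq) (by simp at hn ⊢; omega)
      simp only [List.cons.injEq] at h5
      obtain ⟨rfl, rfl, rfl⟩ := h5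
      have := cross_top_mem ha hφ h (htop rfl) (P := P) (S := S) (x := x) (d := d) P.length o rfl
        (by simpa using hf) (by simp at hn; omega)
      rw [← hs, h4]
      simpa using this

/-- A standard functional on `n` strands is an arc added to one on `n - 2` strands, so strong
induction applies. The one case that needs information on `n` strands themselves, a crossing at the
top, uses only crossings that are not at the top. -/
theorem piecesPreserve (hα : ∀ d x : α, d = x ∨ d = -x) (hz : zi * z = 1) (ha : a * ai = 1)
    (hφ : φ ∈ skeinSpace W z a [])
    (hcirc : ∀ d, z • act (A := A) [.cup 0 d, .cap 0 d] φ = circleFactor z a ai d • φ) (n : ℕ) :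
    PiecesPreserve A φ n := by
  induction n using Nat.strong_induction_on with
  | h n ih =>
    -- Crossings with a strand above come first; for them the hypothesis about the top is vacuous.
    have below : CrossingsPreserve A φ 1 n := by
      intro P S k o d e hk hS hn f hf
      refine act_mem_of_std (fun f hf => ?_) hf
      generalize hL : P ++ d :: e :: S = L at hf
      cases hf with
      | nil => simp at hL
      | arc P' S' d' f hf =>
        have hlen := congrArg List.length hL
        simp only [List.length_append, List.length_cons, List.length_nil] at hlen
        have := piece_arc_mem hα hz ha hφ hcirc (ih (P'.length + S'.length) (by omega))
          (Q := P) (T := S) (.cross k o d e) rfl hk (by simpa [Slice.input] using hL)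
          (by rintro rfl; simp at hS) (Submodule.subset_span hf)
        simp only [Slice.output, List.append_assoc, List.cons_append, List.nil_append] at this
        exact this
    intro P S s hs hn f hf
    refine act_mem_of_std (fun f hf => ?_) hf
    generalize hL : P ++ s.input ++ S = L at hf
    cases hf with
    | nil =>
      simp only [List.append_eq_nil_iff] at hL
      obtain ⟨⟨rfl, h2⟩, rfl⟩ := hL
      cases s with
      | cup k d =>
        have h3 := arc_mem (A := A) (P := []) (S := []) d k hs
          (Submodule.subset_span (Std.nil (φ := φ)))
        simpa [arc, up, Slice.output] using h3
      | cap k d => simp [Slice.input] at h2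
      | cross k o d e => simp [Slice.input] at h2
    | arc P' S' d' f hf =>
      have hlen := congrArg List.length hL
      simp only [List.length_append, List.length_cons, List.length_nil] at hlen hn
      refine piece_arc_mem hα hz ha hφ hcirc (ih (P'.length + S'.length) (by omega))
          (Q := P) (T := S) s rfl hs hL (fun _ => ?_) (Submodule.subset_span hf)
      rwa [show P'.length + S'.length + 2 = n by omega]

/-- A skein functional on closed diagrams is a multiple of its value on the empty diagram. -/
theorem skein_mem_span (hα : ∀ d x : α, d = x ∨ d = -x) (hz : zi * z = 1) (ha : a * ai = 1)
    (hφ : φ ∈ skeinSpace W z a [])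
    (hcirc : ∀ d, z • act (A := A) [.cup 0 d, .cap 0 d] φ = circleFactor z a ai d • φ)
    {w : List (Slice α)} (hw : Typed [] w []) : ∃ c : A, φ w = c • φ [] := by
  have key : ∀ (w : List (Slice α)) (L M : List α), Typed L w M → ∀ f ∈ stdSpan A φ L,
      act (A := A) w f ∈ stdSpan A φ M := by
    intro w
    induction w with
    | nil => intro L M h f hf; rw [typed_nil] at h; subst h; exact hf
    | cons s w ih =>
      intro L M h f hf
      obtain ⟨N, h1, h2⟩ := typed_cons.1 h
      obtain ⟨P, S, hP, rfl, rfl⟩ := step_eq_some.1 h1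
      rw [act_cons]
      exact ih _ _ h2 _ (piecesPreserve hα hz ha hφ hcirc _ P S s hP rfl f hf)
  have h1 := key w [] [] hw φ (Submodule.subset_span Std.nil)
  -- Every arc adds two strands, so on no strands the span is the line through `φ`.
  have h2 : {f | Std φ ([] : List α) f} = {φ} := by
    ext f
    constructor
    · intro hf
      replace hf : Std φ [] f := hf
      generalize hL : ([] : List α) = L at hf
      cases hf with
      | nil => rfl
      | arc => simp at hL
    · rintro rfl; exact Std.nil
  rw [stdSpan, h2, Submodule.mem_span_singleton] at h1
  obtain ⟨c, hc⟩ := h1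
  refine ⟨c, ?_⟩
  have := congrFun hc []
  simpa [act_apply] using this.symm

end Span

/-! ## A state model for `R` at `a = t ^ N` -/

theorem Dir.neg_ne (d : Dir) : -d ≠ d := by cases d <;> decide

theorem Dir.eq_or_eq_neg (d x : Dir) : d = x ∨ d = -x := by cases d <;> cases x <;> decide

namespace Model

variable {F : Type*} [Field F] {N : ℕ}

/-- The order of the colors that is relevant for strands of a given direction. -/
def prec : Dir → Fin N → Fin N → Prop
  | .east, i, j => i < j
  | .west, i, j => j < i

instance (d : Dir) (i j : Fin N) : Decidable (prec d i j) := by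
  cases d <;> unfold prec <;> infer_instance

theorem prec_neg (d : Dir) (i j : Fin N) : prec (-d) i j ↔ prec d j i := by
  cases d <;> exact Iff.rfl

theorem prec_irrefl (d : Dir) (i : Fin N) : ¬ prec d i i := by
  cases d <;> exact lt_irrefl i

theorem prec_trichotomy (d : Dir) (i j : Fin N) :
    (prec d i j ∧ i ≠ j ∧ ¬ prec d j i) ∨ (i = j) ∨ (prec d j i ∧ i ≠ j ∧ ¬ prec d i j) := by
  cases d <;> simp only [prec] <;> omega

/-- Weight of a leftmost point. -/
def cupWt (t : F) : Dir → Fin N → F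
  -- The numbers `2i + 1 - N` are symmetric about `0`; summed over the colors, the circle becomes
  -- the quantum integer `(t^N - t^(-N)) / (t - t⁻¹)`. A strand is straightened without a factor
  -- because `capWt` is defined as the inverse weight.
  | .east, i => t ^ (-(2 * (i : ℤ) + 1 - N))
  | .west, _ => 1

/-- Weight of a rightmost point. -/
def capWt (t : F) (d : Dir) (i : Fin N) : F := (cupWt t (-d) i)⁻¹

/-- Weight of the two strands of equal color at a crossing of strands of equal direction. -/
def eqWt (t : F) (o : Bool) : F := if o then t⁻¹ else t

/-- Weight of a crossing of strands of equal direction that exchanges the colors. -/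
def turnWt (t : F) (o : Bool) (d : Dir) (i j : Fin N) : F :=
  if o then (if prec d i j then -(t - t⁻¹) else 0) else (if prec d j i then t - t⁻¹ else 0)

/-- Weight of a crossing that lets the colors pass. -/
def passWt (t : F) (o : Bool) (d e : Dir) (i j : Fin N) : F :=
  if i = j then (if d = e then eqWt t o else eqWt t (!o)) else 1

/-- Weight of a crossing of strands of opposite directions that changes the colors. -/
def jumpWt (t : F) (o : Bool) (d : Dir) (i x : Fin N) : F :=
  -- This is forced by the slides: the crossing is one of equal directions rotated by a leftmost and
  -- a rightmost point, which switches its kind.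
  capWt t d i * cupWt t (-d) x * turnWt t (!o) (-d) i x

/-- The matrix of a crossing. -/
def crossWt (t : F) (o : Bool) (d e : Dir) (i j x y : Fin N) : F :=
  (if x = j ∧ y = i then passWt t o d e i j else 0) +
    if d = e then (if x = i ∧ y = j then turnWt t o d i j else 0)
    else if i = j ∧ x = y then jumpWt t o d i x else 0

/-- The matrix of a piece. -/
def wt (t : F) : Slice Dir → List (Fin N) → List (Fin N) → F
  | .cup _ d => fun _ out =>
    match out with
    | [x, y] => if x = y then cupWt t d x else 0
    | _ => 0
  | .cap _ d => fun inp _ =>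
    match inp with
    | [i, j] => if i = j then capWt t d i else 0
    | _ => 0
  | .cross _ o d e => fun inp out =>
    match inp, out with
    | [i, j], [x, y] => crossWt t o d e i j x y
    | _, _ => 0

/-- All pairs of colors. -/
def pairs (N : ℕ) : Finset (List (Fin N)) :=
  Finset.univ.map ⟨fun p : Fin N × Fin N => [p.1, p.2], by
    rintro ⟨a, b⟩ ⟨c, d⟩ h; simpa using h⟩

theorem sum_pairs (h : List (Fin N) → F) : ∑ x ∈ pairs N, h x = ∑ i, ∑ j, h [i, j] := by
  rw [pairs, Finset.sum_map, Fintype.sum_prod_type]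
  rfl

/-- The possible colors to the right of a piece. -/
def outs : Slice Dir → Finset (List (Fin N))
  | .cap _ _ => {[]}
  | _ => pairs N

theorem length_of_mem_outs {s : Slice Dir} {x : List (Fin N)} (hx : x ∈ outs s) :
    x.length = s.output.length := by
  cases s <;> simp [outs, pairs] at hx
  · obtain ⟨a, b, rfl⟩ := hx; rfl
  · subst hx; rfl
  · obtain ⟨a, b, rfl⟩ := hx; rfl

/-- The transfer operator of a piece. -/
def op (t : F) (s : Slice Dir) (g : List (Fin N) → F) (I : List (Fin N)) : F :=
  -- A function of the colors on the right is pulled back to a function of the colors on the left,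
  -- which is why `opWord` folds from the right.
  ∑ x ∈ outs s, wt t s ((I.drop s.pos).take s.input.length) x *
    g (I.take s.pos ++ x ++ I.drop (s.pos + s.input.length))

/-- The transfer operator of a word. -/
def opWord (t : F) (w : List (Slice Dir)) (g : List (Fin N) → F) : List (Fin N) → F :=
  w.foldr (op t) g

@[simp] theorem opWord_nil (t : F) (g : List (Fin N) → F) : opWord t [] g = g := rfl

@[simp] theorem opWord_cons (t : F) (s : Slice Dir) (w : List (Slice Dir))
    (g : List (Fin N) → F) : opWord t (s :: w) g = op t s (opWord t w g) := rfl

theorem opWord_append (t : F) (v w : List (Slice Dir)) (g : List (Fin N) → F) :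
    opWord t (v ++ w) g = opWord t v (opWord t w g) := by simp [opWord]

variable {t : F}

theorem op_append (s : Slice Dir) (g : List (Fin N) → F) (P i S : List (Fin N))
    (hP : P.length = s.pos) (hi : i.length = s.input.length) :
    op t s g (P ++ i ++ S) = ∑ x ∈ outs s, wt t s i x * g (P ++ x ++ S) := by
  rw [op, ← hP, ← hi, List.append_assoc, List.drop_left, List.take_left, List.take_left,
    ← List.append_assoc, ← List.length_append, List.drop_left]

theorem exists_split {β γ : Type*} {I : List β} {P i S : List γ}
    (h : I.length = (P ++ i ++ S).length) :
    ∃ P' i' S', I = P' ++ i' ++ S' ∧ P'.length = P.length ∧ i'.length = i.length ∧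
      S'.length = S.length := by
  refine ⟨I.take P.length, (I.drop P.length).take i.length, I.drop (P.length + i.length), ?_⟩
  simp only [List.length_append] at h
  refine ⟨?_, by simp; omega, by simp; omega, by simp; omega⟩
  rw [← List.drop_drop, List.append_assoc, List.take_append_drop, List.take_append_drop]

/-- Two words have the same transfer operator, starting from the strands `L`. -/
def ModelEq (t : F) (N : ℕ) (L : List Dir) (x y : List (Slice Dir)) : Prop :=
  ∀ (g : List (Fin N) → F) (I : List (Fin N)), I.length = L.length → opWord t x g I = opWord t y g I

theorem op_congr {s : Slice Dir} {L M : List Dir} (hs : s.step L = some M)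
    {g g' : List (Fin N) → F} (h : ∀ I, I.length = M.length → g I = g' I)
    {I : List (Fin N)} (hI : I.length = L.length) : op t s g I = op t s g' I := by
  obtain ⟨P, S, hP, rfl, rfl⟩ := step_eq_some.1 hs
  obtain ⟨P', i, S', rfl, h1, h2, h3⟩ := exists_split hI
  rw [op_append s g P' i S' (h1.trans hP) h2, op_append s g' P' i S' (h1.trans hP) h2]
  refine Finset.sum_congr rfl fun x hx => ?_
  rw [h]
  simp [length_of_mem_outs hx, h1, h3]

theorem opWord_congr {w : List (Slice Dir)} {L M : List Dir} (hw : Typed L w M)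
    {g g' : List (Fin N) → F} (h : ∀ I, I.length = M.length → g I = g' I)
    {I : List (Fin N)} (hI : I.length = L.length) : opWord t w g I = opWord t w g' I := by
  induction w generalizing L I with
  | nil => rw [typed_nil] at hw; subst hw; exact h I hI
  | cons s w ih =>
    obtain ⟨K, h1, h2⟩ := typed_cons.1 hw
    exact op_congr h1 (fun J hJ => ih h2 hJ) hI

@[simp] theorem wt_setPos (s : Slice Dir) (j : ℕ) (i x : List (Fin N)) :
    wt t (s.setPos j) i x = wt t s i x := by cases s <;> rfl

@[simp] theorem outs_setPos (s : Slice Dir) (j : ℕ) :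
    (outs (s.setPos j) : Finset (List (Fin N))) = outs s := by cases s <;> rfl

theorem modelEq_congr : TangleCongr (ModelEq t N) where
  refl _ _ _ _ _ := rfl
  symm h g I hI := (h g I hI).symm
  trans h h' g I hI := (h g I hI).trans (h' g I hI)
  ctx A B x y hA h g I hI := by
    simp only [opWord_append]
    exact opWord_congr hA (fun J hJ => h _ J hJ) hI
  exchange s t' P Q S hP g I hI := by
    rw [List.append_assoc, List.append_assoc (P ++ s.input)] at hI
    obtain ⟨P', i, R, rfl, h1, h2, h3⟩ := exists_split hI
    rw [← List.append_assoc] at h3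
    obtain ⟨Q', j, S', rfl, h4, h5, h6⟩ := exists_split h3
    simp only [opWord_cons, opWord_nil]
    rw [op_append s _ P' i _ (h1.trans hP) h2]
    have hR : P' ++ i ++ (Q' ++ j ++ S') = (P' ++ i ++ Q') ++ j ++ S' := by simp
    rw [hR, op_append (t'.setPos _) _ (P' ++ i ++ Q') j S' (by simp; omega) (by simpa using h5)]
    have e1 : ∀ x ∈ outs s, op t (t'.setPos (s.pos + s.output.length + Q.length)) g
        (P' ++ x ++ (Q' ++ j ++ S')) = ∑ y ∈ outs t', wt t t' j y * g (P' ++ x ++ Q' ++ y ++ S') := by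
      intro x hx
      have hR : P' ++ x ++ (Q' ++ j ++ S') = (P' ++ x ++ Q') ++ j ++ S' := by simp
      rw [hR, op_append (t'.setPos _) _ (P' ++ x ++ Q') j S'
        (by simp [length_of_mem_outs hx]; omega) (by simpa using h5)]
      simp
    have e2 : ∀ y ∈ outs (t'.setPos (s.pos + s.input.length + Q.length)),
        op t s g (P' ++ i ++ Q' ++ y ++ S') =
        ∑ x ∈ outs s, wt t s i x * g (P' ++ x ++ Q' ++ y ++ S') := by
      intro y _
      have hR : P' ++ i ++ Q' ++ y ++ S' = P' ++ i ++ (Q' ++ y ++ S') := by simp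
      rw [hR, op_append s _ P' i _ (h1.trans hP) h2]
      simp
    rw [Finset.sum_congr rfl fun x hx => congrArg (wt t s i x * ·) (e1 x hx)]
    rw [Finset.sum_congr rfl fun y hy => congrArg (wt t (t'.setPos _) j y * ·) (e2 y hy)]
    simp only [outs_setPos, wt_setPos, Finset.mul_sum]
    rw [Finset.sum_comm]
    refine Finset.sum_congr rfl fun y _ => Finset.sum_congr rfl fun x _ => ?_
    ring

theorem op_cup (P S : List (Fin N)) (k : ℕ) (d : Dir) (g : List (Fin N) → F)
    (hk : P.length = k) :
    op t (.cup k d) g (P ++ S) = ∑ x, cupWt t d x * g (P ++ x :: x :: S) := by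
  have := op_append (t := t) (.cup k d) g P [] S hk rfl
  simp only [List.append_nil] at this
  rw [this]
  simp only [outs, sum_pairs, wt, ite_mul, zero_mul, Finset.sum_ite_eq, Finset.mem_univ, if_true]
  simp

theorem op_cap (P S : List (Fin N)) (i j : Fin N) (k : ℕ) (d : Dir) (g : List (Fin N) → F)
    (hk : P.length = k) :
    op t (.cap k d) g (P ++ i :: j :: S) = if i = j then capWt t d i * g (P ++ S) else 0 := by
  have := op_append (t := t) (.cap k d) g P [i, j] S hk rfl
  simp only [List.append_assoc, List.cons_append, List.nil_append] at this
  rw [this]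
  simp [outs, wt]

theorem op_cross (P S : List (Fin N)) (i j : Fin N) (k : ℕ) (o : Bool) (d e : Dir)
    (g : List (Fin N) → F) (hk : P.length = k) :
    op t (.cross k o d e) g (P ++ i :: j :: S) =
      passWt t o d e i j * g (P ++ j :: i :: S) +
        if d = e then turnWt t o d i j * g (P ++ i :: j :: S)
        else if i = j then ∑ x, jumpWt t o d i x * g (P ++ x :: x :: S) else 0 := by
  have := op_append (t := t) (.cross k o d e) g P [i, j] S hk rfl
  simp only [List.append_assoc, List.cons_append, List.nil_append] at this
  rw [this]
  simp only [outs, sum_pairs, wt, crossWt, List.cons_append, List.nil_append, add_mul,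
    Finset.sum_add_distrib]
  congr 1
  · simp [ite_and]
  · split_ifs with h1 h2
    · simp [ite_and]
    · simp [h2]
    · simp [h2]

theorem op_cup_succ (P S : List (Fin N)) (c : Fin N) (k : ℕ) (d : Dir) (g : List (Fin N) → F)
    (hk : P.length = k) :
    op t (.cup (k + 1) d) g (P ++ c :: S) = ∑ x, cupWt t d x * g (P ++ c :: x :: x :: S) := by
  have := op_cup (t := t) (P ++ [c]) S (k + 1) d g (by simpa using hk)
  simpa using this

theorem op_cap_succ (P S : List (Fin N)) (c i j : Fin N) (k : ℕ) (d : Dir)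
    (g : List (Fin N) → F) (hk : P.length = k) :
    op t (.cap (k + 1) d) g (P ++ c :: i :: j :: S) =
      if i = j then capWt t d i * g (P ++ c :: S) else 0 := by
  have := op_cap (t := t) (P ++ [c]) S i j (k + 1) d g (by simpa using hk)
  simpa using this

theorem op_cross_succ (P S : List (Fin N)) (c i j : Fin N) (k : ℕ) (o : Bool) (d e : Dir)
    (g : List (Fin N) → F) (hk : P.length = k) :
    op t (.cross (k + 1) o d e) g (P ++ c :: i :: j :: S) =
      passWt t o d e i j * g (P ++ c :: j :: i :: S) +
        if d = e then turnWt t o d i j * g (P ++ c :: i :: j :: S)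
        else if i = j then ∑ x, jumpWt t o d i x * g (P ++ c :: x :: x :: S) else 0 := by
  have := op_cross (t := t) (P ++ [c]) S i j (k + 1) o d e g (by simpa using hk)
  simpa using this

end Model

/-! ### Geometric sums and inverse matrices for the weights. -/

namespace Model

variable {F : Type*} [Field F] {N : ℕ} {t : F}

theorem cupWt_ne_zero (ht : t ≠ 0) (d : Dir) (i : Fin N) : cupWt t d i ≠ 0 := by
  cases d <;> simp [cupWt, ht, zpow_ne_zero]

theorem cupWt_mul_capWt (ht : t ≠ 0) (d : Dir) (i : Fin N) : cupWt t d i * capWt t (-d) i = 1 := by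
  rw [capWt, neg_neg, mul_inv_cancel₀ (cupWt_ne_zero ht d i)]

theorem capWt_mul_cupWt (ht : t ≠ 0) (d : Dir) (i : Fin N) : capWt t d i * cupWt t (-d) i = 1 := by
  rw [capWt, inv_mul_cancel₀ (cupWt_ne_zero ht _ i)]

/-- The weight of a circle of a given color. -/
def loopWt (t : F) (d : Dir) (i : Fin N) : F := cupWt t d i * capWt t d i

theorem loopWt_west (i : Fin N) : loopWt t .west i = t ^ (2 * (i : ℤ) + 1 - N) := by
  change cupWt t .west i * (cupWt t .east i)⁻¹ = _
  simp [cupWt, ← zpow_neg]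

theorem loopWt_east (i : Fin N) : loopWt t .east i = t ^ (-(2 * (i : ℤ) + 1 - N)) := by
  change cupWt t .east i * (cupWt t .west i)⁻¹ = _
  simp [cupWt]

theorem geom_sum_range (s : F) (hs : s ≠ 0) (c : ℤ) (m : ℕ) :
    (s - s⁻¹) * ∑ x ∈ Finset.range m, s ^ (2 * (x : ℤ) + c) =
      s ^ (2 * (m : ℤ) + c - 1) - s ^ (c - 1) := by
  induction m with
  | zero => simp
  | succ m ih =>
    rw [Finset.sum_range_succ, mul_add, ih]
    have h1 : s ^ (2 * (m : ℤ) + c) = s ^ (2 * (m : ℤ) + c - 1) * s := by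
      rw [← zpow_add_one₀ hs]; congr 1; ring
    have h2 : s ^ (2 * ((m + 1 : ℕ) : ℤ) + c - 1) = s ^ (2 * (m : ℤ) + c - 1) * s * s := by
      rw [← zpow_add_one₀ hs, ← zpow_add_one₀ hs]; congr 1; push_cast; ring
    rw [h1, h2]; field_simp; ring

theorem geom_sum_Ico (s : F) (hs : s ≠ 0) (c : ℤ) {l m : ℕ} (h : l ≤ m) :
    (s - s⁻¹) * ∑ x ∈ Finset.Ico l m, s ^ (2 * (x : ℤ) + c) =
      s ^ (2 * (m : ℤ) + c - 1) - s ^ (2 * (l : ℤ) + c - 1) := by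
  rw [Finset.sum_Ico_eq_sub _ h, mul_sub, geom_sum_range s hs, geom_sum_range s hs]; ring

theorem sum_ite_eq_sum_Ico (q : Fin N → Prop) [DecidablePred q] (h : ℕ → F) (l m : ℕ)
    (hm : m ≤ N) (hq : ∀ x : Fin N, q x ↔ l ≤ (x : ℕ) ∧ (x : ℕ) < m) :
    (∑ x : Fin N, if q x then h x else 0) = ∑ x ∈ Finset.Ico l m, h x := by
  have h1 : ∀ x : Fin N, (if q x then h x else 0) =
      (fun x : ℕ => if l ≤ x ∧ x < m then h x else 0) x := fun x => by simp [hq]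
  rw [Finset.sum_congr rfl fun x _ => h1 x, Fin.sum_univ_eq_sum_range
    (fun x : ℕ => if l ≤ x ∧ x < m then h x else 0), ← Finset.sum_filter]
  refine Finset.sum_congr ?_ fun _ _ => rfl
  ext x; simp; omega

/-- The factor `t - t⁻¹` makes the geometric sum telescope; for `west` the same holds with `t⁻¹` and
the opposite order. This sum evaluates the curl in `op_curl`. -/
theorem sum_after (ht : t ≠ 0) (d : Dir) (i : Fin N) :
    (t - t⁻¹) * (∑ x, if prec d i x then loopWt t (-d) x else 0) =
      t ^ (N : ℤ) - t * loopWt t (-d) i := by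
  cases d with
  | east =>
    change (t - t⁻¹) * (∑ x, if prec .east i x then loopWt t .west x else 0) =
      t ^ (N : ℤ) - t * loopWt t .west i
    simp only [loopWt_west, prec, add_sub_assoc]
    rw [sum_ite_eq_sum_Ico (fun x => i < x) (fun x => t ^ (2 * (x : ℤ) + (1 - N))) (i + 1) N le_rfl
      (fun x => by omega), geom_sum_Ico t ht _ (by omega)]
    rw [← zpow_one_add₀ ht]
    congr 2 <;> push_cast <;> ring
  | west =>
    change (t - t⁻¹) * (∑ x, if prec .west i x then loopWt t .east x else 0) =
      t ^ (N : ℤ) - t * loopWt t .east i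
    have e : ∀ x : ℕ, t ^ (-(2 * (x : ℤ) + 1 - N)) = t⁻¹ ^ (2 * (x : ℤ) + (1 - N)) := fun x => by
      rw [inv_zpow', add_sub_assoc]
    simp only [loopWt_east, prec, e]
    rw [sum_ite_eq_sum_Ico (fun x => x < i) (fun x => t⁻¹ ^ (2 * (x : ℤ) + (1 - N))) 0 i i.2.le
      (fun x => by omega)]
    have := geom_sum_Ico t⁻¹ (inv_ne_zero ht) (1 - N) (Nat.zero_le i)
    rw [inv_inv] at this
    rw [← neg_sub t⁻¹ t, neg_mul, this]
    rw [inv_zpow', inv_zpow', inv_zpow', ← zpow_one_add₀ ht, neg_sub]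
    congr 2 <;> push_cast <;> ring

/-- The same telescoping over the intermediate colors, needed for the matrix product in
`diagWt_mul`. -/
theorem sum_between (ht : t ≠ 0) (d : Dir) (i m : Fin N) (h : prec d i m) :
    (t - t⁻¹) * (∑ x, if prec d i x ∧ prec d x m then loopWt t (-d) x else 0) =
      t⁻¹ * loopWt t (-d) m - t * loopWt t (-d) i := by
  cases d with
  | east =>
    change (t - t⁻¹) * (∑ x, if prec .east i x ∧ prec .east x m then loopWt t .west x else 0) =
      t⁻¹ * loopWt t .west m - t * loopWt t .west i
    simp only [prec] at h
    simp only [loopWt_west, prec, add_sub_assoc]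
    rw [sum_ite_eq_sum_Ico (fun x => i < x ∧ x < m) (fun x => t ^ (2 * (x : ℤ) + (1 - N))) (i + 1) m
      m.2.le (fun x => by omega), geom_sum_Ico t ht _ (by omega)]
    rw [← zpow_one_add₀ ht, mul_comm t⁻¹, ← zpow_sub_one₀ ht]
    congr 2; push_cast; ring
  | west =>
    change (t - t⁻¹) * (∑ x, if prec .west i x ∧ prec .west x m then loopWt t .east x else 0) =
      t⁻¹ * loopWt t .east m - t * loopWt t .east i
    have e : ∀ x : ℕ, t ^ (-(2 * (x : ℤ) + 1 - N)) = t⁻¹ ^ (2 * (x : ℤ) + (1 - N)) := fun x => by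
      rw [inv_zpow', add_sub_assoc]
    simp only [prec] at h
    simp only [loopWt_east, prec, e]
    rw [sum_ite_eq_sum_Ico (fun x => x < i ∧ m < x) (fun x => t⁻¹ ^ (2 * (x : ℤ) + (1 - N)))
      (m + 1) i i.2.le (fun x => by omega)]
    have := geom_sum_Ico t⁻¹ (inv_ne_zero ht) (1 - N) (show (m : ℕ) + 1 ≤ i by omega)
    rw [inv_inv] at this
    rw [← neg_sub t⁻¹ t, neg_mul, this]
    rw [inv_zpow', inv_zpow', inv_zpow', inv_zpow', ← zpow_one_add₀ ht, neg_sub, mul_comm t⁻¹,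
      ← zpow_sub_one₀ ht]
    congr 2 <;> push_cast <;> ring

theorem sum_loopWt (ht : t ≠ 0) (d : Dir) :
    (t - t⁻¹) * (∑ x : Fin N, loopWt t d x) = t ^ (N : ℤ) - (t ^ (N : ℤ))⁻¹ := by
  cases d with
  | west =>
    simp only [loopWt_west, add_sub_assoc]
    rw [Fin.sum_univ_eq_sum_range (fun x : ℕ => t ^ (2 * (x : ℤ) + (1 - N))), geom_sum_range t ht,
      ← zpow_neg]
    congr 2 <;> ring
  | east =>
    have e : ∀ x : ℕ, t ^ (-(2 * (x : ℤ) + 1 - N)) = t⁻¹ ^ (2 * (x : ℤ) + (1 - N)) := fun x => by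
      rw [inv_zpow', add_sub_assoc]
    simp only [loopWt_east, e]
    have := geom_sum_range t⁻¹ (inv_ne_zero ht) (1 - N) N
    rw [inv_inv] at this
    rw [Fin.sum_univ_eq_sum_range (fun x : ℕ => t⁻¹ ^ (2 * (x : ℤ) + (1 - N))),
      ← neg_sub t⁻¹ t, neg_mul, this, inv_zpow', inv_zpow', neg_sub, ← zpow_neg]
    congr 2 <;> ring

theorem turnWt_neg (o : Bool) (d : Dir) (i x : Fin N) :
    turnWt t o (-d) i x = turnWt t o d x i := by
  simp only [turnWt, prec_neg]

/-- The matrix of a crossing of strands of opposite directions and equal colors. -/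
def diagWt (t : F) (o : Bool) (d : Dir) : Matrix (Fin N) (Fin N) F :=
  fun i x => (if i = x then eqWt t (!o) else 0) + jumpWt t o d i x

theorem diagWt_true (ht : t ≠ 0) (d : Dir) (i x : Fin N) : diagWt t true d i x =
    capWt t d i * cupWt t (-d) x *
      ((if i = x then t else 0) + if prec d i x then t - t⁻¹ else 0) := by
  have h : (if i = x then eqWt t false else 0) =
      capWt t d i * cupWt t (-d) x * (if i = x then t else 0) := by
    split_ifs with h
    · rw [← h, capWt_mul_cupWt ht]; simp [eqWt]
    · simp
  simp only [diagWt, jumpWt, turnWt, Bool.not_true, prec_neg, h, mul_add]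
  simp

theorem diagWt_false (ht : t ≠ 0) (d : Dir) (i x : Fin N) : diagWt t false (-d) i x =
    capWt t (-d) i * cupWt t d x *
      ((if i = x then t⁻¹ else 0) - if prec d i x then t - t⁻¹ else 0) := by
  have h : (if i = x then eqWt t true else 0) =
      capWt t (-d) i * cupWt t d x * (if i = x then t⁻¹ else 0) := by
    split_ifs with h
    · have := capWt_mul_cupWt ht (-d) i
      rw [neg_neg] at this
      rw [← h, this]; simp [eqWt]
    · simp
  simp only [diagWt, jumpWt, turnWt, Bool.not_false, neg_neg, h, mul_sub]
  split_ifs <;> ring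

/-- This is the second Reidemeister move for opposite directions and equal colors. Both factors are
triangular for the order `prec d`. An entry off the diagonal consists of two end terms and a sum
over intermediate colors, and these cancel by `sum_between`. -/
theorem diagWt_mul (ht : t ≠ 0) (d : Dir) :
    (diagWt t true d : Matrix (Fin N) (Fin N) F) * diagWt t false (-d) = 1 := by
  ext i m
  rw [Matrix.mul_apply, Matrix.one_apply]
  have e : ∀ x, diagWt t true d i x * diagWt t false (-d) x m = capWt t d i * cupWt t d m *
      ((if i = x then (if x = m then loopWt t (-d) x else 0) else 0) +
        (if x = m then (if prec d i x then t⁻¹ * (t - t⁻¹) * loopWt t (-d) x else 0) else 0) -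
        (if i = x then (if prec d x m then t * (t - t⁻¹) * loopWt t (-d) x else 0) else 0) -
        (t - t⁻¹) * ((t - t⁻¹) *
          if prec d i x ∧ prec d x m then loopWt t (-d) x else 0)) := by
    intro x
    rw [diagWt_true ht, diagWt_false ht, loopWt]
    have hb := prec_trichotomy d x m
    obtain ⟨a1, a2, a3⟩ | rfl | ⟨a1, a2, a3⟩ := prec_trichotomy d i x <;>
    obtain ⟨b1, b2, b3⟩ | rfl | ⟨b1, b2, b3⟩ := hb <;>
    simp only [*, prec_irrefl, if_true, if_false, and_self, and_true, true_and, and_false,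
      false_and, ne_eq, not_true_eq_false, not_false_eq_true] <;> field_simp <;> ring
  rw [Finset.sum_congr rfl fun x _ => e x, ← Finset.mul_sum, Finset.sum_sub_distrib,
    Finset.sum_sub_distrib, Finset.sum_add_distrib, Finset.sum_ite_eq, Finset.sum_ite_eq',
    Finset.sum_ite_eq, ← Finset.mul_sum, ← Finset.mul_sum]
  simp only [Finset.mem_univ, if_true]
  obtain ⟨h1, h2, h3⟩ | rfl | ⟨h1, h2, h3⟩ := prec_trichotomy d i m
  · rw [sum_between ht d i m h1]
    simp only [h1, h2, if_true, if_false]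
    ring
  · have h0 : ∀ x, ¬ (prec d i x ∧ prec d x i) := fun x h => by
      obtain ⟨a1, a2, a3⟩ | rfl | ⟨a1, a2, a3⟩ := prec_trichotomy d i x
      · exact a3 h.2
      · exact prec_irrefl d i h.1
      · exact a3 h.1
    simp only [prec_irrefl, h0, if_true, if_false, Finset.sum_const_zero]
    have h1 := cupWt_mul_capWt ht d i
    have h2 := capWt_mul_cupWt ht d i
    rw [loopWt]
    linear_combination (cupWt t d i * capWt t (-d) i) * h2 + h1
  · have h0 : ∀ x, ¬ (prec d i x ∧ prec d x m) := fun x h => by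
      cases d <;> simp only [prec] at h h1 <;> omega
    simp only [h0, h2, h3, if_false, Finset.sum_const_zero]
    ring

theorem diagWt_mul' (ht : t ≠ 0) (o : Bool) (d : Dir) :
    (diagWt t o d : Matrix (Fin N) (Fin N) F) * diagWt t (!o) (-d) = 1 := by
  cases o with
  | true => exact diagWt_mul ht d
  | false =>
    have := diagWt_mul (N := N) ht (-d)
    rw [neg_neg] at this
    exact mul_eq_one_comm.1 this

theorem op_cross_diag (P S : List (Fin N)) (i : Fin N) (k : ℕ) (o : Bool) (d : Dir)
    (g : List (Fin N) → F) (hk : P.length = k) :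
    op t (.cross k o d (-d)) g (P ++ i :: i :: S) =
      ∑ x, diagWt t o d i x * g (P ++ x :: x :: S) := by
  rw [op_cross P S i i k o d (-d) g hk, if_neg (Dir.neg_ne d).symm, if_pos rfl, passWt, if_pos rfl,
    if_neg (Dir.neg_ne d).symm]
  simp only [diagWt, add_mul, Finset.sum_add_distrib, ite_mul, zero_mul, Finset.sum_ite_eq,
    Finset.mem_univ, if_true]

theorem op_cross_opp (P S : List (Fin N)) (i j : Fin N) (h : i ≠ j) (k : ℕ) (o : Bool) (d : Dir)
    (g : List (Fin N) → F) (hk : P.length = k) :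
    op t (.cross k o d (-d)) g (P ++ i :: j :: S) = g (P ++ j :: i :: S) := by
  rw [op_cross P S i j k o d (-d) g hk, if_neg (Dir.neg_ne d).symm, if_neg h, passWt, if_neg h]
  simp

theorem op_cross_same (P S : List (Fin N)) (i j : Fin N) (k : ℕ) (o : Bool) (d : Dir)
    (g : List (Fin N) → F) (hk : P.length = k) :
    op t (.cross k o d d) g (P ++ i :: j :: S) =
      (if i = j then eqWt t o else 1) * g (P ++ j :: i :: S) +
        turnWt t o d i j * g (P ++ i :: j :: S) := by
  rw [op_cross P S i j k o d d g hk, if_pos rfl, passWt, if_pos rfl]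

theorem op_cross_same_succ (P S : List (Fin N)) (c i j : Fin N) (k : ℕ) (o : Bool) (d : Dir)
    (g : List (Fin N) → F) (hk : P.length = k) :
    op t (.cross (k + 1) o d d) g (P ++ c :: i :: j :: S) =
      (if i = j then eqWt t o else 1) * g (P ++ c :: j :: i :: S) +
        turnWt t o d i j * g (P ++ c :: i :: j :: S) := by
  rw [op_cross_succ P S c i j k o d d g hk, if_pos rfl, passWt, if_pos rfl]

end Model

theorem exists_split_one {β γ : Type*} {I : List β} {P S : List γ} {a : γ}
    (h : I.length = (P ++ a :: S).length) :
    ∃ P' i S', I = P' ++ i :: S' ∧ P'.length = P.length ∧ S'.length = S.length := by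
  obtain ⟨P', i, S', rfl, h1, h2, h3⟩ := Model.exists_split (P := P) (i := [a]) (S := S)
    (by simpa using h)
  obtain ⟨i, rfl⟩ := List.length_eq_one_iff.1 h2
  exact ⟨P', i, S', by simp, h1, h3⟩

theorem exists_split_two {β γ : Type*} {I : List β} {P S : List γ} {a b : γ}
    (h : I.length = (P ++ a :: b :: S).length) :
    ∃ P' i j S', I = P' ++ i :: j :: S' ∧ P'.length = P.length ∧ S'.length = S.length := by
  obtain ⟨P', i, S', rfl, h1, h2⟩ := exists_split_one h
  obtain ⟨Q, j, T, rfl, h3, h4⟩ := exists_split_one (P := []) h2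
  obtain rfl := List.length_eq_zero_iff.1 h3
  exact ⟨P', i, j, T, rfl, h1, h4⟩

theorem exists_split_three {β γ : Type*} {I : List β} {P S : List γ} {a b c : γ}
    (h : I.length = (P ++ a :: b :: c :: S).length) :
    ∃ P' i j l S', I = P' ++ i :: j :: l :: S' ∧ P'.length = P.length ∧ S'.length = S.length := by
  obtain ⟨P', i, j, S', rfl, h1, h2⟩ := exists_split_two h
  obtain ⟨Q, l, T, rfl, h3, h4⟩ := exists_split_one (P := []) h2
  obtain rfl := List.length_eq_zero_iff.1 h3
  exact ⟨P', i, j, l, T, rfl, h1, h4⟩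

/-! ### Zigzags, slides and Reidemeister moves in the vertex model. -/

namespace Model

variable {F : Type*} [Field F] {N : ℕ} {t : F}

theorem prec_trans {d : Dir} {i j l : Fin N} (h : prec d i j) (h' : prec d j l) : prec d i l := by
  cases d <;> simp only [prec] at * <;> omega

theorem prec_cases (d : Dir) (i j : Fin N) : (prec d i j ∧ i ≠ j ∧ j ≠ i ∧ ¬ prec d j i) ∨
    (i = j) ∨ (prec d j i ∧ i ≠ j ∧ j ≠ i ∧ ¬ prec d i j) := by
  cases d <;> simp only [prec] <;> omega

theorem modelEq_zigzag (ht : t ≠ 0) (P S : List Dir) (k : ℕ) (d : Dir) (hk : P.length = k) :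
    ModelEq t N (P ++ d :: S) [.cup k d, .cap (k + 1) (-d)] [] := by
  intro g I hI
  obtain ⟨P', i, S', rfl, h1, h2⟩ := exists_split_one hI
  simp only [opWord_cons, opWord_nil]
  rw [op_cup _ _ _ _ _ (h1.trans hk)]
  simp only [op_cap_succ _ _ _ _ _ _ _ _ (h1.trans hk), mul_ite, mul_zero, Finset.sum_ite_eq',
    Finset.mem_univ, if_true]
  rw [← mul_assoc, cupWt_mul_capWt ht, one_mul]

theorem modelEq_zigzag' (ht : t ≠ 0) (P S : List Dir) (k : ℕ) (d : Dir) (hk : P.length = k) :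
    ModelEq t N (P ++ -d :: S) [.cup (k + 1) d, .cap k (-d)] [] := by
  intro g I hI
  obtain ⟨P', i, S', rfl, h1, h2⟩ := exists_split_one hI
  simp only [opWord_cons, opWord_nil]
  rw [op_cup_succ _ _ _ _ _ _ (h1.trans hk)]
  simp only [op_cap _ _ _ _ _ _ _ (h1.trans hk), mul_ite, mul_zero, Finset.sum_ite_eq,
    Finset.mem_univ, if_true]
  rw [← mul_assoc, cupWt_mul_capWt ht, one_mul]

/-- The terms where the colors pass agree one by one. The other terms agree because `jumpWt` is a
rotated `turnWt`: whichever side has opposite directions at its crossing, its jump equals the turn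
on the other side. -/
theorem modelEq_cupSlide (ht : t ≠ 0) (P S : List Dir) (k : ℕ) (o : Bool) (d e : Dir)
    (hk : P.length = k) : ModelEq t N (P ++ e :: S) [.cup k d, .cross (k + 1) o (-d) e]
      [.cup (k + 1) d, .cross k (!o) e d] := by
  intro g I hI
  obtain ⟨P', j, S', rfl, h1, h2⟩ := exists_split_one hI
  simp only [opWord_cons, opWord_nil]
  rw [op_cup _ _ _ _ _ (h1.trans hk), op_cup_succ _ _ _ _ _ _ (h1.trans hk)]
  simp only [op_cross_succ _ _ _ _ _ _ _ _ _ _ (h1.trans hk),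
    op_cross _ _ _ _ _ _ _ _ _ (h1.trans hk), mul_add, Finset.sum_add_distrib]
  congr 1
  · refine Finset.sum_congr rfl fun x _ => ?_
    congr 2
    obtain rfl | rfl := Dir.eq_or_eq_neg e d <;>
      simp [passWt, Dir.neg_ne, (Dir.neg_ne _).symm, eq_comm]
  · obtain rfl | rfl := Dir.eq_or_eq_neg e d
    · simp only [if_neg (Dir.neg_ne e), if_true, mul_ite, mul_zero, Finset.sum_ite_eq',
        Finset.mem_univ, Finset.mul_sum]
      refine Finset.sum_congr rfl fun x _ => ?_
      have := cupWt_mul_capWt ht e j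
      rw [jumpWt, neg_neg]
      linear_combination (cupWt t e x * turnWt t (!o) e j x * g (P' ++ j :: x :: x :: S')) * this
    · simp only [if_neg (Dir.neg_ne d), if_true, mul_ite, mul_zero, Finset.sum_ite_eq,
        Finset.mem_univ, Finset.mul_sum]
      refine Finset.sum_congr rfl fun x _ => ?_
      have := cupWt_mul_capWt ht d j
      rw [jumpWt, neg_neg, Bool.not_not, turnWt_neg]
      linear_combination -(cupWt t d x * turnWt t o d j x * g (P' ++ x :: x :: j :: S')) * this

theorem modelEq_reidemeisterTwo (ht : t ≠ 0) (P S : List Dir) (k : ℕ) (o : Bool) (d e : Dir)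
    (hk : P.length = k) :
    ModelEq t N (P ++ d :: e :: S) [.cross k o d e, .cross k (!o) e d] [] := by
  intro g I hI
  obtain ⟨P', i, j, S', rfl, h1, h2⟩ := exists_split_two hI
  simp only [opWord_cons, opWord_nil]
  obtain rfl | rfl := Dir.eq_or_eq_neg e d
  · simp only [op_cross_same _ _ _ _ _ _ _ _ (h1.trans hk)]
    obtain ⟨a1, a2, a2', a3⟩ | rfl | ⟨a1, a2, a2', a3⟩ := prec_cases e i j <;> cases o <;>
    simp only [*, prec_irrefl, turnWt, eqWt, if_true, if_false, Bool.not_true,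
      Bool.not_false, Bool.false_eq_true, ne_eq, not_true_eq_false, not_false_eq_true] <;>
    field_simp <;> ring
  · by_cases h : i = j
    · subst h
      rw [op_cross_diag _ _ _ _ _ _ _ (h1.trans hk)]
      have e1 : ∀ x : Fin N, op t (.cross k (!o) (-d) d) g (P' ++ x :: x :: S') =
          ∑ y, diagWt t (!o) (-d) x y * g (P' ++ y :: y :: S') := fun x => by
        have := op_cross_diag (t := t) P' S' x k (!o) (-d) g (h1.trans hk)
        rwa [neg_neg] at this
      simp only [e1, Finset.mul_sum]
      rw [Finset.sum_comm]
      simp only [← mul_assoc, ← Finset.sum_mul, ← Matrix.mul_apply, diagWt_mul' ht o d,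
        Matrix.one_apply, ite_mul, one_mul, zero_mul, Finset.sum_ite_eq, Finset.mem_univ, if_true]
    · have e1 := op_cross_opp (t := t) P' S' j i (Ne.symm h) k (!o) (-d) g (h1.trans hk)
      rw [neg_neg] at e1
      rw [op_cross_opp _ _ _ _ h _ _ _ _ (h1.trans hk), e1]

theorem modelEq_isotopy (ht : t ≠ 0) : IsotopyCongr (ModelEq t N) where
  toTangleCongr := modelEq_congr
  zigzag := modelEq_zigzag ht
  zigzag' := modelEq_zigzag' ht
  cupSlide := modelEq_cupSlide ht
  reidemeisterTwo := modelEq_reidemeisterTwo ht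

/-- The Yang-Baxter equation, checked for each relative order of the three colors. Only equal
directions need this computation; the rest follows by rotation. -/
theorem modelEq_r3_same (ht : t ≠ 0) (o : Bool) (d : Dir) : HasR3 (ModelEq t N) o d d d := by
  intro P S k hk g I hI
  obtain ⟨P', i, j, l, S', rfl, h1, h2⟩ := exists_split_three hI
  simp only [opWord_cons, opWord_nil]
  simp only [op_cross_same _ _ _ _ _ _ _ _ (h1.trans hk),
    op_cross_same_succ _ _ _ _ _ _ _ _ _ (h1.trans hk)]
  have h12 := prec_cases d i j
  have h13 := prec_cases d i l
  have h23 := prec_cases d j l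
  obtain ⟨a1, a2, a2', a3⟩ | rfl | ⟨a1, a2, a2', a3⟩ := h12 <;>
  obtain ⟨b1, b2, b2', b3⟩ | rfl | ⟨b1, b2, b2', b3⟩ := h13 <;>
  obtain ⟨c1, c2, c2', c3⟩ | c | ⟨c1, c2, c2', c3⟩ := h23 <;>
  try subst c
  all_goals
  -- Inconsistent combinations of the three comparisons are discarded before computing.
  first
  | exact absurd (prec_trans a1 c1) b3
  | exact absurd (prec_trans c1 a1) b3
  | exact absurd (prec_trans a1 b1) c3
  | exact absurd (prec_trans b1 a1) c3
  | exact absurd c1 a3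
  | exact absurd c1 b3
  | exact absurd c1 (prec_irrefl _ _)
  | exact absurd b1 c3
  | (cases o <;> simp [*, prec_irrefl, turnWt, eqWt] <;>
    field_simp <;> ring)

end Model

theorem Model.modelEq_regular {F : Type*} [Field F] {N : ℕ} {t : F} (ht : t ≠ 0) :
    RegularCongr (ModelEq t N) where
  toIsotopyCongr := modelEq_isotopy ht
  reidemeisterThree := by
    have h := modelEq_isotopy (N := N) ht
    -- Up to reversing everything there are four patterns of three directions, and successive
    -- rotations reach them all from the pattern of equal directions.
    have h1 : ∀ o d, HasR3 (ModelEq t N) o (-d) d d := fun o d =>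
      h.r3_rotate (by rw [neg_neg]; exact modelEq_r3_same ht _ _)
    have h2 : ∀ o d, HasR3 (ModelEq t N) o (-d) d (-d) := fun o d =>
      h.r3_rotate (by rw [neg_neg]; exact h1 _ _)
    have h3 : ∀ o d, HasR3 (ModelEq t N) o d d (-d) := fun o d => h.r3_rotate (h2 _ _)
    intro o d e f
    have hf := Dir.eq_or_eq_neg f e
    obtain rfl | rfl := Dir.eq_or_eq_neg d e <;> obtain rfl | rfl := hf
    · exact modelEq_r3_same ht _ _
    · exact h3 _ _
    · exact h1 _ _
    · exact h2 _ _

/-! ### From elementary moves on typed words to congruences. -/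

section Moves

variable {α : Type} [InvolutiveNeg α] [DecidableEq α]
  {E : List α → List (Slice α) → List (Slice α) → Prop}

theorem replaceAt_zero_pair_eq_some {d e : α} {out L M : List α} :
    replaceAt 0 [d, e] out L = some M ↔ ∃ S, L = d :: e :: S ∧ M = out ++ S := by
  rw [replaceAt_eq_some]
  constructor
  · rintro ⟨P, S, hP, rfl, rfl⟩
    obtain rfl := List.length_eq_zero_iff.1 hP
    exact ⟨S, by simp, by simp⟩
  · rintro ⟨S, rfl, rfl⟩
    exact ⟨[], S, rfl, by simp, by simp⟩

theorem typed_cons_split {s : Slice α} {w : List (Slice α)} {L M : List α}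
    (h : Typed L (s :: w) M) : ∃ P S, P.length = s.pos ∧ L = P ++ s.input ++ S ∧
      Typed (P ++ s.output ++ S) w M := by
  obtain ⟨N, h1, h2⟩ := typed_cons.1 h
  obtain ⟨P, S, hP, rfl, rfl⟩ := step_eq_some.1 h1
  exact ⟨P, S, hP, rfl, h2⟩

theorem exists_append_singleton {P : List α} {k : ℕ} (h : P.length = k + 1) :
    ∃ Q c, P = Q ++ [c] ∧ Q.length = k := by
  obtain rfl | ⟨Q, c, rfl⟩ := P.eq_nil_or_concat'
  · simp at h
  · exact ⟨Q, c, rfl, by simpa using h⟩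

/-- A congruence that contains the elementary moves between strands with fitting labels contains
all elementary moves. -/
theorem RegularCongr.of_localMove (h : RegularCongr E) {x y : List (Slice α)} (hm : LocalMove x y)
    {L M : List α} (hx : Typed L x M) : Typed L y M ∧ E L x y := by
  cases hm with
  | exchange s t n =>
    obtain ⟨P, S, hP, rfl, h1⟩ := typed_cons_split hx
    rw [← hP, Nat.add_assoc, List.append_assoc] at h1
    obtain ⟨_, h2, h3⟩ := typed_cons.1 h1
    clear h1
    rw [typed_nil] at h3
    subst h3
    rename' h2 => h1
    rw [step_unfold, Slice.pos_setPos, Slice.input_setPos, Slice.output_setPos,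
      replaceAt_append_length_add, Option.map_eq_some_iff] at h1
    obtain ⟨T, h1, rfl⟩ := h1
    rw [replaceAt_append_length_add, Option.map_eq_some_iff] at h1
    obtain ⟨T, h1, rfl⟩ := h1
    obtain ⟨Q, S, rfl, rfl, rfl⟩ := replaceAt_eq_some.1 h1
    constructor
    · have a1 := typed_setPos t (P ++ s.input ++ Q) S (s.pos + s.input.length + Q.length)
        (by simp [hP, Nat.add_assoc])
      have a2 := typed_setPos s P (Q ++ t.output ++ S) s.pos hP
      simp only [Slice.setPos_pos, List.append_assoc] at a1 a2
      simpa only [List.append_assoc, List.cons_append, List.nil_append] using a1.append a2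
    · have := h.exchange s t P Q S hP
      simpa only [List.append_assoc] using this
  | zigzag k d =>
    obtain ⟨P, S, hP, rfl, h1⟩ := typed_cons_split hx
    obtain rfl : P.length = k := hP
    simp only [Slice.output, List.append_assoc, List.cons_append, List.nil_append, typed_cap_add,
      replaceAt_succ_cons, neg_neg, Option.map_eq_some_iff, replaceAt_zero_pair_eq_some] at h1
    obtain ⟨_, ⟨_, ⟨_, h2, rfl⟩, rfl⟩, h3⟩ := h1
    obtain ⟨-, rfl⟩ := List.cons.inj h2
    refine ⟨by simpa [Slice.input] using h3, ?_⟩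
    simpa [Slice.input] using h.zigzag P _ P.length d rfl
  | zigzag' k d =>
    obtain ⟨P, S, hP, rfl, h1⟩ := typed_cons_split hx
    obtain ⟨P, c, rfl, rfl⟩ := exists_append_singleton hP
    simp only [Slice.output, List.append_assoc, List.cons_append, List.nil_append] at h1
    rw [← Nat.add_zero P.length] at h1
    simp only [typed_cap_add, neg_neg, replaceAt_zero_pair_eq_some] at h1
    obtain ⟨_, ⟨_, h2, rfl⟩, h3⟩ := h1
    simp only [List.cons.injEq, true_and] at h2
    obtain ⟨rfl, rfl⟩ := h2
    refine ⟨by simpa [Slice.input] using h3, ?_⟩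
    simpa [Slice.input] using h.zigzag' P S P.length d rfl
  | cupSlide k o d e =>
    obtain ⟨P, S, hP, rfl, h1⟩ := typed_cons_split hx
    obtain rfl : P.length = k := hP
    simp only [Slice.output, List.append_assoc, List.cons_append, List.nil_append, typed_cross_add,
      replaceAt_succ_cons, neg_neg, Option.map_eq_some_iff, replaceAt_zero_pair_eq_some] at h1
    obtain ⟨_, ⟨_, ⟨_, h2, rfl⟩, rfl⟩, h3⟩ := h1
    obtain ⟨-, rfl⟩ := List.cons.inj h2
    refine ⟨by simpa [Slice.input] using h3, ?_⟩
    simpa [Slice.input] using h.cupSlide P _ P.length o d e rfl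
  | capSlide k o d e =>
    obtain ⟨P, S, hP, rfl, h1⟩ := typed_cons_split hx
    obtain ⟨P, c, rfl, rfl⟩ := exists_append_singleton hP
    simp only [Slice.output, List.append_assoc, List.cons_append, List.nil_append] at h1
    conv at h1 => arg 2; rw [← Nat.add_zero P.length]
    simp only [typed_cap_add, neg_neg, replaceAt_zero_pair_eq_some] at h1
    obtain ⟨_, ⟨_, h2, rfl⟩, h3⟩ := h1
    simp only [List.cons.injEq, true_and] at h2
    obtain ⟨rfl, rfl⟩ := h2
    refine ⟨by simpa [Slice.input] using h3, ?_⟩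
    simpa [Slice.input] using h.capSlide P S P.length o c e rfl
  | reidemeisterTwo k o d e =>
    obtain ⟨P, S, hP, rfl, h1⟩ := typed_cons_split hx
    obtain rfl : P.length = k := hP
    refine ⟨by simpa [Slice.input, Slice.output] using h1, ?_⟩
    simpa [Slice.input] using h.reidemeisterTwo P S P.length o d e rfl
  | reidemeisterThree k o d e f =>
    obtain ⟨P, S, hP, rfl, h1⟩ := typed_cons_split hx
    obtain rfl : P.length = k := hP
    simp only [Slice.output, List.append_assoc, List.cons_append, List.nil_append, typed_cross_add,
      replaceAt_succ_cons, neg_neg, Option.map_eq_some_iff, replaceAt_zero_pair_eq_some] at h1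
    obtain ⟨_, ⟨_, ⟨_, h2, rfl⟩, rfl⟩, h3⟩ := h1
    obtain ⟨-, rfl⟩ := List.cons.inj h2
    refine ⟨by simpa [Slice.input] using h3, ?_⟩
    simpa [Slice.input] using h.reidemeisterThree o d e f P _ P.length rfl

end Moves

/-! ## Construction of skein functionals -/

section Construction

variable {α : Type} [InvolutiveNeg α] [DecidableEq α]
variable {A : Type*} [CommRing A] {W : Type*} [AddCommGroup W] [Module A W] {z a ai zi : A}

/-- The relation that holds between all words is a regular congruence, so
`RegularCongr.of_localMove` yields its typing half for free. -/
theorem LocalMove.typed {x y : List (Slice α)} (hm : LocalMove x y) {L M : List α}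
    (hx : Typed L x M) : Typed L y M :=
  RegularCongr.of_localMove (E := fun _ _ _ => True) ⟨⟨⟨by simp, by simp, by simp, by simp,
    by simp⟩, by simp, by simp, by simp, by simp⟩, by simp [HasR3]⟩ hm hx |>.1

theorem LocalMove.typed_context {x y : List (Slice α)} (hm : LocalMove x y) {L M : List α}
    {U V : List (Slice α)} (hx : Typed L (U ++ x ++ V) M) : Typed L (U ++ y ++ V) M := by
  obtain ⟨N, h1, h2⟩ := typed_append.1 hx
  obtain ⟨K, h3, h4⟩ := typed_append.1 h1
  exact (h3.append (hm.typed h4)).append h2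

theorem typed_cross_context {U V : List (Slice α)} {k : ℕ} {o : Bool} {d e : α} {L M : List α}
    (h : Typed L (U ++ [.cross k o d e] ++ V) M) : ∃ P S, P.length = k ∧
      Typed L U (P ++ d :: e :: S) ∧ Typed (P ++ e :: d :: S) V M := by
  rw [List.append_assoc] at h
  obtain ⟨N, h1, h2⟩ := typed_append.1 h
  obtain ⟨P, S, hP, rfl, h3⟩ := typed_cons_split h2
  exact ⟨P, S, hP, by simpa [Slice.input] using h1, by simpa [Slice.output] using h3⟩

theorem typed_curl_context {U V : List (Slice α)} {k : ℕ} {o : Bool} {d : α} {L M : List α}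
    (h : Typed L (U ++ [.cross k o d (-d), .cap k (-d)] ++ V) M) : ∃ P S, P.length = k ∧
      Typed L U (P ++ d :: -d :: S) ∧ Typed (P ++ S) V M := by
  have h' : Typed L (U ++ [.cross k o d (-d)] ++ (.cap k (-d) :: V)) M := by simpa using h
  obtain ⟨P, S, rfl, h1, h2⟩ := typed_cross_context h'
  exact ⟨P, S, rfl, h1, by simpa using h2⟩

open Classical in
/-- A functional on closed words, extended by zero. -/
noncomputable def closedPart (ev : List (Slice α) → W) (w : List (Slice α)) : W :=
  if Typed [] w [] then ev w else 0

theorem closedPart_of_typed (ev : List (Slice α) → W) {w : List (Slice α)} (h : Typed [] w []) :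
    closedPart ev w = ev w := if_pos h

/-- The common interface of the two state sums: once the transfer operators define a regular
congruence, only the skein relation and the curl remain to be checked. -/
theorem closedPart_mem {E : List α → List (Slice α) → List (Slice α) → Prop} (h : RegularCongr E)
    {ev : List (Slice α) → W} (hE : ∀ x y, E [] x y → Typed [] x [] → ev x = ev y)
    (skein : ∀ U V P S k d e, P.length = k → Typed [] U (P ++ d :: e :: S) →
      Typed (P ++ e :: d :: S) V [] →
      ev (U ++ [.cross k true d e] ++ V) - ev (U ++ [.cross k false d e] ++ V) =
        z • ((if e = -d then ev (U ++ [.cap k d, .cup k (-d)] ++ V) else 0) -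
          if d = e then ev (U ++ V) else 0))
    (curl : ∀ U V P S k d, P.length = k → Typed [] U (P ++ d :: -d :: S) →
      Typed (P ++ S) V [] →
      ev (U ++ [.cross k true d (-d), .cap k (-d)] ++ V) = a • ev (U ++ [.cap k d] ++ V)) :
    closedPart ev ∈ skeinSpace W z a [] := by
  constructor
  · intro w hw
    exact if_neg hw
  · intro U V x y hm hx
    rw [closedPart_of_typed ev hx, closedPart_of_typed ev (hm.typed_context hx)]
    refine hE _ _ ?_ hx
    obtain ⟨N, h1, h2⟩ := typed_append.1 hx
    obtain ⟨K, h3, h4⟩ := typed_append.1 h1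
    exact h.ctx U V h3 (h.of_localMove hm h4).2
  · intro U V k d e hx
    obtain ⟨P, S, rfl, h1, h2⟩ := typed_cross_context hx
    rw [closedPart_of_typed ev hx,
      closedPart_of_typed ev ((h1.append (M := P ++ e :: d :: S) (by simp)).append h2),
      skein U V P S _ d e rfl h1 h2]
    congr 2
    · split_ifs with he
      · subst he
        rw [closedPart_of_typed ev ((h1.append (M := P ++ -d :: d :: S) (by simp)).append h2)]
      · rfl
    · split_ifs with he
      · subst he
        rw [closedPart_of_typed ev (h1.append h2)]
      · rfl
  · intro U V k d hx
    obtain ⟨P, S, rfl, h1, h2⟩ := typed_curl_context hx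
    rw [closedPart_of_typed ev hx,
      closedPart_of_typed ev ((h1.append (M := P ++ S) (by simp)).append h2),
      curl U V P S _ d rfl h1 h2]

theorem typed_nil_cons {s : Slice α} {w : List (Slice α)} {M : List α} (h : Typed [] (s :: w) M) :
    ∃ c, s = .cup 0 c ∧ Typed [c, -c] w M := by
  obtain ⟨P, S, h1, h2, h3⟩ := typed_cons_split h
  obtain ⟨h4, rfl⟩ := List.append_eq_nil_iff.1 h2.symm
  obtain ⟨rfl, h5⟩ := List.append_eq_nil_iff.1 h4
  cases s with
  | cup k c =>
    obtain rfl : 0 = k := h1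
    exact ⟨c, rfl, by simpa [Slice.output] using h3⟩
  | cap k c => simp [Slice.input] at h5
  | cross k o c e => simp [Slice.input] at h5

/-- The value of a circle determines the effect of adding a circle. -/
theorem act_closed_circle (hα : ∀ d x : α, d = x ∨ d = -x) (ha : a * ai = 1)
    {φ : List (Slice α) → W} (hφ : φ ∈ skeinSpace W z a []) (d : α)
    (hc : z • φ [.cup 0 d, .cap 0 d] = circleFactor z a ai d • φ []) :
    z • act (A := A) [.cup 0 d, .cap 0 d] φ = circleFactor z a ai d • φ := by
  ext w
  by_cases hw : Typed [] w []
  · cases w with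
    | nil => exact hc
    | cons s w =>
      obtain ⟨c, rfl, hw⟩ := typed_nil_cons hw
      have h := skeinEq_regular (α := α) (W := W) (z := z) (a := a)
      -- The circle is pushed past the first leftmost point of `w`; there it lies beside a strand
      -- and `act_circle` evaluates it.
      have e1 := h.exch (L := []) [.cup 0 d] [] (.cap 0 d) (.cup 0 c) [] [] [] 0 2 rfl
        (by simp [Typed, Slice.step, Slice.pos, Slice.input, Slice.output]) rfl rfl
      have e2 := h.exch (L := []) [] [.cap 0 d] (.cup 0 d) (.cup 0 c) [] [] [] 2 0 rfl
        (by simp [Typed, Slice.step, Slice.pos, Slice.input, Slice.output]) rfl rfl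
      have e3 := h.ctx_left [.cup 0 c] (L := []) (M := [c, -c])
        (by simp [Typed, Slice.step, Slice.pos, Slice.input, Slice.output])
        (h.circle_across [] [-c] 0 c d rfl)
      have e4 := act_circle hα ha (P := []) (S := [-c]) (x := c) d 0 rfl
        (act_mem hφ (M := [c, -c]) (x := [.cup 0 c])
          (by simp [Typed, Slice.step, Slice.pos, Slice.input, Slice.output]))
      have e5 := congrFun (h.trans e1 (h.trans e2 e3) φ hφ) w
      have e6 := congrFun e4 w
      exact (congrArg (z • ·) e5).trans e6
  · have h1 : ¬ Typed [] ([.cup 0 d, .cap 0 d] ++ w) [] := by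
      intro h
      apply hw
      have := typed_cap (P := []) (L := []) (M := []) (d := d) (w := w)
      simp only [List.nil_append, List.length_nil] at this
      rw [← this]
      have h' := typed_cup (P := []) (L := []) (M := []) (d := d) (w := .cap 0 d :: w)
      simp only [List.nil_append, List.length_nil] at h'
      exact h'.1 h
    rw [Pi.smul_apply, Pi.smul_apply, act_apply, hφ.untyped _ hw, hφ.untyped _ h1, smul_zero,
      smul_zero]

theorem closed_mem_span (hα : ∀ d x : α, d = x ∨ d = -x) (hz : zi * z = 1) (ha : a * ai = 1)
    {φ : List (Slice α) → W} (hφ : φ ∈ skeinSpace W z a [])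
    (hc : ∀ d, z • φ [.cup 0 d, .cap 0 d] = circleFactor z a ai d • φ [])
    {w : List (Slice α)} (hw : Typed [] w []) : ∃ c : A, φ w = c • φ [] :=
  skein_mem_span hα hz ha hφ (fun d => act_closed_circle hα ha hφ d (hc d)) hw

/-- Pairing makes a single coefficient from `closed_mem_span` serve two functionals at once, which
gives uniqueness. -/
theorem IsSkein.prod {W' : Type*} [AddCommGroup W'] [Module A W'] {L : List α}
    {f : List (Slice α) → W} {g : List (Slice α) → W'} (hf : IsSkein z a L f)
    (hg : IsSkein z a L g) : IsSkein z a L fun w => (f w, g w) := by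
  constructor
  · intro w hw; simp [hf.untyped w hw, hg.untyped w hw]
  · intro U V x y h ht; simp only [hf.move U V x y h ht, hg.move U V x y h ht]
  · intro U V k d e ht
    have h1 := hf.skein U V k d e ht
    have h2 := hg.skein U V k d e ht
    refine Prod.ext (h1.trans ?_) (h2.trans ?_) <;> split_ifs <;> simp
  · intro U V k d ht
    exact Prod.ext (hf.curl U V k d ht) (hg.curl U V k d ht)

/-- Used for interpolation, with one coordinate for each evaluation point. -/
theorem isSkein_pi {ι F : Type*} [CommRing F] [Module A (ι → F)] {L : List α} (ev : A → ι → F)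
    (hev : ∀ (c : A) (f : ι → F) i, (c • f) i = ev c i * f i) {φ : List (Slice α) → ι → F}
    (h : ∀ i, IsSkein (ev z i) (ev a i) L fun w => φ w i) : IsSkein z a L φ := by
  constructor
  · intro w hw; funext i; exact (h i).untyped w hw
  · intro U V x y hm ht; funext i; exact (h i).move U V x y hm ht
  · intro U V k d e ht
    funext i
    have := (h i).skein U V k d e ht
    rw [hev]
    refine this.trans ?_
    rw [smul_eq_mul]
    congr 1
    split_ifs <;> simp
  · intro U V k d ht; funext i; rw [hev]; exact (h i).curl U V k d ht

theorem IsSkein.map {B : Type*} [CommRing B] (ρ : A →+* B) {L : List α} {f : List (Slice α) → A}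
    (hf : IsSkein z a L f) : IsSkein (ρ z) (ρ a) L fun w => ρ (f w) := by
  constructor
  · intro w hw; rw [hf.untyped w hw, map_zero]
  · intro U V x y hm ht; rw [hf.move U V x y hm ht]
  · intro U V k d e ht
    rw [← map_sub, hf.skein U V k d e ht, smul_eq_mul, map_mul, map_sub, smul_eq_mul]
    split_ifs <;> simp
  · intro U V k d ht; rw [hf.curl U V k d ht, smul_eq_mul, map_mul, smul_eq_mul]

end Construction

/-! ### The vertex model satisfies the skein and curl relations of `R`. -/

namespace Model

variable {F : Type*} [Field F] {N : ℕ} {t : F}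

theorem op_linear (s : Slice Dir) (b c : F) (g h : List (Fin N) → F) :
    op t s (fun I => b * g I + c * h I) = fun I => b * op t s g I + c * op t s h I := by
  funext I
  simp only [op, Finset.mul_sum, ← Finset.sum_add_distrib]
  exact Finset.sum_congr rfl fun x _ => by ring

theorem opWord_linear (w : List (Slice Dir)) (b c : F) (g h : List (Fin N) → F) :
    opWord t w (fun I => b * g I + c * h I) = fun I => b * opWord t w g I + c * opWord t w h I := by
  induction w with
  | nil => rfl
  | cons s w ih => rw [opWord_cons, ih, op_linear]; rfl

theorem op_skein_same (P S : List Dir) (k : ℕ) (d : Dir) (hk : P.length = k)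
    (g : List (Fin N) → F) (I : List (Fin N)) (hI : I.length = (P ++ d :: d :: S).length) :
    op t (.cross k true d d) g I =
      1 * op t (.cross k false d d) g I + -(t - t⁻¹) * g I := by
  obtain ⟨P', i, j, S', rfl, h1, h2⟩ := exists_split_two hI
  simp only [op_cross_same _ _ _ _ _ _ _ _ (h1.trans hk)]
  obtain ⟨a1, a2, a2', a3⟩ | rfl | ⟨a1, a2, a2', a3⟩ := prec_cases d i j <;>
  simp only [*, prec_irrefl, turnWt, eqWt, if_true, if_false, Bool.false_eq_true] <;> ring

theorem op_skein_opp (ht : t ≠ 0) (P S : List Dir) (k : ℕ) (d : Dir) (hk : P.length = k)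
    (g : List (Fin N) → F) (I : List (Fin N)) (hI : I.length = (P ++ d :: -d :: S).length) :
    op t (.cross k true d (-d)) g I = 1 * op t (.cross k false d (-d)) g I +
      (t - t⁻¹) * op t (.cap k d) (op t (.cup k (-d)) g) I := by
  obtain ⟨P', i, j, S', rfl, h1, h2⟩ := exists_split_two hI
  rw [op_cap _ _ _ _ _ _ _ (h1.trans hk), op_cup _ _ _ _ _ (h1.trans hk)]
  by_cases hij : i = j
  · subst hij
    simp only [op_cross_diag _ _ _ _ _ _ _ (h1.trans hk), if_true, Finset.mul_sum]
    rw [← Finset.sum_add_distrib]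
    refine Finset.sum_congr rfl fun x _ => ?_
    have e := diagWt_false ht (-d) i x
    rw [neg_neg] at e
    rw [diagWt_true ht, e]
    obtain ⟨a1, a2, a2', a3⟩ | rfl | ⟨a1, a2, a2', a3⟩ := prec_cases d i x <;>
    simp only [*, prec_neg, prec_irrefl, if_true, if_false] <;> ring
  · simp only [op_cross_opp _ _ _ _ hij _ _ _ _ (h1.trans hk), if_neg hij]
    ring

/-- The color `i` itself contributes `t * loopWt t (-d) i`, and by `sum_after` the later colors
complete this to `t ^ N`: hence the value of `a` in the model. The zero term gives the right side
the two-term shape of `opWord_linear`. -/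
theorem op_curl (ht : t ≠ 0) (P S : List Dir) (k : ℕ) (d : Dir) (hk : P.length = k)
    (g : List (Fin N) → F) (I : List (Fin N)) (hI : I.length = (P ++ d :: -d :: S).length) :
    op t (.cross k true d (-d)) (op t (.cap k (-d)) g) I =
      t ^ (N : ℤ) * op t (.cap k d) g I + 0 * op t (.cap k d) g I := by
  obtain ⟨P', i, j, S', rfl, h1, h2⟩ := exists_split_two hI
  rw [op_cap _ _ _ _ _ _ _ (h1.trans hk)]
  by_cases hij : i = j
  · subst hij
    simp only [op_cross_diag _ _ _ _ _ _ _ (h1.trans hk), op_cap _ _ _ _ _ _ _ (h1.trans hk),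
      if_true, diagWt_true ht]
    have e : ∀ x : Fin N, capWt t d i * cupWt t (-d) x *
        ((if i = x then t else 0) + if prec d i x then t - t⁻¹ else 0) *
          (capWt t (-d) x * g (P' ++ S')) = capWt t d i * g (P' ++ S') *
        ((if i = x then t * loopWt t (-d) x else 0) +
          (t - t⁻¹) * if prec d i x then loopWt t (-d) x else 0) := fun x => by
      rw [loopWt]; split_ifs <;> ring
    rw [Finset.sum_congr rfl fun x _ => e x, ← Finset.mul_sum, Finset.sum_add_distrib,
      Finset.sum_ite_eq, if_pos (Finset.mem_univ i), ← Finset.mul_sum, sum_after ht]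
    ring
  · rw [op_cross_opp _ _ _ _ hij _ _ _ _ (h1.trans hk), op_cap _ _ _ _ _ _ _ (h1.trans hk),
      if_neg hij, if_neg (Ne.symm hij)]
    ring

/-- The value of a closed word in the state model. -/
noncomputable def value (t : F) (N : ℕ) : List (Slice Dir) → F :=
  closedPart fun w => opWord t w (fun _ : List (Fin N) => 1) []

theorem value_mem (ht : t ≠ 0) :
    value t N ∈ skeinSpace F (t - t⁻¹) (t ^ (N : ℤ)) [] := by
  refine closedPart_mem (modelEq_regular (N := N) ht) ?_ ?_ ?_
  · intro x y h _
    exact h _ _ rfl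
  · intro U V P S k d e hk hU hV
    simp only [opWord_append, opWord_cons, opWord_nil]
    set g := opWord t V fun _ : List (Fin N) => 1
    obtain rfl | rfl := Dir.eq_or_eq_neg e d
    · rw [opWord_congr hU (op_skein_same P S k e hk g) rfl, opWord_linear,
        if_neg (Dir.neg_ne e).symm, if_pos rfl, smul_eq_mul]
      ring
    · rw [opWord_congr hU (op_skein_opp ht P S k d hk g) rfl, opWord_linear, if_pos rfl,
        if_neg (Dir.neg_ne d).symm, smul_eq_mul]
      ring
  · intro U V P S k d hk hU hV
    simp only [opWord_append, opWord_cons, opWord_nil]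
    rw [opWord_congr hU (op_curl ht P S k d hk _) rfl, opWord_linear, smul_eq_mul]
    ring

theorem value_nil : value t N [] = 1 := closedPart_of_typed _ (typed_nil.2 rfl)

theorem value_circle (ht : t ≠ 0) (d : Dir) :
    (t - t⁻¹) • value t N [.cup 0 d, .cap 0 d] =
      circleFactor (t - t⁻¹) (t ^ (N : ℤ)) (t ^ (N : ℤ))⁻¹ d • value t N [] := by
  rw [value_nil, circleFactor, if_neg (Dir.neg_ne d).symm, value, closedPart_of_typed]
  · simp only [opWord_cons, opWord_nil]
    have := op_cup (t := t) (N := N) [] [] 0 d (op t (.cap 0 d) fun _ => 1) rfl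
    simp only [List.nil_append] at this
    rw [this]
    have e : ∀ x : Fin N, op t (.cap 0 d) (fun _ : List (Fin N) => 1) [x, x] = capWt t d x :=
      fun x => by simpa using op_cap (t := t) [] [] x x 0 d (fun _ => 1) rfl
    simp only [e]
    have := sum_loopWt (N := N) ht d
    simp only [loopWt] at this
    simp [this]
  · simp [Typed, Slice.step, Slice.pos, Slice.input, Slice.output]

end Model

/-! ## Evaluation of Laurent polynomials -/

namespace LaurentZA

section Eval

variable {F : Type*} [Field F]

/-- The value of a monomial. -/
def monomialHom {x y : F} (hx : x ≠ 0) (hy : y ≠ 0) : Multiplicative (ℤ × ℤ) →* F where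
  toFun m := x ^ m.toAdd.1 * y ^ m.toAdd.2
  map_one' := by simp
  map_mul' m n := by
    simp only [toAdd_mul, Prod.fst_add, Prod.snd_add, zpow_add₀ hx, zpow_add₀ hy]
    ring

/-- Evaluation as a ring homomorphism. -/
noncomputable def evalHom {x y : F} (hx : x ≠ 0) (hy : y ≠ 0) : LaurentZA →+* F :=
  AddMonoidAlgebra.liftNCRingHom (Int.castRingHom F) (monomialHom hx hy) fun _ _ => .all _ _

theorem evalHom_apply {x y : F} (hx : x ≠ 0) (hy : y ≠ 0) (p : LaurentZA) :
    evalHom hx hy p = eval x y p := by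
  change p.coeff.sum _ = _
  simp [eval, monomialHom, mul_assoc, Function.comp_def]

theorem evalHom_mono {x y : F} (hx : x ≠ 0) (hy : y ≠ 0) (i j : ℤ) :
    evalHom hx hy (mono i j) = x ^ i * y ^ j := by
  rw [evalHom, mono]
  refine (AddMonoidAlgebra.liftNC_single _ _ _ _).trans ?_
  simp [monomialHom]

end Eval

/-- Multiplication by a power of `y` that clears negative exponents gives an ordinary polynomial
with infinitely many roots. -/
theorem coeff_eq_zero_of_infinite (s : Finset ℤ) (c : ℤ → ℚ)
    (h : {y : ℚ | y ≠ 0 ∧ ∑ j ∈ s, c j * y ^ j = 0}.Infinite) : ∀ j ∈ s, c j = 0 := by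
  obtain ⟨M, hM⟩ : ∃ M : ℕ, ∀ j ∈ s, 0 ≤ j + M := by
    refine ⟨∑ j ∈ s, j.natAbs, fun j hj => ?_⟩
    have : j.natAbs ≤ ∑ j ∈ s, j.natAbs :=
      Finset.single_le_sum (f := Int.natAbs) (fun _ _ => Nat.zero_le _) hj
    omega
  let q : Polynomial ℚ := ∑ j ∈ s, Polynomial.monomial (j + M).toNat (c j)
  have hq : q = 0 := by
    refine Polynomial.eq_zero_of_infinite_isRoot q (h.mono ?_)
    rintro y ⟨hy, h0⟩
    have e : ∀ j ∈ s, c j * y ^ (j + (M : ℤ)).toNat = y ^ M * (c j * y ^ j) := by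
      intro j hj
      rw [← zpow_natCast, Int.toNat_of_nonneg (hM j hj), zpow_add₀ hy, zpow_natCast]
      ring
    simp only [Set.mem_ofPred_eq, Polynomial.IsRoot, q, Polynomial.eval_finsetSum,
      Polynomial.eval_monomial]
    rw [Finset.sum_congr rfl e, ← Finset.mul_sum, h0, mul_zero]
  intro j hj
  have h1 := congrArg (fun q => Polynomial.coeff q (j + M).toNat) hq
  simp only [q, Polynomial.finsetSum_coeff, Polynomial.coeff_monomial, Polynomial.coeff_zero] at h1
  rw [Finset.sum_eq_single j] at h1
  · simpa using h1
  · intro i hi hij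
    rw [if_neg]
    intro h2
    have := hM i hi
    have := hM j hj
    omega
  · intro h2; exact absurd hj h2

theorem eq_zero_of_infinite (p : LaurentZA) (Z : Set ℚ) (hZ : Z.Infinite) (hZ0 : ∀ z ∈ Z, z ≠ 0)
    (h : ∀ z ∈ Z, {y : ℚ | y ≠ 0 ∧ eval z y p = 0}.Infinite) : p = 0 := by
  let s := p.coeff.support
  have hs : s ⊆ s.image Prod.fst ×ˢ s.image Prod.snd := Finset.subset_product
  have e : ∀ x y : ℚ, eval x y p = ∑ j ∈ s.image Prod.snd,
      (∑ i ∈ s.image Prod.fst, (p.coeff (i, j) : ℚ) * x ^ i) * y ^ j := by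
    intro x y
    rw [eval, Finsupp.sum_of_support_subset _ hs _ (by simp), Finset.sum_product_right]
    simp only [Finset.sum_mul]
  have h1 : ∀ j ∈ s.image Prod.snd, ∀ i ∈ s.image Prod.fst, (p.coeff (i, j) : ℚ) = 0 := by
    intro j hj
    refine coeff_eq_zero_of_infinite _ (fun i => (p.coeff (i, j) : ℚ)) (hZ.mono fun z hz => ?_)
    refine ⟨hZ0 z hz, ?_⟩
    refine coeff_eq_zero_of_infinite (s.image Prod.snd)
      (fun j => ∑ i ∈ s.image Prod.fst, (p.coeff (i, j) : ℚ) * z ^ i) ((h z hz).mono ?_) j hj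
    rintro y ⟨hy, h0⟩
    exact ⟨hy, by rw [← e]; exact h0⟩
  rw [← AddMonoidAlgebra.coeff_eq_zero]
  ext ⟨i, j⟩
  by_cases hm : (i, j) ∈ s
  · have := h1 j (Finset.mem_image_of_mem _ hm) i (Finset.mem_image_of_mem _ hm)
    exact_mod_cast this
  · simpa [s] using hm

/-- The rational number `n + 2`, which is neither `0` nor `±1`. -/
def node (n : ℕ) : ℚ := n + 2

theorem node_ne_zero (n : ℕ) : node n ≠ 0 := by unfold node; positivity

theorem one_lt_node (n : ℕ) : 1 < node n := by
  unfold node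
  have : (0 : ℚ) ≤ n := Nat.cast_nonneg n
  linarith

theorem node_sub_inv_ne_zero (n : ℕ) : node n - (node n)⁻¹ ≠ 0 := by
  have h1 := one_lt_node n
  have h2 := inv_lt_one_of_one_lt₀ h1
  exact (sub_pos.2 (h2.trans h1)).ne'

theorem node_sub_inv_injective : Function.Injective fun n => node n - (node n)⁻¹ := by
  refine StrictMono.injective fun m n h => ?_
  have h1 : node m < node n := by unfold node; exact_mod_cast Nat.add_lt_add_right h 2
  have h2 := inv_strictAnti₀ (zero_lt_one.trans (one_lt_node m)) h1
  change node m - (node m)⁻¹ < node n - (node n)⁻¹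
  linarith

/-- The values of the second variable may depend on the first, as they must: for given `t` the
vertex model exists only at the powers of `t`. -/
theorem eq_zero_of_nodes {ι : Type*} [Infinite ι] (p : LaurentZA) (y : ℕ → ι → ℚ)
    (hy : ∀ n, Function.Injective (y n)) (hy0 : ∀ n i, y n i ≠ 0)
    (h : ∀ n i, eval (node n - (node n)⁻¹) (y n i) p = 0) : p = 0 := by
  refine eq_zero_of_infinite p (Set.range fun n => node n - (node n)⁻¹)
    (Set.infinite_range_of_injective node_sub_inv_injective) ?_ ?_
  · rintro _ ⟨n, rfl⟩
    exact node_sub_inv_ne_zero n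
  · rintro _ ⟨n, rfl⟩
    refine (Set.infinite_range_of_injective (hy n)).mono ?_
    rintro _ ⟨i, rfl⟩
    exact ⟨hy0 n i, h n i⟩

end LaurentZA

/-! ## Skein functionals and diagram invariants -/

theorem mono_mul (i j k l : ℤ) : mono i j * mono k l = mono (i + k) (j + l) := by
  simp [mono, AddMonoidAlgebra.single_mul_single]

theorem mono_zero_zero : mono 0 0 = 1 := rfl

section Invariants

variable {α : Type} [InvolutiveNeg α] [DecidableEq α]
variable {A : Type*} [CommRing A] {z a ai zi : A}

/-- Skein functionals with the same values on the empty diagram and on circles agree. -/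
theorem IsSkein.unique (hα : ∀ d x : α, d = x ∨ d = -x) (hz : zi * z = 1) (ha : a * ai = 1)
    {f g : List (Slice α) → A} (hf : IsSkein z a [] f) (hg : IsSkein z a [] g)
    (hf1 : f [] = 1) (hg1 : g [] = 1)
    (hfc : ∀ d, z * f [.cup 0 d, .cap 0 d] = circleFactor z a ai d)
    (hgc : ∀ d, z * g [.cup 0 d, .cap 0 d] = circleFactor z a ai d)
    {w : List (Slice α)} (hw : Typed [] w []) : f w = g w := by
  obtain ⟨c, hc⟩ := closed_mem_span hα hz ha (W := A × A) (φ := fun w => (f w, g w)) (hf.prod hg)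
    (fun d => by
      refine Prod.ext ?_ ?_
      · simp [hf1, hfc]
      · simp [hg1, hgc]) hw
  have h1 := congrArg Prod.fst hc
  have h2 := congrArg Prod.snd hc
  simp only [Prod.smul_fst, Prod.smul_snd, hf1, hg1] at h1 h2
  rw [h1, h2]

/-- A family of rational skein functionals comes from a functional with values in Laurent
polynomials, if these are determined by their values at the given points. -/
theorem exists_laurent_skein (hα : ∀ d x : α, d = x ∨ d = -x) {ι : Type*} (x y : ι → ℚ)
    (hx : ∀ i, x i ≠ 0) (hy : ∀ i, y i ≠ 0)
    (hinj : ∀ p : LaurentZA, (∀ i, p.eval (x i) (y i) = 0) → p = 0)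
    (φ : ι → List (Slice α) → ℚ) (hφ : ∀ i, IsSkein (x i) (y i) [] (φ i)) (hφ1 : ∀ i, φ i [] = 1)
    (hφc : ∀ i d, x i * φ i [.cup 0 d, .cap 0 d] = circleFactor (x i) (y i) (y i)⁻¹ d) :
    ∃ f : List (Slice α) → LaurentZA, IsSkein (mono 1 0) (mono 0 1) [] f ∧ f [] = 1 ∧
      ∀ d, mono 1 0 * f [.cup 0 d, .cap 0 d] =
        circleFactor (mono 1 0) (mono 0 1) (mono 0 (-1)) d := by
  let ρ : LaurentZA →+* (ι → ℚ) := RingHom.pi fun i => LaurentZA.evalHom (hx i) (hy i)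
  have hρ : ∀ p i, ρ p i = LaurentZA.evalHom (hx i) (hy i) p := fun _ _ => rfl
  have hρz : ∀ i, ρ (mono 1 0) i = x i := fun i => by simp [hρ, LaurentZA.evalHom_mono]
  have hρa : ∀ i, ρ (mono 0 1) i = y i := fun i => by simp [hρ, LaurentZA.evalHom_mono]
  have hρai : ∀ i, ρ (mono 0 (-1)) i = (y i)⁻¹ := fun i => by simp [hρ, LaurentZA.evalHom_mono]
  have hρinj : Function.Injective ρ := by
    rw [injective_iff_map_eq_zero]
    intro p hp
    refine hinj p fun i => ?_
    rw [← LaurentZA.evalHom_apply (hx i) (hy i), ← hρ, hp]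
    rfl
  -- Laurent polynomials act on families of rational numbers by evaluation at the given points. The
  -- family `Φ` is then one skein functional over `LaurentZA`.
  let _ : Module LaurentZA (ι → ℚ) := Module.compHom (ι → ℚ) ρ
  have hsmul : ∀ (c : LaurentZA) (g : ι → ℚ), c • g = ρ c * g := fun _ _ => rfl
  let Φ : List (Slice α) → ι → ℚ := fun w i => φ i w
  have hΦ1 : Φ [] = 1 := funext fun i => hφ1 i
  have hΦ : IsSkein (mono 1 0) (mono 0 1) [] Φ := by
    refine isSkein_pi (fun c i => ρ c i) (fun c g i => by rw [hsmul]; rfl) fun i => ?_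
    rw [hρz, hρa]
    exact hφ i
  have hcirc : ∀ d, ρ (circleFactor (mono 1 0) (mono 0 1) (mono 0 (-1)) d) =
      ρ (mono 1 0) * Φ [.cup 0 d, .cap 0 d] := by
    intro d
    funext i
    rw [Pi.mul_apply, hρz, hφc, circleFactor, circleFactor, map_add, map_sub, Pi.add_apply,
      Pi.sub_apply, hρa, hρai]
    split_ifs <;> simp [hρz]
  -- The coefficient of `Φ w` with respect to `Φ [] = 1` is a Laurent polynomial that takes the
  -- prescribed value at every point. By injectivity of `ρ` it inherits all relations.
  have hspan : ∀ w, ∃ c : LaurentZA, ρ c = Φ w := by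
    intro w
    by_cases hw : Typed [] w []
    · obtain ⟨c, hc⟩ := closed_mem_span hα (zi := mono (-1) 0) (ai := mono 0 (-1))
        (by rw [mono_mul]; rfl) (by rw [mono_mul]; rfl) hΦ
        (fun d => by rw [hsmul, hsmul, hΦ1, mul_one, hcirc]) hw
      refine ⟨c, ?_⟩
      rw [hc, hsmul, hΦ1, mul_one]
    · exact ⟨0, by rw [hΦ.untyped w hw, map_zero]⟩
  choose f hf using hspan
  refine ⟨f, ⟨?_, ?_, ?_, ?_⟩, ?_, ?_⟩
  · intro w hw
    apply hρinj
    rw [hf, hΦ.untyped w hw, map_zero]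
  · intro U V u v hm ht
    apply hρinj
    rw [hf, hf, hΦ.move U V u v hm ht]
  · intro U V k d e ht
    apply hρinj
    rw [map_sub, hf, hf, hΦ.skein U V k d e ht, hsmul, smul_eq_mul, map_mul, map_sub]
    split_ifs <;> simp [hf]
  · intro U V k d ht
    apply hρinj
    rw [hf, hΦ.curl U V k d ht, hsmul, smul_eq_mul, map_mul, hf]
  · apply hρinj
    rw [hf, hΦ1, map_one]
  · intro d
    apply hρinj
    rw [hcirc, map_mul, hf]

open Classical in
/-- A diagram invariant as a functional on words. -/
noncomputable def extend (R : Diagram α → A) (w : List (Slice α)) : A :=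
  -- The empty word is not a `Diagram`; it gets the value `1`, which matches the normalisation of
  -- the circle through `circleFactor`.
  if h : Typed [] w [] then (if h0 : w = [] then 1 else R ⟨w, h0, h⟩) else 0

theorem extend_word (R : Diagram α → A) (K : Diagram α) : extend R K.word = R K := by
  rw [extend, dif_pos (show Typed [] K.word [] from K.closed), dif_neg K.nonempty]

theorem extend_nil (R : Diagram α → A) : extend R [] = 1 := by
  rw [extend, dif_pos (typed_nil.2 rfl), dif_pos rfl]

theorem typed_nil_ne_nil {P S : List α} {d : α} {U : List (Slice α)}
    (h : Typed [] U (P ++ d :: S)) : U ≠ [] := by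
  rintro rfl
  simp at h

/-- No move turns a closed word into the empty one: a zigzag or a pair of crossings needs strands
that exist already. So the value that `extend` gives to `[]` cannot conflict with invariance. -/
theorem LocalMove.ne_nil {x y : List (Slice α)} (hm : LocalMove x y) {U V : List (Slice α)}
    (hx : Typed [] (U ++ x ++ V) []) : U ++ y ++ V ≠ [] := by
  intro h
  simp only [List.append_eq_nil_iff] at h
  obtain ⟨⟨rfl, rfl⟩, rfl⟩ := h
  cases hm with
  | zigzag k d =>
    obtain ⟨c, -, h1⟩ := typed_nil_cons hx
    obtain ⟨P, S, h2, h3, -⟩ := typed_cons_split (w := []) h1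
    have := congrArg List.length h3
    simp [h2, Slice.input, Slice.pos] at this
    omega
  | zigzag' k d =>
    obtain ⟨c, h, -⟩ := typed_nil_cons hx
    simp at h
  | reidemeisterTwo k o d e =>
    obtain ⟨c, h, -⟩ := typed_nil_cons hx
    simp at h

theorem isSkein_extend {R : Diagram α → A}
    (hiso : ∀ K K' : Diagram α, K.RegularIsotopic K' → R K = R K')
    (hskein : ∀ (K K' : Diagram α) (U V : List (Slice α)) (P S : List α) (d e : α),
      Typed [] U (P ++ d :: e :: S) → Typed (P ++ e :: d :: S) V [] →
      K.word = U ++ [.cross P.length true d e] ++ V →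
      K'.word = U ++ [.cross P.length false d e] ++ V → R K - R K' =
        z * ((if e = -d then extend R (U ++ [.cap P.length d, .cup P.length (-d)] ++ V) else 0) -
          if d = e then extend R (U ++ V) else 0))
    (hcurl : ∀ (K K' : Diagram α) (U V : List (Slice α)) (k : ℕ) (d : α),
      K.word = U ++ [.cross k true d (-d), .cap k (-d)] ++ V →
      K'.word = U ++ [.cap k d] ++ V → R K = a * R K') : IsSkein z a [] (extend R) := by
  constructor
  · intro w hw
    exact dif_neg hw
  · intro U V x y hm hx
    have hx0 : U ++ x ++ V ≠ [] := by
      intro h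
      rw [h] at hx
      simp only [List.append_eq_nil_iff] at h
      obtain ⟨⟨rfl, rfl⟩, rfl⟩ := h
      cases hm
    let K : Diagram α := ⟨U ++ x ++ V, hx0, hx⟩
    let K' : Diagram α := ⟨U ++ y ++ V, hm.ne_nil hx, hm.typed_context hx⟩
    change extend R K.word = extend R K'.word
    rw [extend_word, extend_word]
    exact hiso _ _ (.rel _ _ ⟨U, V, x, y, hm, rfl, rfl⟩)
  · intro U V k d e hx
    obtain ⟨P, S, rfl, h1, h2⟩ := typed_cross_context hx
    let K : Diagram α := ⟨_, by simp, hx⟩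
    let K' : Diagram α := ⟨U ++ [.cross P.length false d e] ++ V, by simp,
      (h1.append (M := P ++ e :: d :: S) (by simp)).append h2⟩
    change extend R K.word - extend R K'.word = _
    rw [extend_word, extend_word]
    exact hskein K K' U V P S d e h1 h2 rfl rfl
  · intro U V k d hx
    obtain ⟨P, S, rfl, h1, h2⟩ := typed_curl_context hx
    let K : Diagram α := ⟨_, by simp, hx⟩
    let K' : Diagram α := ⟨U ++ [.cap P.length d] ++ V, by simp,
      (h1.append (M := P ++ S) (by simp)).append h2⟩
    change extend R K.word = _ • extend R K'.word
    rw [extend_word, extend_word]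
    exact hcurl K K' U V _ d rfl rfl

theorem IsSkein.regularIsotopic {f : List (Slice α) → A} (hf : IsSkein z a [] f)
    {K K' : Diagram α} (h : K.RegularIsotopic K') : f K.word = f K'.word := by
  induction h with
  | rel K K' h =>
    obtain ⟨U, V, x, y, hm, h1, h2⟩ := h
    rw [h1, h2]
    exact hf.move U V x y hm (h1 ▸ K.closed)
  | refl => rfl
  | symm _ _ _ ih => exact ih.symm
  | trans _ _ _ _ _ ih ih' => exact ih.trans ih'

end Invariants

/-! ### Uniqueness of `R` and `D`, and existence of `R`. -/

theorem mono_circle (p : LaurentZA) (q : LaurentZA) (h : mono 1 0 * p = mono 0 1 - mono 0 (-1) + q) :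
    p = mono (-1) 1 - mono (-1) (-1) + mono (-1) 0 * q := by
  have := congrArg (mono (-1) 0 * ·) h
  simp only [← mul_assoc, mul_add, mul_sub, mono_mul] at this
  simpa [mono_zero_zero] using this

theorem IsHomflyR.isSkein {R : ODiagram → LaurentZA} (hR : IsHomflyR R) :
    IsSkein (mono 1 0) (mono 0 1) [] (extend R) := by
  refine isSkein_extend hR.regularIsotopy ?_ hR.curl
  intro K K' U V P S d e h1 h2 hK hK'
  obtain rfl | rfl := Dir.eq_or_eq_neg e d
  · let O : ODiagram := ⟨U ++ V, by simp [typed_nil_ne_nil h1], h1.append h2⟩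
    -- For equal directions the crossing `false` is the positive one, so the two diagrams change
    -- places.
    have := hR.skeinHorizontal K' K O U V P.length e hK' hK rfl
    rw [if_neg (Dir.neg_ne e).symm, if_pos rfl, show U ++ V = O.word from rfl, extend_word]
    linear_combination -this
  · let O : ODiagram := ⟨U ++ [.cap P.length d, .cup P.length (-d)] ++ V, by simp,
      (h1.append (M := P ++ -d :: d :: S) (by simp)).append h2⟩
    have := hR.skeinVertical K K' O U V P.length d hK hK' rfl
    rw [if_pos rfl, if_neg (Dir.neg_ne d).symm, show U ++ [.cap P.length d, .cup P.length (-d)] ++ V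
      = O.word from rfl, extend_word, sub_zero]
    exact this

theorem IsHomflyR.circle_extend {R : ODiagram → LaurentZA} (hR : IsHomflyR R) (d : Dir) :
    mono 1 0 * extend R [.cup 0 d, .cap 0 d] =
      circleFactor (mono 1 0) (mono 0 1) (mono 0 (-1)) d := by
  let K : ODiagram := ⟨[.cup 0 d, .cap 0 d], by simp,
    by simp [Slice.step, Slice.pos, Slice.input, Slice.output]⟩
  change mono 1 0 * extend R K.word = _
  rw [extend_word, hR.circle K d rfl, circleFactor, if_neg (Dir.neg_ne d).symm, mul_sub, mono_mul,
    mono_mul]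
  simp

theorem isHomflyR_of_isSkein {f : List (Slice Dir) → LaurentZA}
    (hf : IsSkein (mono 1 0) (mono 0 1) [] f)
    (hc : ∀ d, mono 1 0 * f [.cup 0 d, .cap 0 d] =
      circleFactor (mono 1 0) (mono 0 1) (mono 0 (-1)) d) : IsHomflyR fun K => f K.word where
  regularIsotopy K K' h := hf.regularIsotopic h
  circle K d hK := by
    have := hc d
    rw [circleFactor, if_neg (Dir.neg_ne d).symm] at this
    simpa [hK] using mono_circle _ _ this
  skeinVertical P N O U V k d hP hN hO := by
    have := hf.skein U V k d (-d) (hP ▸ P.closed)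
    rw [if_pos rfl, if_neg (Dir.neg_ne d).symm, sub_zero, smul_eq_mul] at this
    simpa only [hP, hN, hO] using this
  skeinHorizontal P N O U V k d hP hN hO := by
    have := hf.skein U V k d d (hN ▸ N.closed)
    rw [if_neg (Dir.neg_ne d).symm, if_pos rfl, smul_eq_mul] at this
    simp only [hP, hN, hO]
    linear_combination -this
  curl K K' U V k d hK hK' := by
    simpa only [hK, hK', smul_eq_mul] using hf.curl U V k d (hK ▸ K.closed)

theorem IsKauffmanD.isSkein {D : UDiagram → LaurentZA} (hD : IsKauffmanD D) :
    IsSkein (mono 1 0) (mono 0 1) [] (extend D) := by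
  refine isSkein_extend hD.regularIsotopy ?_ fun K K' U V k _ => hD.curl K K' U V k
  intro K K' U V P S d e h1 h2 hK hK'
  let H : UDiagram := ⟨U ++ V, by simp [typed_nil_ne_nil h1], h1.append h2⟩
  have hO : Typed [] (U ++ [.cap P.length d, .cup P.length (-d)] ++ V) [] :=
    (h1.append (M := P ++ -d :: d :: S) (typed_cap.2 (typed_cup.2 (typed_nil.2 rfl)))).append h2
  let O : Diagram Unit := ⟨_, by simp, hO⟩
  have := hD.skein K K' O H U V P.length hK hK' rfl rfl
  rw [if_pos (Subsingleton.elim _ _), if_pos (Subsingleton.elim _ _),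
    show U ++ [.cap P.length d, .cup P.length (-d)] ++ V = O.word from rfl,
    show U ++ V = H.word from rfl, extend_word, extend_word]
  exact this

theorem IsKauffmanD.circle_extend {D : UDiagram → LaurentZA} (hD : IsKauffmanD D) (d : Unit) :
    mono 1 0 * extend D [.cup 0 d, .cap 0 d] =
      circleFactor (mono 1 0) (mono 0 1) (mono 0 (-1)) d := by
  let K : UDiagram := ⟨[.cup 0 d, .cap 0 d], by simp,
    by simp [Slice.step, Slice.pos, Slice.input, Slice.output]⟩
  change mono 1 0 * extend D K.word = _
  rw [extend_word, hD.circle K rfl, circleFactor, if_pos (Subsingleton.elim _ _), mul_add, mul_sub,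
    mono_mul, mono_mul]
  simp

theorem isKauffmanD_of_isSkein {f : List (Slice Unit) → LaurentZA}
    (hf : IsSkein (mono 1 0) (mono 0 1) [] f)
    (hc : ∀ d, mono 1 0 * f [.cup 0 d, .cap 0 d] =
      circleFactor (mono 1 0) (mono 0 1) (mono 0 (-1)) d) : IsKauffmanD fun K => f K.word where
  regularIsotopy K K' h := hf.regularIsotopic h
  circle K hK := by
    have := hc ()
    rw [circleFactor, if_pos (Subsingleton.elim _ _)] at this
    simpa [hK, mono_mul, mono_zero_zero] using mono_circle _ _ this
  skein P N V' H U V k hP hN hV hH := by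
    have := hf.skein U V k () () (hP ▸ P.closed)
    rw [if_pos (Subsingleton.elim _ _), if_pos rfl] at this
    simp only [hP, hN, hV, hH]
    exact this
  curl K K' U V k hK hK' := by
    simp only [hK, hK']
    exact hf.curl U V k () (hK ▸ K.closed)

theorem mono_mul_cancel : mono (-1) 0 * mono 1 0 = 1 ∧ mono 0 1 * mono 0 (-1) = 1 := by
  constructor <;> rw [mono_mul] <;> rfl

theorem IsHomflyR.unique {R R' : ODiagram → LaurentZA} (hR : IsHomflyR R) (hR' : IsHomflyR R') :
    R = R' := by
  funext K
  rw [← extend_word R, ← extend_word R']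
  exact hR.isSkein.unique Dir.eq_or_eq_neg mono_mul_cancel.1 mono_mul_cancel.2 hR'.isSkein
    (extend_nil R) (extend_nil R') hR.circle_extend hR'.circle_extend K.closed

theorem IsKauffmanD.unique {D D' : UDiagram → LaurentZA} (hD : IsKauffmanD D)
    (hD' : IsKauffmanD D') : D = D' := by
  funext K
  rw [← extend_word D, ← extend_word D']
  exact hD.isSkein.unique (fun _ _ => .inl rfl) mono_mul_cancel.1 mono_mul_cancel.2 hD'.isSkein
    (extend_nil D) (extend_nil D') hD.circle_extend hD'.circle_extend K.closed

/-- Interpolation of the vertex models at `a = t ^ N`, with `t` running over the rational numbers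
`node n`; the powers of each are distinct because `node n > 1`. -/
theorem exists_isHomflyR : ∃ R, IsHomflyR R := by
  obtain ⟨f, hf, -, hc⟩ := exists_laurent_skein Dir.eq_or_eq_neg (ι := ℕ × ℕ)
    (fun i => LaurentZA.node i.1 - (LaurentZA.node i.1)⁻¹)
    (fun i => LaurentZA.node i.1 ^ (i.2 : ℤ))
    (fun i => LaurentZA.node_sub_inv_ne_zero i.1)
    (fun i => zpow_ne_zero _ (LaurentZA.node_ne_zero i.1))
    (fun p hp => LaurentZA.eq_zero_of_nodes p (fun n (i : ℕ) => LaurentZA.node n ^ (i : ℤ))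
      (fun n i j h => by
        have := zpow_right_injective₀ (zero_lt_one.trans (LaurentZA.one_lt_node n))
          (LaurentZA.one_lt_node n).ne' h
        exact_mod_cast this)
      (fun n i => zpow_ne_zero _ (LaurentZA.node_ne_zero n)) fun n i => hp (n, i))
    (fun i => Model.value (LaurentZA.node i.1) i.2)
    (fun i => Model.value_mem (LaurentZA.node_ne_zero i.1))
    (fun i => Model.value_nil)
    (fun i d => by
      have := Model.value_circle (N := i.2) (LaurentZA.node_ne_zero i.1) d
      rwa [Model.value_nil, smul_eq_mul, smul_eq_mul, mul_one] at this)
  exact ⟨_, isHomflyR_of_isSkein hf hc⟩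

/-! ## Words that occupy a fixed block of strands -/

section Chain

variable {α : Type} [InvolutiveNeg α] [DecidableEq α]
  {E : List α → List (Slice α) → List (Slice α) → Prop}

/-- A word all of whose pieces act on a whole block of strands, from `i` to `x`. -/
inductive Chain : List α → List (Slice α) → List α → Prop
  | nil (i : List α) : Chain i [] i
  | cons (s : Slice α) {u : List (Slice α)} {x : List α} (h : Chain s.output u x) :
      Chain s.input (s :: u) x

theorem Chain.typed {i x : List α} {u : List (Slice α)} (h : Chain i u x) (P S : List α) (k : ℕ)
    (hk : P.length = k) : Typed (P ++ i ++ S) (u.map (Slice.setPos k)) (P ++ x ++ S) := by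
  induction h with
  | nil i => simp
  | cons s _ ih => exact (typed_setPos s P S k hk).append ih

theorem TangleCongr.exchange_chain (h : TangleCongr E) {i x j y : List α}
    {u v : List (Slice α)} (hu : Chain i u x) (hv : Chain j v y) (P Q S : List α) (k m n : ℕ)
    (hk : P.length = k) (hm : (P ++ x ++ Q).length = m) (hn : (P ++ i ++ Q).length = n) :
    E (P ++ i ++ Q ++ j ++ S) (u.map (Slice.setPos k) ++ v.map (Slice.setPos m))
      (v.map (Slice.setPos n) ++ u.map (Slice.setPos k)) := by
  have single : ∀ (s : Slice α) (m n : ℕ), (P ++ s.output ++ Q).length = m →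
      (P ++ s.input ++ Q).length = n → E (P ++ s.input ++ Q ++ j ++ S)
        (s.setPos k :: v.map (Slice.setPos m)) (v.map (Slice.setPos n) ++ [s.setPos k]) := by
    intro s m n hm hn
    induction hv with
    | nil j => exact h.refl _ _
    | @cons t v y hv ih =>
      refine h.trans (y := t.setPos n :: s.setPos k :: v.map (Slice.setPos m)) ?_ ?_
      · have := h.exch (L := P ++ s.input ++ Q ++ t.input ++ S) [] (v.map (Slice.setPos m)) (s.setPos k) t P Q S m n (by simpa using hk)
          (by simp) (by simpa [← hk, Nat.add_assoc] using hm)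
          (by simpa [← hk, Nat.add_assoc] using hn)
        simpa using this
      · have := h.ctx_left [t.setPos n] (typed_setPos t (P ++ s.input ++ Q) S n hn) ih
        simpa using this
  induction hu generalizing m n with
  | nil i =>
    obtain rfl : m = n := hm.symm.trans hn
    simpa using h.refl _ _
  | @cons s u x hu ih =>
    refine h.trans (y := s.setPos k :: (v.map (Slice.setPos (P ++ s.output ++ Q).length) ++
      u.map (Slice.setPos k))) ?_ ?_
    · have := h.ctx_left [s.setPos k] (L := P ++ s.input ++ Q ++ j ++ S)
        (by simpa using typed_setPos s P (Q ++ j ++ S) k hk)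
        (ih m _ hm rfl)
      simpa using this
    · have := h.ctx_right (u.map (Slice.setPos k)) (single s _ n rfl hn)
      simpa using this

end Chain

/-! ## Jaeger's state sum -/

namespace Jaeger

@[simp] theorem neg_east : -Dir.east = Dir.west := rfl
@[simp] theorem neg_west : -Dir.west = Dir.east := rfl

variable {F : Type*} [Field F]

/-- Functionals on words of oriented pieces. -/
abbrev Fn (F : Type*) : Type _ := List (Slice Dir) → F

/-- Weight of a rightmost point. -/
def capWt (t a : F) : Dir → F
  -- In a zigzag a rightmost point `.east` meets a leftmost point `.west`, which `term` gives the
  -- coefficient `a * t⁻¹`; the product is `1`.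
  | .east => (a * t⁻¹)⁻¹
  | .west => 1

/-- The lower direction at which a crossing may be spliced. -/
def spliceDir (o : Bool) : Dir := if o then .west else .east

/-- Weight of the horizontal splice, up to sign. -/
def spliceWt (t : F) (o : Bool) : F := if o then t - t⁻¹ else -(t - t⁻¹)

/-- Weight of the vertical splice, relative to the horizontal one. -/
def turnWt (t a : F) (o : Bool) : F := if o then a * t⁻¹ else (a * t⁻¹)⁻¹

/-- The oriented local pictures that replace an unoriented piece, with coefficients: the coefficient,
the labels on the right, and the word. -/
def term (t a : F) : Slice Unit → List Dir → Fin 3 → F × List Dir × List (Slice Dir)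
  | .cup _ _, _, n =>
    (![1, a * t⁻¹, 0] n, ![[.east, .west], [.west, .east], [.west, .east]] n,
      ![[.cup 0 .east], [.cup 0 .west], [.cup 0 .west]] n)
  | .cap _ _, [p, q], n =>
    (![if q = -p then capWt t a p else 0, 0, 0] n, [], [.cap 0 p])
  | .cross _ o _ _, [p, q], n =>
    -- A kept crossing exchanges the labels, both splices preserve them. The leftmost point of the
    -- vertical splice has the lower label `p`, unlike in the oriented skein relation, where it is
    -- `-p`.
    (![1, if p = spliceDir o ∧ q = -p then spliceWt t o * turnWt t a o else 0,
        if p = spliceDir o ∧ q = -p then -spliceWt t o else 0] n, ![[q, p], [p, q], [p, q]] n,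
      ![[.cross 0 o p q], [.cap 0 p, .cup 0 p], []] n)
  | _, _, _ => (0, [], [])

/-- The transfer operator of a piece. -/
def op (t a : F) (s : Slice Unit) (g : List Dir → Module.Dual F (Fn F)) (I : List Dir) :
    Module.Dual F (Fn F) :=
  ∑ n, (term t a s ((I.drop s.pos).take s.input.length) n).1 •
    (g (I.take s.pos ++ (term t a s ((I.drop s.pos).take s.input.length) n).2.1 ++
      I.drop (s.pos + s.input.length))).comp
      (act ((term t a s ((I.drop s.pos).take s.input.length) n).2.2.map (Slice.setPos s.pos)))

/-- The transfer operator of a word. -/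
def opWord (t a : F) (w : List (Slice Unit)) (g : List Dir → Module.Dual F (Fn F)) :
    List Dir → Module.Dual F (Fn F) :=
  w.foldr (op t a) g

variable {t a : F}

@[simp] theorem opWord_nil (g : List Dir → Module.Dual F (Fn F)) : opWord t a [] g = g := rfl

@[simp] theorem opWord_cons (s : Slice Unit) (w : List (Slice Unit))
    (g : List Dir → Module.Dual F (Fn F)) :
    opWord t a (s :: w) g = op t a s (opWord t a w g) := rfl

theorem opWord_append (v w : List (Slice Unit)) (g : List Dir → Module.Dual F (Fn F)) :
    opWord t a (v ++ w) g = opWord t a v (opWord t a w g) := by simp [opWord]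

theorem op_append (s : Slice Unit) (g : List Dir → Module.Dual F (Fn F)) (P i S : List Dir)
    (hP : P.length = s.pos) (hi : i.length = s.input.length) (h : Fn F) :
    op t a s g (P ++ i ++ S) h = ∑ n, (term t a s i n).1 * g (P ++ (term t a s i n).2.1 ++ S)
      (act (A := F) ((term t a s i n).2.2.map (Slice.setPos s.pos)) h) := by
  rw [op, ← hP, ← hi, List.append_assoc, List.drop_left, List.take_left, List.take_left,
    ← List.append_assoc, ← List.length_append, List.drop_left]
  simp

theorem length_term (s : Slice Unit) (i : List Dir) (hi : i.length = s.input.length) (n : Fin 3) :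
    (term t a s i n).2.1.length = s.output.length := by
  cases s with
  | cup k d => fin_cases n <;> rfl
  | cap k d =>
    obtain ⟨p, q, rfl⟩ := List.length_eq_two.1 hi
    rfl
  | cross k o d e =>
    obtain ⟨p, q, rfl⟩ := List.length_eq_two.1 hi
    fin_cases n <;> rfl

theorem chain_term (s : Slice Unit) (i : List Dir) (hi : i.length = s.input.length) (n : Fin 3)
    (h0 : (term t a s i n).1 ≠ 0) : Chain i (term t a s i n).2.2 (term t a s i n).2.1 := by
  cases s with
  | cup k d =>
    obtain rfl := List.length_eq_zero_iff.1 hi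
    fin_cases n
    · exact Chain.cons (.cup 0 Dir.east) (.nil _)
    · exact Chain.cons (.cup 0 Dir.west) (.nil _)
    · exact Chain.cons (.cup 0 Dir.west) (.nil _)
  | cap k d =>
    obtain ⟨p, q, rfl⟩ := List.length_eq_two.1 hi
    have hq : q = -p := by
      by_contra hq
      fin_cases n <;> simp [term, hq] at h0
    subst hq
    exact Chain.cons (.cap 0 p) (.nil _)
  | cross k o d e =>
    obtain ⟨p, q, rfl⟩ := List.length_eq_two.1 hi
    fin_cases n
    · exact Chain.cons (.cross 0 o p q) (.nil _)
    · have hq : q = -p := by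
        by_contra hq
        simp [term, hq] at h0
      subst hq
      exact Chain.cons (.cap 0 p) (Chain.cons (.cup 0 p) (.nil _))
    · exact .nil _

/-- Two words have the same transfer operator, starting from the strands `L`. -/
def JaegerEq (t a : F) (L : List Unit) (x y : List (Slice Unit)) : Prop :=
  ∀ (g : List Dir → Module.Dual F (Fn F)) (I : List Dir), I.length = L.length →
    -- Only functionals `h` that satisfy the oriented skein relations are tested, so state sums are
    -- compared modulo these relations.
    ∀ h ∈ skeinSpace F (t - t⁻¹) a I, opWord t a x g I h = opWord t a y g I h

theorem op_congr {s : Slice Unit} {L M : List Unit} (hs : s.step L = some M)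
    {g g' : List Dir → Module.Dual F (Fn F)}
    (hg : ∀ I, I.length = M.length → ∀ h ∈ skeinSpace F (t - t⁻¹) a I, g I h = g' I h)
    {I : List Dir} (hI : I.length = L.length) {h : Fn F} (hh : h ∈ skeinSpace F (t - t⁻¹) a I) :
    op t a s g I h = op t a s g' I h := by
  obtain ⟨P, S, hP, rfl, rfl⟩ := step_eq_some.1 hs
  obtain ⟨P', i, S', rfl, h1, h2, h3⟩ := Model.exists_split hI
  rw [op_append s g P' i S' (h1.trans hP) h2, op_append s g' P' i S' (h1.trans hP) h2]
  refine Finset.sum_congr rfl fun n _ => ?_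
  by_cases h0 : (term t a s i n).1 = 0
  · rw [h0, zero_mul, zero_mul]
  · rw [hg _ _ _ (act_mem hh ((chain_term s i h2 n h0).typed P' S' s.pos (h1.trans hP)))]
    simp [length_term s i h2, h1, h3]

theorem opWord_congr {w : List (Slice Unit)} {L M : List Unit} (hw : Typed L w M)
    {g g' : List Dir → Module.Dual F (Fn F)}
    (hg : ∀ I, I.length = M.length → ∀ h ∈ skeinSpace F (t - t⁻¹) a I, g I h = g' I h)
    {I : List Dir} (hI : I.length = L.length) {h : Fn F} (hh : h ∈ skeinSpace F (t - t⁻¹) a I) :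
    opWord t a w g I h = opWord t a w g' I h := by
  induction w generalizing L I h with
  | nil => rw [typed_nil] at hw; subst hw; exact hg I hI h hh
  | cons s w ih =>
    obtain ⟨K, h1, h2⟩ := typed_cons.1 hw
    exact op_congr h1 (fun J hJ h hh => ih h2 hJ hh) hI hh

@[simp] theorem term_setPos (s : Slice Unit) (j : ℕ) (i : List Dir) (n : Fin 3) :
    term t a (s.setPos j) i n = term t a s i n := by
  cases s with
  | cup => rfl
  | cap =>
    match i with
    | [] | [_] | [_, _] | _ :: _ :: _ :: _ => rfl
  | cross =>
    match i with
    | [] | [_] | [_, _] | _ :: _ :: _ :: _ => rfl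

theorem jaegerEq_congr : TangleCongr (JaegerEq t a) where
  refl _ _ _ _ _ _ _ := rfl
  symm h g I hI f hf := (h g I hI f hf).symm
  trans h h' g I hI f hf := (h g I hI f hf).trans (h' g I hI f hf)
  ctx A B x y hA h g I hI f hf := by
    simp only [opWord_append]
    exact opWord_congr hA (fun J hJ f hf => h _ J hJ f hf) hI hf
  exchange s u P Q S hP g I hI h hh := by
    rw [List.append_assoc, List.append_assoc (P ++ s.input)] at hI
    obtain ⟨P', i, R, rfl, h1, h2, h3⟩ := Model.exists_split hI
    rw [← List.append_assoc] at h3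
    obtain ⟨Q', j, S', rfl, h4, h5, h6⟩ := Model.exists_split h3
    have hs := h1.trans hP
    simp only [opWord_cons, opWord_nil]
    rw [op_append s _ P' i _ hs h2]
    have hR : P' ++ i ++ (Q' ++ j ++ S') = (P' ++ i ++ Q') ++ j ++ S' := by simp
    rw [hR] at hh ⊢
    rw [op_append (u.setPos _) _ (P' ++ i ++ Q') j S' (by simp; omega) (by simpa using h5)]
    have e1 : ∀ n h', op t a (u.setPos (s.pos + s.output.length + Q.length)) g
        (P' ++ (term t a s i n).2.1 ++ (Q' ++ j ++ S')) h' = ∑ m, (term t a u j m).1 *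
          g (P' ++ (term t a s i n).2.1 ++ Q' ++ (term t a u j m).2.1 ++ S')
            (act (A := F) ((term t a u j m).2.2.map
              (Slice.setPos (s.pos + s.output.length + Q.length))) h') := by
      intro n h'
      have hR : P' ++ (term t a s i n).2.1 ++ (Q' ++ j ++ S') =
        (P' ++ (term t a s i n).2.1 ++ Q') ++ j ++ S' := by simp
      rw [hR, op_append (u.setPos _) _ (P' ++ (term t a s i n).2.1 ++ Q') j S'
        (by simp [length_term s i h2]; omega) (by simpa using h5)]
      simp
    have e2 : ∀ m h', op t a s g (P' ++ i ++ Q' ++ (term t a u j m).2.1 ++ S') h' =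
        ∑ n, (term t a s i n).1 *
          g (P' ++ (term t a s i n).2.1 ++ Q' ++ (term t a u j m).2.1 ++ S')
            (act (A := F) ((term t a s i n).2.2.map (Slice.setPos s.pos)) h') := by
      intro m h'
      have hR : P' ++ i ++ Q' ++ (term t a u j m).2.1 ++ S' =
        P' ++ i ++ (Q' ++ (term t a u j m).2.1 ++ S') := by simp
      rw [hR, op_append s _ P' i _ hs h2]
      simp
    simp only [e1, e2, term_setPos, Slice.pos_setPos, Finset.mul_sum]
    rw [Finset.sum_comm]
    refine Finset.sum_congr rfl fun m _ => Finset.sum_congr rfl fun n _ => ?_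
    by_cases hn : (term t a s i n).1 = 0
    · simp [hn]
    by_cases hm : (term t a u j m).1 = 0
    · simp [hm]
    have key := (skeinEq_regular (α := Dir) (W := F) (z := t - t⁻¹) (a := a)).exchange_chain
      (chain_term s i h2 n hn) (chain_term u j h5 m hm) P' Q' S' s.pos
      (s.pos + s.output.length + Q.length) (s.pos + s.input.length + Q.length) hs
      (by simp [length_term s i h2]; omega) (by simp; omega) h hh
    rw [act_append, act_append] at key
    rw [key]
    ring

end Jaeger

/-! ### Planar isotopy and the second Reidemeister move for Jaeger's sum. -/

namespace Jaeger

variable {F : Type*} [Field F] {t a : F}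

theorem op_cup (P S : List Dir) (k : ℕ) (u : Unit) (g : List Dir → Module.Dual F (Fn F)) (h : Fn F)
    (hk : P.length = k) : op t a (.cup k u) g (P ++ S) h =
      g (P ++ .east :: .west :: S) (act (A := F) [.cup k .east] h) +
        a * t⁻¹ * g (P ++ .west :: .east :: S) (act (A := F) [.cup k .west] h) := by
  have := op_append (t := t) (a := a) (.cup k u) g P [] S hk rfl h
  rw [List.append_nil] at this
  rw [this, Fin.sum_univ_three]
  simp [term, Slice.setPos, Slice.pos]

theorem op_cap (P S : List Dir) (p q : Dir) (k : ℕ) (u : Unit)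
    (g : List Dir → Module.Dual F (Fn F)) (h : Fn F) (hk : P.length = k) :
    op t a (.cap k u) g (P ++ p :: q :: S) h =
      if q = -p then capWt t a p * g (P ++ S) (act (A := F) [.cap k p] h) else 0 := by
  have := op_append (t := t) (a := a) (.cap k u) g P [p, q] S hk rfl h
  simp only [List.append_assoc, List.cons_append, List.nil_append] at this
  rw [this, Fin.sum_univ_three]
  simp [term, Slice.setPos, Slice.pos]

theorem op_cross (P S : List Dir) (p q : Dir) (k : ℕ) (o : Bool) (u v : Unit)
    (g : List Dir → Module.Dual F (Fn F)) (h : Fn F) (hk : P.length = k) :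
    op t a (.cross k o u v) g (P ++ p :: q :: S) h =
      g (P ++ q :: p :: S) (act (A := F) [.cross k o p q] h) +
        if p = spliceDir o ∧ q = -p then spliceWt t o * (turnWt t a o *
          g (P ++ p :: q :: S) (act (A := F) [.cap k p, .cup k p] h) - g (P ++ p :: q :: S) h)
        else 0 := by
  have := op_append (t := t) (a := a) (.cross k o u v) g P [p, q] S hk rfl h
  simp only [List.append_assoc, List.cons_append, List.nil_append] at this
  rw [this, Fin.sum_univ_three]
  simp only [term, Slice.setPos, Slice.pos, Matrix.cons_val, List.map_cons, List.map_nil, one_mul,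
    List.cons_append, List.nil_append, List.append_assoc, act_nil]
  split_ifs <;> ring

theorem op_cup_succ (P S : List Dir) (c : Dir) (k : ℕ) (u : Unit)
    (g : List Dir → Module.Dual F (Fn F)) (h : Fn F)
    (hk : P.length = k) : op t a (.cup (k + 1) u) g (P ++ c :: S) h =
      g (P ++ c :: .east :: .west :: S) (act (A := F) [.cup (k + 1) .east] h) +
        a * t⁻¹ * g (P ++ c :: .west :: .east :: S) (act (A := F) [.cup (k + 1) .west] h) := by
  have := op_cup (t := t) (a := a) (P ++ [c]) S (k + 1) u g h (by simpa using hk)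
  simpa using this

theorem op_cap_succ (P S : List Dir) (c p q : Dir) (k : ℕ) (u : Unit)
    (g : List Dir → Module.Dual F (Fn F)) (h : Fn F) (hk : P.length = k) :
    op t a (.cap (k + 1) u) g (P ++ c :: p :: q :: S) h =
      if q = -p then capWt t a p * g (P ++ c :: S) (act (A := F) [.cap (k + 1) p] h) else 0 := by
  have := op_cap (t := t) (a := a) (P ++ [c]) S p q (k + 1) u g h (by simpa using hk)
  simpa using this

theorem op_cross_succ (P S : List Dir) (c p q : Dir) (k : ℕ) (o : Bool) (u v : Unit)
    (g : List Dir → Module.Dual F (Fn F)) (h : Fn F) (hk : P.length = k) :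
    op t a (.cross (k + 1) o u v) g (P ++ c :: p :: q :: S) h =
      g (P ++ c :: q :: p :: S) (act (A := F) [.cross (k + 1) o p q] h) +
        if p = spliceDir o ∧ q = -p then spliceWt t o * (turnWt t a o *
          g (P ++ c :: p :: q :: S) (act (A := F) [.cap (k + 1) p, .cup (k + 1) p] h) -
            g (P ++ c :: p :: q :: S) h)
        else 0 := by
  have := op_cross (t := t) (a := a) (P ++ [c]) S p q (k + 1) o u v g h (by simpa using hk)
  simpa using this

theorem act_act (x y : List (Slice Dir)) (f : Fn F) :
    act (A := F) y (act (A := F) x f) = act (A := F) (x ++ y) f := (act_append x y f).symm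

theorem regular (t a : F) : RegularCongr (SkeinEq (α := Dir) F (t - t⁻¹) a) := skeinEq_regular

theorem jaegerEq_zigzag (ht : t ≠ 0) (ha : a ≠ 0) (P S : List Unit) (k : ℕ) (d : Unit)
    (hk : P.length = k) :
    JaegerEq t a (P ++ d :: S) [.cup k d, .cap (k + 1) (-d)] [] := by
  intro g I hI h hh
  obtain ⟨P, i, S, rfl, h1, -⟩ := exists_split_one hI
  replace h1 := h1.trans hk
  simp only [opWord_cons, opWord_nil, op_cup _ _ _ _ _ _ h1, op_cap_succ _ _ _ _ _ _ _ _ _ h1,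
    act_act, List.cons_append, List.nil_append]
  have e := (regular t a).zigzag P S k i h1 h hh
  simp only [act_nil] at e
  cases i <;> simp only [neg_east, neg_west] at e <;> (simp [e, capWt]; try field_simp)

theorem jaegerEq_zigzag' (ht : t ≠ 0) (ha : a ≠ 0) (P S : List Unit) (k : ℕ) (d : Unit)
    (hk : P.length = k) :
    JaegerEq t a (P ++ -d :: S) [.cup (k + 1) d, .cap k (-d)] [] := by
  intro g I hI h hh
  obtain ⟨P, i, S, rfl, h1, -⟩ := exists_split_one hI
  replace h1 := h1.trans hk
  simp only [opWord_cons, opWord_nil, op_cup_succ _ _ _ _ _ _ _ h1, op_cap _ _ _ _ _ _ _ _ h1,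
    act_act, List.cons_append, List.nil_append]
  have e := (regular t a).zigzag' P S k (-i) h1 h
  simp only [act_nil, neg_neg] at e
  replace e := e hh
  cases i <;> simp only [neg_east, neg_west] at e <;> (simp [e, capWt]; try field_simp)

/-- Kept crossings correspond by the oriented slide. A vertical splice on one side creates a zigzag;
straightened, it matches the horizontal splice on the other side, and `turnWt` is the weight that
this comparison requires. -/
theorem jaegerEq_cupSlide (ht : t ≠ 0) (ha : a ≠ 0) (P S : List Unit) (k : ℕ) (o : Bool)
    (d e : Unit) (hk : P.length = k) : JaegerEq t a (P ++ e :: S)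
      [.cup k d, .cross (k + 1) o (-d) e] [.cup (k + 1) d, .cross k (!o) e d] := by
  intro g I hI h hh
  obtain ⟨P, i, S, rfl, h1, -⟩ := exists_split_one hI
  replace h1 := h1.trans hk
  simp only [opWord_cons, opWord_nil, op_cup _ _ _ _ _ _ h1, op_cup_succ _ _ _ _ _ _ _ h1,
    op_cross _ _ _ _ _ _ _ _ _ _ h1, op_cross_succ _ _ _ _ _ _ _ _ _ _ _ h1,
    act_act, List.cons_append, List.nil_append]
  have e1 := (regular t a).cupSlide P S k o .east i h1 h hh
  have e2 := (regular t a).cupSlide P S k o .west i h1 h hh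
  have z1 := (regular t a).ctx_right [.cup (k + 1) (-i)] ((regular t a).zigzag P S k i h1) h hh
  have z2 : act (A := F) ([.cup (k + 1) (-i), .cap k i] ++ [.cup k i]) h =
      act (A := F) ([] ++ [.cup k i]) h := by
    have := (regular t a).ctx_right [.cup k i] ((regular t a).zigzag' P S k (-i) h1) h
    simp only [neg_neg] at this
    exact this hh
  have hat : a * t⁻¹ ≠ 0 := mul_ne_zero ha (inv_ne_zero ht)
  cases i <;> cases o <;>
    simp only [neg_east, neg_west, List.cons_append, List.nil_append, Bool.not_true,
      Bool.not_false] at e1 e2 z1 z2 <;>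
    simp [e1, e2, z1, z2, spliceDir, spliceWt, turnWt] <;> field_simp <;> ring


theorem act_skein_opp {P S : List Dir} {d : Dir} {h : Fn F} {k : ℕ} (hk : P.length = k)
    (hh : h ∈ skeinSpace F (t - t⁻¹) a (P ++ d :: -d :: S)) (o : Bool) :
    act (A := F) [.cross k o d (-d)] h - act (A := F) [.cross k (!o) d (-d)] h =
      spliceWt t o • act (A := F) [.cap k d, .cup k (-d)] h := by
  have := act_skein k hk hh
  rw [if_pos rfl, if_neg (Dir.neg_ne d).symm, sub_zero] at this
  cases o
  · rw [spliceWt, if_neg Bool.false_ne_true, neg_smul, ← this, neg_sub, Bool.not_false]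
  · exact this

theorem act_skein_same {P S : List Dir} {d : Dir} {h : Fn F} {k : ℕ} (hk : P.length = k)
    (hh : h ∈ skeinSpace F (t - t⁻¹) a (P ++ d :: d :: S)) :
    act (A := F) [.cross k false d d] h =
      act (A := F) [.cross k true d d] h + (t - t⁻¹) • h := by
  have := act_skein k hk hh
  rw [if_neg (Dir.neg_ne d).symm, if_pos rfl, zero_sub, smul_neg, sub_eq_iff_eq_add] at this
  rw [this]
  abel

/-- The scalar identity behind the second Reidemeister move: both sides are `t` for `o = true` and
`t⁻¹` for `o = false`. -/
theorem spliceWt_relation (ht : t ≠ 0) (ha : a ≠ 0) (o : Bool) :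
    spliceWt t o + turnWt t a o * curlFactor a a⁻¹ (!o) =
      (turnWt t a o)⁻¹ * curlFactor a a⁻¹ o := by
  cases o <;> simp [spliceWt, turnWt, curlFactor] <;> field_simp <;> ring

theorem jaegerEq_reidemeisterTwo (ht : t ≠ 0) (ha : a ≠ 0) (P S : List Unit) (k : ℕ) (o : Bool)
    (d e : Unit) (hk : P.length = k) :
    JaegerEq t a (P ++ d :: e :: S) [.cross k o d e, .cross k (!o) e d] [] := by
  intro g I hI h hh
  obtain ⟨P, i, j, S, rfl, h1, -⟩ := exists_split_two hI
  replace h1 := h1.trans hk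
  have r2 := (regular t a).reidemeisterTwo P S k o i j h1 h hh
  rw [act_nil] at r2
  simp only [opWord_cons, opWord_nil, op_cross _ _ _ _ _ _ _ _ _ _ h1, act_act, List.cons_append,
    List.nil_append, r2]
  have hs : spliceDir (!o) = -spliceDir o := by cases o <;> rfl
  have hw : spliceWt t (!o) = -spliceWt t o := by cases o <;> simp [spliceWt]
  have hr : turnWt t a (!o) = (turnWt t a o)⁻¹ := by cases o <;> simp [turnWt]
  -- Exactly for these labels splices occur, at one crossing or at the other but never at both:
  -- splicing the first one leaves labels that forbid it at the second.
  by_cases hij : i = spliceDir o ∧ j = -i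
  · obtain ⟨rfl, rfl⟩ := hij
    set d := spliceDir o
    have e1 := act_skein_opp h1 hh o
    have e2 := congrArg (act (A := F) [.cup k (-d)]) (act_curl (mul_inv_cancel₀ ha) k o h1 hh)
    have e3 := act_cup_curl (mul_inv_cancel₀ ha) (d := d) k (!o) h1
      (act_mem hh (x := [.cap k d]) (M := P ++ S) (by subst h1; simp))
    simp only [map_smul, act_act, List.cons_append, List.nil_append] at e2 e3
    have e1' := congrArg (g (P ++ -d :: d :: S)) e1
    simp only [e2, e3, map_sub, map_smul, smul_eq_mul] at e1' ⊢
    simp only [hs, hw, hr, (Dir.neg_ne d).symm, neg_neg, and_self, false_and, if_true, if_false]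
    have key := spliceWt_relation ht ha o
    linear_combination spliceWt t o * e1' + spliceWt t o *
      g (P ++ -d :: d :: S) (act (A := F) [.cap k d, .cup k (-d)] h) * key
  · have h2 : ¬ (j = spliceDir (!o) ∧ i = -j) := by
      rintro ⟨rfl, rfl⟩
      exact hij (by simp [hs])
    rw [if_neg hij, if_neg h2, add_zero, add_zero]

theorem jaegerEq_isotopy (ht : t ≠ 0) (ha : a ≠ 0) : IsotopyCongr (JaegerEq t a) where
  toTangleCongr := jaegerEq_congr
  zigzag := jaegerEq_zigzag ht ha
  zigzag' := jaegerEq_zigzag' ht ha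
  cupSlide := jaegerEq_cupSlide ht ha
  reidemeisterTwo := jaegerEq_reidemeisterTwo ht ha

end Jaeger

/-! ### The third Reidemeister move for Jaeger's sum. -/

namespace Jaeger

variable {F : Type*} [Field F] {t a : F}

/-- The difference of a crossing of opposite strands and its inverse, squared. -/
theorem act_cross_cross_opp (ha : a ≠ 0) {P S : List Dir} {h : Fn F} {k : ℕ} (d : Dir)
    (hk : P.length = k) (hh : h ∈ skeinSpace F (t - t⁻¹) a (P ++ d :: -d :: S)) :
    act (A := F) [.cross k false d (-d), .cross k false (-d) d] h =
      h - ((t - t⁻¹) * a⁻¹) • act (A := F) [.cap k d, .cup k d] h := by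
  have hm : act (A := F) [.cross k false d (-d)] h ∈
      skeinSpace F (t - t⁻¹) a (P ++ -d :: - -d :: S) :=
    act_mem hh (by subst hk; simp)
  have e1 := act_skein_opp hk hm true
  have e2 := act_curl (mul_inv_cancel₀ ha) k false hk hh
  have r2 := (regular t a).reidemeisterTwo P S k false d (-d) hk h hh
  replace e2 := congrArg (act (A := F) [.cup k d]) e2
  simp only [neg_neg, act_act, List.cons_append, List.nil_append, map_smul, act_nil, Bool.not_true,
    Bool.not_false, spliceWt, curlFactor, if_true, Bool.false_eq_true, if_false] at e1 e2 r2
  rw [r2, e2, smul_smul] at e1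
  rw [← e1]
  abel

theorem act_cross_cross_same {P S : List Dir} {h : Fn F} {k : ℕ} (d : Dir)
    (hk : P.length = k) (hh : h ∈ skeinSpace F (t - t⁻¹) a (P ++ d :: d :: S)) :
    act (A := F) [.cross k false d d, .cross k false d d] h =
      h + (t - t⁻¹) • act (A := F) [.cross k false d d] h := by
  have hm : act (A := F) [.cross k false d d] h ∈
      skeinSpace F (t - t⁻¹) a (P ++ d :: d :: S) := act_mem hh (by subst hk; simp)
  have e1 := act_skein_same hk hm
  have r2 := (regular t a).reidemeisterTwo P S k false d d hk h hh
  simp only [act_act, List.cons_append, List.nil_append, act_nil, Bool.not_false] at e1 r2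
  rw [e1, r2]

/-- The composition of splices in the third Reidemeister move: one sector. -/
theorem splice_sector_west (ht : t ≠ 0) (ha : a ≠ 0) {P S : List Dir} {h : Fn F} {k : ℕ}
    (hk : P.length = k)
    (hh : h ∈ skeinSpace F (t - t⁻¹) a (P ++ .west :: .east :: .west :: S)) :
    (a * t⁻¹) • act (A := F) [.cap k .west, .cup k .west, .cross (k + 1) true .east .west,
        .cross k false .west .west] h -
      act (A := F) [.cross (k + 1) true .east .west, .cross k false .west .west] h =
    (a * t⁻¹) • act (A := F) [.cross (k + 1) false .east .west, .cross k true .west .west,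
        .cap (k + 1) .west, .cup (k + 1) .west] h -
      act (A := F) [.cross (k + 1) false .east .west, .cross k true .west .west] h -
      (t - t⁻¹) • (act (A := F) [.cap (k + 1) .east, .cup (k + 1) .east, .cap k .west, .cup k .west,
          .cross (k + 1) true .east .west] h -
        (a * t⁻¹)⁻¹ • act (A := F) [.cap (k + 1) .east, .cup (k + 1) .east,
          .cross (k + 1) true .east .west] h -
        (a * t⁻¹) • act (A := F) [.cap k .west, .cup k .west, .cross (k + 1) true .east .west] h +
        act (A := F) [.cross (k + 1) true .east .west] h) := by
  have hC : act (A := F) [.cap k .west] h ∈ skeinSpace F (t - t⁻¹) a (P ++ .west :: S) :=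
    act_mem hh (by subst hk; exact typed_cap.2 (typed_nil.2 rfl))
  have hE : act (A := F) [.cap (k + 1) .east] h ∈ skeinSpace F (t - t⁻¹) a (P ++ .west :: S) :=
    act_mem hh (by subst hk; simp)
  have hX : act (A := F) [.cross (k + 1) false .east .west] h ∈
      skeinSpace F (t - t⁻¹) a (P ++ .west :: .west :: .east :: S) :=
    act_mem hh (by subst hk; simp)
  have hh' : h ∈ skeinSpace F (t - t⁻¹) a ((P ++ [.west]) ++ .east :: -.east :: S) := by
    simpa using hh
  have hE' : act (A := F) [.cap (k + 1) .east] h ∈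
      skeinSpace F (t - t⁻¹) a ((P ++ [.west]) ++ S) := by simpa using hE
  have hCM : act (A := F) [.cap k .west, .cup (k + 1) .west] h ∈
      skeinSpace F (t - t⁻¹) a (P ++ .west :: .west :: .east :: S) :=
    act_mem hC (x := [.cup (k + 1) .west]) (by subst hk; simp)
  have hk' : (P ++ [Dir.west]).length = k + 1 := by simp [hk]
  have f1 := (regular t a).cupSlide P S k true .west .west hk _ hC
  have f1' := congrArg (act (A := F) [.cross k false .west .west]) f1
  have f1'' := act_cross_cross_same .west hk hCM
  have f2 := congrArg (act (A := F) [.cup (k + 1) .west])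
    ((regular t a).capSlide P S k false .west .west hk _ hX)
  have f2' := congrArg (act (A := F) [.cap k .west, .cup (k + 1) .west])
    (act_cross_cross_opp ha .east hk' hh')
  have f0 := (regular t a).zigzag' P S k .east hk _ hE
  have f0' := congrArg (act (A := F) [.cup (k + 1) .west]) f0
  have f3 := congrArg (act (A := F) [.cup k .west, .cross (k + 1) true .east .west]) f0
  have f3' := (regular t a).cupSlide P S k true .west .west hk _ hE
  have f4 := act_cup_curl (mul_inv_cancel₀ ha) (d := .east) (k + 1) true hk' hE'
  have f5 := act_skein_opp hk' hh' true
  have f5' := congrArg (act (A := F) [.cross k false .west .west]) f5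
  have f6 := act_skein_same hk hX
  simp only [neg_east, neg_west, act_act, List.cons_append, List.nil_append, map_smul, map_sub,
    act_nil, Bool.not_true, Bool.not_false, spliceWt, curlFactor, if_true] at *
  rw [f0'] at f2'
  -- All terms are now expressed through a few common words, and the identity reduces to their
  -- coefficients.
  rw [f1', f1'', ← f2, f2', f3, f3', f4, f1, eq_sub_of_add_eq f6.symm, eq_add_of_sub_eq f5,
    eq_add_of_sub_eq f5']
  match_scalars <;> field_simp <;> ring

/-- The composition of splices in the third Reidemeister move: the other sector. -/
theorem splice_sector_east (ht : t ≠ 0) (ha : a ≠ 0) {P S : List Dir} {h : Fn F} {k : ℕ}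
    (hk : P.length = k)
    (hh : h ∈ skeinSpace F (t - t⁻¹) a (P ++ .west :: .east :: .east :: S)) :
    (a * t⁻¹) • act (A := F) [.cap k .west, .cup k .west, .cross (k + 1) true .east .east,
        .cross k false .west .east] h -
      act (A := F) [.cross (k + 1) true .east .east, .cross k false .west .east] h -
      (t - t⁻¹) • (act (A := F) [.cross k true .west .east, .cap (k + 1) .west, .cup (k + 1) .west,
          .cap k .east, .cup k .east] h -
        (a * t⁻¹) • act (A := F) [.cross k true .west .east, .cap (k + 1) .west,
          .cup (k + 1) .west] h -
        (a * t⁻¹)⁻¹ • act (A := F) [.cross k true .west .east, .cap k .east, .cup k .east] h +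
        act (A := F) [.cross k true .west .east] h) =
    (a * t⁻¹) • act (A := F) [.cross (k + 1) false .east .east, .cross k true .west .east,
        .cap (k + 1) .west, .cup (k + 1) .west] h -
      act (A := F) [.cross (k + 1) false .east .east, .cross k true .west .east] h := by
  have hC : act (A := F) [.cap k .west] h ∈ skeinSpace F (t - t⁻¹) a (P ++ .east :: S) :=
    act_mem hh (by subst hk; exact typed_cap.2 (typed_nil.2 rfl))
  have hX : act (A := F) [.cross k true .west .east] h ∈
      skeinSpace F (t - t⁻¹) a (P ++ .east :: .west :: .east :: S) :=
    act_mem hh (by subst hk; simp)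
  have hXC : act (A := F) [.cross k true .west .east, .cap (k + 1) .west] h ∈
      skeinSpace F (t - t⁻¹) a (P ++ .east :: S) :=
    act_mem hh (by subst hk; simp [replaceAt])
  have hY : act (A := F) [.cross (k + 1) false .east .east] h ∈
      skeinSpace F (t - t⁻¹) a (P ++ .west :: .east :: .east :: S) :=
    act_mem hh (by subst hk; simp)
  have hY' : act (A := F) [.cross (k + 1) true .east .east] h ∈
      skeinSpace F (t - t⁻¹) a (P ++ .west :: .east :: .east :: S) :=
    act_mem hh (by subst hk; simp)
  have hh' : h ∈ skeinSpace F (t - t⁻¹) a ((P ++ [.west]) ++ .east :: .east :: S) := by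
    simpa using hh
  have hCN : act (A := F) [.cap k .west, .cup (k + 1) .west] h ∈
      skeinSpace F (t - t⁻¹) a (P ++ .east :: .west :: .east :: S) :=
    act_mem hC (x := [.cup (k + 1) .west]) (by subst hk; simp)
  have hk' : (P ++ [Dir.west]).length = k + 1 := by simp [hk]
  have f1 := congrArg (act (A := F) [.cross k false .west .east])
    ((regular t a).cupSlide P S k true .west .east hk _ hC)
  have f1' := act_cross_cross_opp ha .east hk hCN
  have f1'' := congrArg (act (A := F) [.cup k .east])
    ((regular t a).zigzag' P S k .west hk _ hC)
  have f2 := congrArg (act (A := F) [.cup k .east])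
    ((regular t a).zigzag' P S k .west hk _ hXC)
  have f3 := (regular t a).capSlide P S k false .west .east hk
  have f3' := f3 _ hh
  have f3a := congrArg (act (A := F) [.cup k .east]) f3'
  have f3b := congrArg (act (A := F) [.cup (k + 1) .west]) f3'
  have f3c := congrArg (act (A := F) [.cup (k + 1) .west]) (f3 _ hY)
  have f4 := congrArg (act (A := F) [.cup k .east])
    (act_curl (mul_inv_cancel₀ ha) (d := .west) k true hk hh)
  have f5 := congrArg (act (A := F) [.cap k .west, .cup (k + 1) .west])
    (act_cross_cross_same .east hk' hh')
  have f6 := act_skein_same hk' hh'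
  have f6' := congrArg (act (A := F) [.cross k false .west .east]) f6
  have f7 := act_skein_opp hk hh true
  have f7' := act_skein_opp hk hY true
  simp only [neg_east, neg_west, act_act, List.cons_append, List.nil_append, map_smul, map_sub,
    map_add, act_nil, Bool.not_true, Bool.not_false, spliceWt, curlFactor, if_true] at *
  rw [f1, f1', f1'', f2, ← f3a, ← f3b, ← f3c, f4, f5, eq_sub_of_add_eq f6'.symm,
    eq_add_of_sub_eq f7, eq_add_of_sub_eq f7']
  match_scalars <;> field_simp <;> ring

end Jaeger

namespace Jaeger

variable {F : Type*} [Field F] {t a : F}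

/-- The strand crosses first the rightmost and then the leftmost point of the splice. -/
theorem splice_across {P S : List Dir} {h : Fn F} {k : ℕ} (o : Bool) (c d : Dir)
    (hk : P.length = k) (hh : h ∈ skeinSpace F (t - t⁻¹) a (P ++ c :: d :: -d :: S)) :
    act (A := F) [.cross k o c d, .cross (k + 1) o c (-d), .cap k d, .cup k d] h =
      act (A := F) [.cap (k + 1) d, .cup (k + 1) d, .cross k o c d, .cross (k + 1) o c (-d)] h := by
  have e1 := congrArg (act (A := F) [.cup k d]) ((regular t a).cap_across P S k o c d hk h hh)
  have e2 := (regular t a).cup_across P S k o c d hk (act (A := F) [.cap (k + 1) d] h)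
    (act_mem hh (by subst hk; simp))
  simp only [act_act, List.cons_append, List.nil_append] at e1 e2
  rw [e1, e2]

/-- The two crossings slide around the two turning points of the splice, to the other side of the
strand `m`. -/
theorem splice_conj {P S : List Dir} {h : Fn F} {k : ℕ} (d m : Dir)
    (hk : P.length = k) (hh : h ∈ skeinSpace F (t - t⁻¹) a (P ++ d :: m :: -d :: S)) :
    act (A := F) [.cross k true d m, .cap (k + 1) d, .cup (k + 1) d, .cross k false m d] h =
      act (A := F) [.cross (k + 1) false m (-d), .cap k d, .cup k d,
        .cross (k + 1) true (-d) m] h := by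
  have e1 := congrArg (act (A := F) [.cup k d, .cross (k + 1) true (-d) m])
    ((regular t a).capSlide P S k false d m hk h hh)
  have e2 := (regular t a).cupSlide P S k true d m hk
    (act (A := F) [.cross k true d m, .cap (k + 1) d] h) (act_mem hh (by subst hk; simp))
  simp only [act_act, List.cons_append, List.nil_append, Bool.not_true, Bool.not_false] at e1 e2
  rw [e1, e2]

theorem jaegerEq_mixed (ht : t ≠ 0) (ha : a ≠ 0) (P S : List Unit) (k : ℕ) (u v w : Unit)
    (hk : P.length = k) : JaegerEq t a (P ++ u :: v :: w :: S)
      [.cross k true u v, .cross (k + 1) true u w, .cross k false v w]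
      [.cross (k + 1) false v w, .cross k true u w, .cross (k + 1) true u v] := by
  intro g I hI h hh
  obtain ⟨P, i, j, l, S, rfl, h1, -⟩ := exists_split_three hI
  replace h1 := h1.trans hk
  have e0 := (regular t a).r3_flip_upper ((regular t a).reidemeisterThree true i l j) P S k h1 h hh
  simp only [opWord_cons, opWord_nil, op_cross _ _ _ _ _ _ _ _ _ _ h1,
    op_cross_succ _ _ _ _ _ _ _ _ _ _ _ h1, act_act, List.cons_append, List.nil_append]
  simp only [Bool.not_true] at e0
  rw [e0]
  have r1 := (regular t a).reidemeisterTwo P (l :: S) k true i j h1 h hh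
  have r2 := (regular t a).reidemeisterTwo (P ++ [i]) S (k + 1) false j l (by simp [h1]) h
    (by simpa using hh)
  simp only [Bool.not_true, Bool.not_false, act_nil] at r1 r2
  have hat : a * t⁻¹ ≠ 0 := mul_ne_zero ha (inv_ne_zero ht)
  cases i <;> cases j <;> cases l <;>
    simp only [spliceDir, spliceWt, turnWt, neg_east, neg_west, reduceCtorEq, if_true, if_false,
      and_true, and_false, false_and, true_and, add_zero, Bool.false_eq_true, r1, r2]
  · have e2 := splice_across true .east .east h1 hh
    simp only [neg_east] at e2
    rw [e2]
  · have e1 := congrArg (g (P ++ .east :: .west :: .east :: S)) (splice_sector_east ht ha h1 hh)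
    have e2 := splice_conj .west .east h1 hh
    simp only [map_sub, map_add, map_smul, smul_eq_mul, neg_west] at e1 e2
    rw [e2]
    linear_combination (t - t⁻¹) * e1 - (t - t⁻¹) ^ 2 * g (P ++ .east :: .west :: .east :: S)
      (act (A := F) [.cross k true .west .east, .cap (k + 1) .west, .cup (k + 1) .west,
        .cap k .east, .cup k .east] h) * mul_inv_cancel₀ hat
  · have e1 := congrArg (g (P ++ .west :: .west :: .east :: S)) (splice_sector_west ht ha h1 hh)
    have e2 := splice_across true .west .east h1 hh
    simp only [map_sub, map_add, map_smul, smul_eq_mul, neg_east] at e1 e2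
    rw [e2]
    linear_combination (t - t⁻¹) * e1 + (t - t⁻¹) ^ 2 * g (P ++ .west :: .west :: .east :: S)
      (act (A := F) [.cap (k + 1) .east, .cup (k + 1) .east, .cap k .west, .cup k .west,
        .cross (k + 1) true .east .west] h) * mul_inv_cancel₀ hat
  · have e2 := splice_conj .west .west h1 hh
    simp only [neg_west] at e2
    rw [e2]

end Jaeger

/-- The third Reidemeister move follows from the one where the crossing of the two upper strands is
switched. -/
theorem IsotopyCongr.r3_of_flip_upper {α : Type} [InvolutiveNeg α] [DecidableEq α]
    {E : List α → List (Slice α) → List (Slice α) → Prop} (h : IsotopyCongr E) {o : Bool} {d e f : α}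
    (hm : ∀ (P S : List α) (k : ℕ), P.length = k → E (P ++ d :: f :: e :: S)
      [.cross k o d f, .cross (k + 1) o d e, .cross k (!o) f e]
      [.cross (k + 1) (!o) f e, .cross k o d e, .cross (k + 1) o d f]) : HasR3 E o d e f := by
  intro P S k hk
  subst hk
  set k := P.length
  refine h.trans (y := [.cross (k + 1) o e f, .cross (k + 1) (!o) f e, .cross k o d e,
    .cross (k + 1) o d f, .cross k o e f]) (h.symm ?_) ?_
  · exact h.ctx [] [.cross k o d e, .cross (k + 1) o d f, .cross k o e f]
      (M := (P ++ [d]) ++ e :: f :: S) (by simp)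
      (h.reidemeisterTwo (P ++ [d]) S (k + 1) o e f (by simp [k]))
  refine h.trans (y := [.cross (k + 1) o e f, .cross k o d f, .cross (k + 1) o d e,
    .cross k (!o) f e, .cross k o e f]) (h.symm ?_) ?_
  · exact h.ctx [.cross (k + 1) o e f] [.cross k o e f] (M := P ++ d :: f :: e :: S)
      (by simp [k]) (hm P S k rfl)
  · have key := h.reidemeisterTwo P (d :: S) k (!o) f e rfl
    simp only [Bool.not_not] at key
    exact h.ctx [.cross (k + 1) o e f, .cross k o d f, .cross (k + 1) o d e] []
      (M := P ++ f :: e :: d :: S) (by simp [k]) key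

/-! ### Jaeger's sum is a skein functional of Kauffman type. -/

namespace Jaeger

variable {F : Type*} [Field F] {t a : F}

theorem jaegerEq_regular (ht : t ≠ 0) (ha : a ≠ 0) : RegularCongr (JaegerEq t a) where
  toIsotopyCongr := jaegerEq_isotopy ht ha
  reidemeisterThree := by
    have h := jaegerEq_isotopy ht ha
    have h3 : ∀ d e f, HasR3 (JaegerEq t a) true d e f := fun d e f =>
      h.r3_of_flip_upper fun P S k hk => jaegerEq_mixed ht ha P S k d f e hk
    intro o d e f
    cases o with
    | true => exact h3 d e f
    | false => exact h.r3_rotate (h3 _ _ _)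

theorem op_linear (s : Slice Unit) (b c : F) (g g' : List Dir → Module.Dual F (Fn F)) :
    op t a s (b • g + c • g') = b • op t a s g + c • op t a s g' := by
  funext I
  refine LinearMap.ext fun h => ?_
  simp only [op, Pi.add_apply, Pi.smul_apply, LinearMap.add_apply, LinearMap.smul_apply,
    LinearMap.sum_apply, LinearMap.comp_apply, smul_eq_mul, Finset.mul_sum,
    ← Finset.sum_add_distrib]
  exact Finset.sum_congr rfl fun x _ => by ring

theorem opWord_linear (w : List (Slice Unit)) (b c : F)
    (g g' : List Dir → Module.Dual F (Fn F)) :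
    opWord t a w (b • g + c • g') = b • opWord t a w g + c • opWord t a w g' := by
  induction w with
  | nil => rfl
  | cons s w ih => rw [opWord_cons, ih, op_linear]; rfl

/-- For opposite labels the oriented relation for the kept crossings gives the vertical splice with
reversed labels on the right. The splices of the state sum supply the vertical splice with unchanged
labels and the horizontal one. -/
theorem op_skein (ht : t ≠ 0) (ha : a ≠ 0) (P S : List Unit) (k : ℕ) (u v : Unit)
    (hk : P.length = k) (g : List Dir → Module.Dual F (Fn F)) (I : List Dir)
    (hI : I.length = (P ++ u :: v :: S).length) (h : Fn F)
    (hh : h ∈ skeinSpace F (t - t⁻¹) a I) :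
    op t a (.cross k true u v) g I h =
      ((1 : F) • op t a (.cross k false u v) g + (t - t⁻¹) •
        ((1 : F) • op t a (.cap k u) (op t a (.cup k (-u)) g) + (-1 : F) • g)) I h := by
  obtain ⟨P, i, j, S, rfl, h1, -⟩ := exists_split_two hI
  replace h1 := h1.trans hk
  simp only [Pi.add_apply, Pi.smul_apply, LinearMap.add_apply, LinearMap.smul_apply,
    op_cross _ _ _ _ _ _ _ _ _ _ h1, op_cap _ _ _ _ _ _ _ _ h1, op_cup _ _ _ _ _ _ h1, act_act,
    List.cons_append, List.nil_append, smul_eq_mul]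
  obtain rfl | rfl := Dir.eq_or_eq_neg j i
  · have e1 := congrArg (g (P ++ j :: j :: S)) (act_skein_same h1 hh)
    simp only [map_add, map_smul, smul_eq_mul] at e1
    simp only [(Dir.neg_ne j).symm, and_false, if_false]
    linear_combination -e1
  · have e1 := congrArg (g (P ++ -i :: i :: S)) (act_skein_opp h1 hh true)
    simp only [map_sub, map_smul, smul_eq_mul, Bool.not_true] at e1
    cases i <;> simp only [spliceDir, spliceWt, turnWt, neg_east, neg_west, reduceCtorEq, if_true,
      if_false, and_true, and_false, false_and, true_and, add_zero, Bool.false_eq_true, capWt]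
      at e1 ⊢
    · have hat : a * t⁻¹ ≠ 0 := mul_ne_zero ha (inv_ne_zero ht)
      linear_combination e1 - (t - t⁻¹) * g (P ++ .west :: .east :: S)
        (act (A := F) [.cap k .east, .cup k .west] h) * mul_inv_cancel₀ hat
    · linear_combination e1

/-- If the lower strand goes east, nothing can be spliced. If it goes west, the kept crossing, the
vertical and the horizontal splice contribute `t`, `a t⁻¹ (a - a⁻¹)` and `-(t - t⁻¹)`, with sum `a²
t⁻¹`. -/
theorem op_curl (ht : t ≠ 0) (ha : a ≠ 0) (P S : List Unit) (k : ℕ) (u : Unit)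
    (hk : P.length = k) (g : List Dir → Module.Dual F (Fn F)) (I : List Dir)
    (hI : I.length = (P ++ u :: -u :: S).length) (h : Fn F)
    (hh : h ∈ skeinSpace F (t - t⁻¹) a I) :
    op t a (.cross k true u (-u)) (op t a (.cap k (-u)) g) I h =
      ((a ^ 2 * t⁻¹) • op t a (.cap k u) g + (0 : F) • g) I h := by
  obtain ⟨P, i, j, S, rfl, h1, -⟩ := exists_split_two hI
  replace h1 := h1.trans hk
  simp only [Pi.add_apply, Pi.smul_apply, LinearMap.add_apply, LinearMap.smul_apply,
    op_cross _ _ _ _ _ _ _ _ _ _ h1, op_cap _ _ _ _ _ _ _ _ h1, act_act,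
    List.cons_append, List.nil_append, smul_eq_mul]
  obtain rfl | rfl := Dir.eq_or_eq_neg j i
  · simp [(Dir.neg_ne j).symm]
  · have e1 := congrArg (g (P ++ S)) (act_curl (mul_inv_cancel₀ ha) k true h1 hh)
    simp only [map_smul, smul_eq_mul, curlFactor, if_true] at e1
    cases i <;> simp only [spliceDir, spliceWt, turnWt, neg_east, neg_west, reduceCtorEq, if_true,
      if_false, and_true, and_false, false_and, true_and, add_zero, Bool.false_eq_true, capWt]
      at e1 ⊢
    · rw [e1]
      field_simp
      ring
    -- The vertical splice leaves a circle to the right of a rightmost point, where there may be no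
    -- strand. It is moved to the left of that point, beside a strand, and evaluated there.
    · have ec : (t - t⁻¹) • act (A := F) [.cap k .west, .cup k .west, .cap k .west] h =
          (a - a⁻¹) • act (A := F) [.cap k .west] h := by
        subst h1
        have x1 := (regular t a).exch (L := P ++ .west :: .east :: S) [] [.cap P.length .west]
          (.cap P.length .west) (.cup 0 .west) P [] S P.length (P.length + 2) rfl
          (typed_nil.2 (by simp [Slice.input])) rfl rfl h hh
        have x2 := (regular t a).exch (L := P ++ .west :: .east :: S)
          [.cup (P.length + 2) .west] [] (.cap P.length .west) (.cap 0 .west) P [] S P.length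
          (P.length + 2) rfl (by simp [Slice.input]) rfl rfl h hh
        have x3 := congrArg (act (A := F) [.cap P.length .west])
          (act_circle Dir.eq_or_eq_neg (mul_inv_cancel₀ ha) (P := P ++ [.west]) (S := S)
            (x := .east) .west (P.length + 1) (by simp) (by simpa using hh))
        simp only [map_smul, act_act, Slice.setPos, List.cons_append, List.nil_append, circleFactor,
          neg_west, reduceCtorEq, if_false, add_zero] at x1 x2 x3
        rw [x1, x2]
        exact x3
      have ec' := congrArg (g (P ++ S)) ec
      simp only [map_smul, smul_eq_mul] at ec'
      rw [e1]
      have key : (a * t⁻¹)⁻¹ * a = t := by field_simp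
      have key' : a * t⁻¹ * a⁻¹ = t⁻¹ := by field_simp
      linear_combination a * t⁻¹ * ec' + g (P ++ S) (act (A := F) [.cap k .west] h) * (key - key')

/-- The state sum of a closed word. -/
noncomputable def value (t a : F) (φ : Fn F) : List (Slice Unit) → F :=
  closedPart fun w => opWord t a w (fun _ => LinearMap.proj []) [] φ

variable {φ : Fn F}

theorem value_mem (ht : t ≠ 0) (ha : a ≠ 0) (hφ : φ ∈ skeinSpace F (t - t⁻¹) a []) :
    value t a φ ∈ skeinSpace F (t - t⁻¹) (a ^ 2 * t⁻¹) [] := by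
  refine closedPart_mem (jaegerEq_regular ht ha) ?_ ?_ ?_
  · intro x y h _
    exact h _ _ rfl _ hφ
  · intro U V P S k d e hk hU hV
    simp only [opWord_append, opWord_cons, opWord_nil]
    rw [opWord_congr hU (op_skein ht ha P S k d e hk _) rfl hφ, opWord_linear, opWord_linear]
    simp only [if_true, Pi.add_apply, Pi.smul_apply, LinearMap.add_apply, LinearMap.smul_apply, smul_eq_mul]
    ring
  · intro U V P S k d hk hU hV
    simp only [opWord_append, opWord_cons, opWord_nil]
    rw [opWord_congr hU (op_curl ht ha P S k d hk _) rfl hφ, opWord_linear]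
    simp

theorem value_nil : value t a φ [] = φ [] := closedPart_of_typed _ (typed_nil.2 rfl)

/-- The two orientations give `((a t⁻¹)⁻¹ + a t⁻¹) (a - a⁻¹)`, which expands to `a² t⁻¹ - (a² t⁻¹)⁻¹
+ (t - t⁻¹)`. -/
theorem value_circle (ht : t ≠ 0) (ha : a ≠ 0)
    (hφc : ∀ d, (t - t⁻¹) * φ [.cup 0 d, .cap 0 d] = circleFactor (t - t⁻¹) a a⁻¹ d) (u : Unit) :
    (t - t⁻¹) * value t a φ [.cup 0 u, .cap 0 u] =
      circleFactor (t - t⁻¹) (a ^ 2 * t⁻¹) (a ^ 2 * t⁻¹)⁻¹ u := by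
  have h1 := hφc .east
  have h2 := hφc .west
  rw [circleFactor, if_neg (by decide), add_zero] at h1 h2
  rw [circleFactor, if_pos (Subsingleton.elim _ _), value, closedPart_of_typed]
  · have e1 := op_cup (t := t) (a := a) [] [] 0 u
      (op t a (.cap 0 u) fun _ => LinearMap.proj []) φ rfl
    simp only [List.nil_append] at e1
    have e2 := fun p q h => op_cap (t := t) (a := a) [] [] p q 0 u
      (fun _ => LinearMap.proj []) h rfl
    simp only [List.nil_append] at e2
    simp only [opWord_cons, opWord_nil, e1, e2, act_act, neg_east, neg_west, if_true, capWt,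
      LinearMap.proj_apply, act_apply, List.cons_append, List.nil_append, one_mul]
    have key : (t - t⁻¹) * ((a * t⁻¹)⁻¹ * φ [.cup 0 .east, .cap 0 .east] +
        a * t⁻¹ * φ [.cup 0 .west, .cap 0 .west]) =
        (a * t⁻¹)⁻¹ * (a - a⁻¹) + a * t⁻¹ * (a - a⁻¹) := by
      linear_combination (a * t⁻¹)⁻¹ * h1 + a * t⁻¹ * h2
    rw [key]
    field_simp
    ring
  · exact typed_cons.2 ⟨[u, -u], by simp [Slice.step, Slice.pos, Slice.input, Slice.output],
      typed_cons.2 ⟨[], by simp [Slice.step, Slice.pos, Slice.input, Slice.output], typed_nil.2 rfl⟩⟩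

end Jaeger

/-! ## The state sum of a front -/

theorem length_of_replaceAt {α : Type} [DecidableEq α] {k : ℕ} {inp out L M : List α}
    (h : replaceAt k inp out L = some M) : M.length + inp.length = L.length + out.length := by
  obtain ⟨P, S, -, rfl, rfl⟩ := replaceAt_eq_some.1 h
  simp only [List.length_append]
  omega

theorem replaceAt_pair {α : Type} [DecidableEq α] {P S : List α} {k : ℕ} (hk : P.length = k)
    (d e i j : α) (out : List α) : replaceAt k [d, e] out (P ++ i :: j :: S) =
      if d = i ∧ e = j then some (P ++ out ++ S) else none := by
  subst hk
  simp [replaceAt]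

theorem replaceAt_empty {α : Type} [DecidableEq α] {P S : List α} {k : ℕ} (hk : P.length = k)
    (out : List α) : replaceAt k [] out (P ++ S) = some (P ++ out ++ S) := by
  subst hk
  simp [replaceAt]

namespace LocalState

theorem length_stepState {s : LocalState} {I M : List Dir} (h : s.stepState I = some M)
    {L N : List Unit} (h' : FrontPiece.step L s.original = some N) (hI : I.length = L.length) :
    M.length = N.length := by
  have h1 := length_of_replaceAt h'
  cases s with
  | spliceV k d e =>
    obtain ⟨K, h2, h3⟩ := Option.bind_eq_some_iff.1 h
    have h4 := length_of_replaceAt h2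
    have h5 := length_of_replaceAt h3
    simp only [original, FrontPiece.input, FrontPiece.output, List.length_cons, List.length_nil]
      at h1 h4 h5
    omega
  | _ =>
    have h2 := length_of_replaceAt h
    simp only [original, FrontPiece.input, FrontPiece.output, List.length_cons, List.length_nil]
      at h1 h2
    omega

open Classical in
/-- The possible states at a piece. -/
noncomputable def ofPiece : FrontPiece Unit → Finset LocalState
  | .leftCusp k _ => Finset.univ.image (leftCusp k)
  | .rightCusp k _ => Finset.univ.image (rightCusp k)
  | .crossing k _ _ => Finset.univ.image (fun x : Dir × Dir => keep k x.1 x.2) ∪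
      Finset.univ.image (fun x : Dir × Dir => spliceH k x.1 x.2) ∪
      Finset.univ.image (fun x : Dir × Dir => spliceV k x.1 x.2)

theorem mem_ofPiece {s : LocalState} {p : FrontPiece Unit} : s ∈ ofPiece p ↔ s.original = p := by
  cases p <;> cases s <;> simp [ofPiece, original, eq_comm]

section Sums

variable {A : Type*} [AddCommMonoid A] (f : LocalState → A)

theorem sum_dir (f : Dir → A) : ∑ d, f d = f .east + f .west := by
  rw [show (Finset.univ : Finset Dir) = {.east, .west} from rfl]
  simp

theorem sum_ofPiece_leftCusp (k : ℕ) (u : Unit) :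
    ∑ s ∈ ofPiece (.leftCusp k u), f s = ∑ d, f (leftCusp k d) := by
  classical
  rw [ofPiece, Finset.sum_image]
  intro d _ e _ h
  simpa using h

theorem sum_ofPiece_rightCusp (k : ℕ) (u : Unit) :
    ∑ s ∈ ofPiece (.rightCusp k u), f s = ∑ d, f (rightCusp k d) := by
  classical
  rw [ofPiece, Finset.sum_image]
  intro d _ e _ h
  simpa using h

theorem sum_ofPiece_crossing (k : ℕ) (u v : Unit) :
    ∑ s ∈ ofPiece (.crossing k u v), f s =
      ∑ d, ∑ e, f (keep k d e) + ∑ d, ∑ e, f (spliceH k d e) + ∑ d, ∑ e, f (spliceV k d e) := by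
  classical
  rw [ofPiece, Finset.sum_union, Finset.sum_union, Finset.sum_image, Finset.sum_image,
    Finset.sum_image, Fintype.sum_prod_type, Fintype.sum_prod_type, Fintype.sum_prod_type]
  · rintro ⟨d, e⟩ _ ⟨d', e'⟩ _ h
    simpa using h
  · rintro ⟨d, e⟩ _ ⟨d', e'⟩ _ h
    simpa using h
  · rintro ⟨d, e⟩ _ ⟨d', e'⟩ _ h
    simpa using h
  · rw [Finset.disjoint_left]
    simp
    rintro _ d e rfl
    simp
  · rw [Finset.disjoint_left]
    simp
    rintro _ (⟨d, e, rfl⟩ | ⟨d, e, rfl⟩) <;> simp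

end Sums

/-- Prefixing a word of local states with a local state. -/
def consEmbedding : LocalState × List LocalState ↪ List LocalState where
  toFun x := x.1 :: x.2
  inj' := by
    rintro ⟨s, τ⟩ ⟨s', τ'⟩ h
    simpa using h

@[simp]
theorem consEmbedding_apply (x : LocalState × List LocalState) :
    consEmbedding x = x.1 :: x.2 := rfl

/-- All words of local states of a word of pieces. -/
noncomputable def ofWord : List (FrontPiece Unit) → Finset (List LocalState)
  | [] => {[]}
  | p :: w => (ofPiece p ×ˢ ofWord w).map consEmbedding

theorem mem_ofWord {w : List (FrontPiece Unit)} {τ : List LocalState} :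
    τ ∈ ofWord w ↔ τ.map original = w := by
  induction w generalizing τ with
  | nil => simp [ofWord]
  | cons p w ih =>
    cases τ with
    | nil => simp [ofWord]
    | cons s τ => simp [ofWord, mem_ofPiece, ih]

variable {F : Type*} [Field F]

/-- The total weight of a word of local states, including its cusps. -/
def totalWeight (t a : F) (τ : List LocalState) : F :=
  (a * t⁻¹) ^ ((τ.flatMap result).countP FrontPiece.isLeftCuspUp +
    (τ.flatMap result).countP FrontPiece.isRightCuspDown) * (τ.map (weight t a)).prod

theorem totalWeight_cons (t a : F) (s : LocalState) (τ : List LocalState) :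
    totalWeight t a (s :: τ) = totalWeight t a [s] * totalWeight t a τ := by
  simp only [totalWeight, List.flatMap_cons, List.flatMap_nil, List.append_nil, List.countP_append,
    List.map_cons, List.map_nil, List.prod_cons, List.prod_nil, mul_one, pow_add]
  ring

/-- The word of a local state. -/
def toWord (s : LocalState) : List (Slice Dir) := s.result.flatMap FrontPiece.morsify

theorem typed_toWord {s : LocalState} {I M : List Dir} (h : s.stepState I = some M) :
    Typed I s.toWord M :=
  foldlM_flatMap_morsify _ (foldlM_result s h)

end LocalState

namespace Jaeger

open LocalState

variable {F : Type*} [Field F] {t a : F}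

/-- The contribution of a local state to the transfer operator of a piece. -/
def contribution (t a : F) (g : List Dir → Module.Dual F (Fn F)) (I : List Dir) (h : Fn F)
    (s : LocalState) : F :=
  (s.stepState I).elim 0 fun M => totalWeight t a [s] * g M (act (A := F) s.toWord h)

/-- Piece by piece, the weights of `term` become the local weights of a state times `a * t⁻¹` for
each counted cusp, once the curls of right cusps are evaluated on both sides. -/
theorem opWord_morsify (ht : t ≠ 0) (ha : a ≠ 0) {p : FrontPiece Unit} {L M : List Unit}
    (hp : FrontPiece.step L p = some M) (g : List Dir → Module.Dual F (Fn F)) {I : List Dir}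
    (hI : I.length = L.length) {h : Fn F} (hh : h ∈ skeinSpace F (t - t⁻¹) a I) :
    opWord t a p.morsify g I h = ∑ s ∈ ofPiece p, contribution t a g I h s := by
  obtain ⟨P, S, hk, rfl, rfl⟩ := replaceAt_eq_some.1 hp
  cases p with
  | leftCusp k u =>
    obtain ⟨P, i, S, rfl, h1, h2, -⟩ := Model.exists_split hI
    obtain rfl := List.length_eq_zero_iff.1 h2
    replace h1 : P.length = k := h1.trans hk
    rw [sum_ofPiece_leftCusp, sum_dir]
    simp only [FrontPiece.morsify, opWord_cons, opWord_nil, List.append_nil,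
      op_cup _ _ _ _ _ _ h1, contribution, stepState, FrontPiece.step, FrontPiece.pos,
      FrontPiece.input, FrontPiece.output, replaceAt_empty h1, Option.elim_some, toWord, result,
      List.flatMap_cons, List.flatMap_nil]
    simp [totalWeight, result, weight, FrontPiece.isLeftCuspUp, FrontPiece.isRightCuspDown]
  | rightCusp k u =>
    have hI' : I.length = (P ++ u :: -u :: S).length := by simpa [FrontPiece.input] using hI
    have ec := op_curl ht ha P S k u hk g I hI' h hh
    obtain ⟨P, i, j, S, rfl, h1, -⟩ := exists_split_two hI'
    replace h1 : P.length = k := h1.trans hk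
    rw [sum_ofPiece_rightCusp, sum_dir]
    simp only [FrontPiece.morsify, opWord_cons, opWord_nil, ec]
    simp only [Pi.add_apply, Pi.smul_apply, LinearMap.add_apply, LinearMap.smul_apply,
      op_cap _ _ _ _ _ _ _ _ h1, contribution, stepState, FrontPiece.step, FrontPiece.pos,
      FrontPiece.input, FrontPiece.output, replaceAt_pair h1, toWord, result,
      List.flatMap_cons, List.flatMap_nil, FrontPiece.morsify, List.append_nil]
    obtain rfl | rfl := Dir.eq_or_eq_neg j i
    · cases j <;> simp
    -- The unoriented curl has the factor `a ^ 2 * t⁻¹`, the oriented one `a`. So a right cusp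
    -- contributes `a * t⁻¹ * capWt`, which is `a * t⁻¹` if it is oriented downward and `1`
    -- otherwise.
    · have e1 := congrArg (g (P ++ S)) (act_curl (mul_inv_cancel₀ ha) k true h1 hh)
      cases i <;> simp [curlFactor] at e1 <;> simp [e1, totalWeight, result, weight, capWt,
        FrontPiece.isLeftCuspUp, FrontPiece.isRightCuspDown] <;> field_simp
  | crossing k u v =>
    have hI' : I.length = (P ++ u :: v :: S).length := by simpa [FrontPiece.input] using hI
    obtain ⟨P, i, j, S, rfl, h1, -⟩ := exists_split_two hI'
    replace h1 : P.length = k := h1.trans hk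
    rw [sum_ofPiece_crossing]
    simp only [sum_dir]
    simp only [FrontPiece.morsify, opWord_cons, opWord_nil, op_cross _ _ _ _ _ _ _ _ _ _ h1,
      contribution, stepState, FrontPiece.step, FrontPiece.pos,
      FrontPiece.input, FrontPiece.output, replaceAt_pair h1, toWord, result,
      List.flatMap_cons, List.flatMap_nil, List.append_nil]
    cases i <;> cases j <;>
      simp [totalWeight, result, weight, spliceDir, spliceWt, turnWt, replaceAt_empty h1,
        FrontPiece.isLeftCuspUp, FrontPiece.isRightCuspDown, List.countP_cons, List.countP_nil]
    -- The vertical splice remains. Its right cusp brings a curl with factor `a` and both of its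
    -- cusps are counted: `t a⁻² (t - t⁻¹) · (a t⁻¹)² · a = (t - t⁻¹) · a t⁻¹`, which is its
    -- coefficient in `term`.
    have e1 := congrArg (act (A := F) [.cup k .west])
      (act_curl (mul_inv_cancel₀ ha) (d := .west) k true h1 hh)
    simp only [act_act, map_smul, curlFactor, if_true, neg_west, List.cons_append,
      List.nil_append] at e1
    rw [e1, map_smul, smul_eq_mul]
    field_simp
    ring

theorem opWord_front (ht : t ≠ 0) (ha : a ≠ 0) (w : List (FrontPiece Unit)) {L : List Unit}
    (hw : w.foldlM FrontPiece.step L = some []) {I : List Dir} (hI : I.length = L.length) {h : Fn F}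
    (hh : h ∈ skeinSpace F (t - t⁻¹) a I) :
    opWord t a (w.flatMap FrontPiece.morsify) (fun _ => LinearMap.proj []) I h =
      ∑ τ ∈ ofWord w, if τ.foldlM stepState I = some [] then
        totalWeight t a τ * h ((τ.flatMap result).flatMap FrontPiece.morsify) else 0 := by
  induction w generalizing L I h with
  | nil =>
    obtain rfl : L = [] := by simpa using hw
    obtain rfl := List.length_eq_zero_iff.1 hI
    simp [ofWord, totalWeight]
  | cons p w ih =>
    rw [List.foldlM_cons, Option.bind_eq_bind, Option.bind_eq_some_iff] at hw
    obtain ⟨N, h1, h2⟩ := hw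
    rw [List.flatMap_cons, opWord_append, opWord_morsify ht ha h1 _ hI hh, ofWord, Finset.sum_map,
      Finset.sum_product]
    refine Finset.sum_congr rfl fun s hs => ?_
    obtain rfl := mem_ofPiece.1 hs
    simp only [consEmbedding_apply, List.foldlM_cons, contribution]
    cases hM : s.stepState I with
    | none => simp
    | some M =>
      rw [Option.elim_some, ih h2 (length_stepState hM h1 hI) (act_mem hh (typed_toWord hM)),
        Finset.mul_sum]
      refine Finset.sum_congr rfl fun τ _ => ?_
      rw [Option.bind_eq_bind, Option.bind_some, totalWeight_cons t a s τ, mul_ite, mul_zero]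
      simp only [act_apply, toWord, List.flatMap_cons, List.flatMap_append, mul_assoc]

theorem value_morsification (ht : t ≠ 0) (ha : a ≠ 0) {φ : Fn F}
    (hφ : φ ∈ skeinSpace F (t - t⁻¹) a []) (l : Front Unit) :
    value t a φ l.morsification.word = ∑ σ : FrontState l,
      (a * t⁻¹) ^ (σ.front.leftCuspsUp + σ.front.rightCuspsDown) * σ.weight t a *
        φ σ.front.morsification.word := by
  rw [value, closedPart_of_typed _ l.morsification.closed]
  refine (opWord_front ht ha l.word l.closed rfl hφ).trans ?_
  rw [← Finset.sum_filter]
  symm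
  refine Finset.sum_bij (fun σ _ => σ.pieces) ?_ ?_ ?_ ?_
  · intro σ _
    exact Finset.mem_filter.2 ⟨mem_ofWord.2 σ.original, σ.oriented⟩
  · intro σ _ σ' _ h
    exact FrontState.ext h
  · intro τ hτ
    obtain ⟨h1, h2⟩ := Finset.mem_filter.1 hτ
    exact ⟨⟨τ, mem_ofWord.1 h1, h2⟩, Finset.mem_univ _, rfl⟩
  · intro σ _
    rfl

end Jaeger

/-! ## Existence of `D` and the state sum formula -/

section Formula

variable {F : Type*} [Field F]

theorem IsHomflyR.isSkein_eval {R : ODiagram → LaurentZA} (hR : IsHomflyR R) {z a : F}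
    (hz : z ≠ 0) (ha : a ≠ 0) :
    IsSkein z a [] (fun w => LaurentZA.evalHom hz ha (extend R w)) ∧
      ∀ d, z * LaurentZA.evalHom hz ha (extend R [.cup 0 d, .cap 0 d]) =
        circleFactor z a a⁻¹ d := by
  constructor
  · have := hR.isSkein.map (LaurentZA.evalHom hz ha)
    simpa [LaurentZA.evalHom_mono] using this
  · intro d
    have := congrArg (LaurentZA.evalHom hz ha) (hR.circle_extend d)
    rw [map_mul, circleFactor, if_neg (Dir.neg_ne d).symm] at this
    rw [circleFactor, if_neg (Dir.neg_ne d).symm]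
    simpa [LaurentZA.evalHom_mono] using this

theorem IsKauffmanD.isSkein_eval {D : UDiagram → LaurentZA} (hD : IsKauffmanD D) {z a : F}
    (hz : z ≠ 0) (ha : a ≠ 0) :
    IsSkein z a [] (fun w => LaurentZA.evalHom hz ha (extend D w)) ∧
      ∀ d, z * LaurentZA.evalHom hz ha (extend D [.cup 0 d, .cap 0 d]) =
        circleFactor z a a⁻¹ d := by
  constructor
  · have := hD.isSkein.map (LaurentZA.evalHom hz ha)
    simpa [LaurentZA.evalHom_mono] using this
  · intro d
    have := congrArg (LaurentZA.evalHom hz ha) (hD.circle_extend d)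
    rw [map_mul, circleFactor, if_pos (Subsingleton.elim _ _)] at this
    rw [circleFactor, if_pos (Subsingleton.elim _ _)]
    simpa [LaurentZA.evalHom_mono] using this

end Formula

/-- The state sum constructs `D`: built from evaluations of `R`, it is a functional of Kauffman type
at every point `(t - t⁻¹, a ^ 2 * t⁻¹)`, and rational points of this form suffice for interpolation.
-/
theorem exists_isKauffmanD : ∃ D, IsKauffmanD D := by
  obtain ⟨R, hR⟩ := exists_isHomflyR
  have hpos : ∀ m : ℕ, ((m : ℚ) + 1) ≠ 0 := fun m => by positivity
  have hy : ∀ n m : ℕ, ((m : ℚ) + 1) ^ 2 * (LaurentZA.node n)⁻¹ ≠ 0 := fun n m =>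
    mul_ne_zero (pow_ne_zero _ (hpos m)) (inv_ne_zero (LaurentZA.node_ne_zero n))
  have hφ := fun i : ℕ × ℕ => hR.isSkein_eval (LaurentZA.node_sub_inv_ne_zero i.1) (hpos i.2)
  obtain ⟨f, hf, -, hc⟩ := exists_laurent_skein (α := Unit) (fun _ _ => .inl rfl) (ι := ℕ × ℕ)
    (fun i => LaurentZA.node i.1 - (LaurentZA.node i.1)⁻¹)
    (fun i => ((i.2 : ℚ) + 1) ^ 2 * (LaurentZA.node i.1)⁻¹)
    (fun i => LaurentZA.node_sub_inv_ne_zero i.1) (fun i => hy i.1 i.2)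
    (fun p hp => LaurentZA.eq_zero_of_nodes p
      (fun n (m : ℕ) => ((m : ℚ) + 1) ^ 2 * (LaurentZA.node n)⁻¹)
      (fun n i j h => by
        -- The values chosen for `a` are positive, so their squares are distinct.
        have h1 := mul_right_cancel₀ (inv_ne_zero (LaurentZA.node_ne_zero n)) h
        have h2 := (pow_left_inj₀ (by positivity) (by positivity) two_ne_zero).1 h1
        exact_mod_cast add_right_cancel h2)
      hy fun n i => hp (n, i))
    (fun i => Jaeger.value (LaurentZA.node i.1) ((i.2 : ℚ) + 1) _)
    (fun i => Jaeger.value_mem (LaurentZA.node_ne_zero i.1) (hpos i.2) (hφ i).1)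
    (fun i => by rw [Jaeger.value_nil, extend_nil, map_one])
    (fun i d => Jaeger.value_circle (LaurentZA.node_ne_zero i.1) (hpos i.2) (hφ i).2 d)
  exact ⟨_, isKauffmanD_of_isSkein hf hc⟩

end LegendrianJaeger

theorem mainTheorem1 :
    (∃! R : ODiagram → LaurentZA, IsHomflyR R) ∧
    (∃! D : UDiagram → LaurentZA, IsKauffmanD D) ∧
    ∀ (F : Type*) [Field F] (t a : F), t ≠ 0 → a ≠ 0 → t - t⁻¹ ≠ 0 → ∀ l : Front Unit,
      (kauffmanD l.morsification).eval (t - t⁻¹) (a ^ 2 * t⁻¹) =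
        ∑ σ : FrontState l,
          (a * t⁻¹) ^ (σ.front.leftCuspsUp + σ.front.rightCuspsDown) *
            σ.weight t a *
            (homflyR σ.front.morsification).eval (t - t⁻¹) a := by
  refine ⟨?_, ?_, ?_⟩
  · obtain ⟨R, hR⟩ := exists_isHomflyR
    exact ⟨R, hR, fun R' hR' => hR'.unique hR⟩
  · obtain ⟨D, hD⟩ := exists_isKauffmanD
    exact ⟨D, hD, fun D' hD' => hD'.unique hD⟩
  · intro F _ t a ht ha hz l
    have hR : IsHomflyR homflyR := Classical.epsilon_spec exists_isHomflyR
    have hD : IsKauffmanD kauffmanD := Classical.epsilon_spec exists_isKauffmanD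
    have hy : a ^ 2 * t⁻¹ ≠ 0 := mul_ne_zero (pow_ne_zero _ ha) (inv_ne_zero ht)
    obtain ⟨r1, r2⟩ := hR.isSkein_eval hz ha
    obtain ⟨d1, d2⟩ := hD.isSkein_eval hz hy
    -- Over `F`, the evaluation of `D` and the state sum built from the evaluation of `R` are skein
    -- functionals with the same parameters and the same normalisation. Dividing by `t - t⁻¹` is
    -- allowed by `hz`.
    have key := d1.unique (fun _ _ => .inl rfl) (inv_mul_cancel₀ hz) (mul_inv_cancel₀ hy)
      (Jaeger.value_mem ht ha r1) (by rw [extend_nil, map_one])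
      (by rw [Jaeger.value_nil, extend_nil, map_one]) d2 (Jaeger.value_circle ht ha r2)
      l.morsification.closed
    rw [Jaeger.value_morsification ht ha r1, extend_word, LaurentZA.evalHom_apply] at key
    rw [key]
    refine Finset.sum_congr rfl fun σ _ => ?_
    rw [extend_word, LaurentZA.evalHom_apply]
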